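/- Let $\mathbb R^2_+=\{(x,y)\in\mathbb R^2 : y>0\}$ and, for $R>0$, $B_R^+(\boldsymbol 0)=\{\boldsymbol x\in\mathbb R^2_+ : |\boldsymbol x|<R\}$. Let $$H:=\{w\in H^1_{\mathrm{loc}}(\mathbb R^2_+) : w\in H^1(B_R^+(\boldsymbol 0))\text{ for every }R>0\},$$ and for $w\in H$ let $w(\cdot,0)$ denote its trace on the positive real axis. Let $c\in\mathbb R$ and, for $w\in H$, let $$\mathcal J(w):=\int_{\mathbb R^2_+}|\nabla w|^2\,d\boldsymbol x+\int_0^1\left(w(x,0)^2-c\,x^{-1/2}w(x,0)\right)dx+\int_1^\infty\left(w(x,0)-\frac c2x^{-1/2}\right)^2dx\in(-\infty,+\infty].$$ Then $A:=\inf\{\mathcal J(w) : w\in H\}$ is a real number, and there exists $w\in H$ with $\mathcal J(w)=A$. Furthermore, every $w\in H$ with $\mathcal J(w)=A$ is a weak solution of the mixed problem $$\Delta w=0\ \text{ in }\mathbb R^2_+,\qquad \partial_\nu w=0\ \text{ on }(-\infty,0)\times\{0\},\qquad \partial_\nu w+w=\frac c2x^{-1/2}\ \text{ on }(0,\infty)\times\{0\},$$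 that is, $$\int_{\mathbb R^2_+}\nabla w\cdot\nabla\varphi\,d\boldsymbol x+\int_0^\infty\left(w(x,0)-\frac c2x^{-1/2}\right)\varphi(x,0)\,dx=0,$$ with both integrals absolutely convergent, for every $\varphi\in H$ with $\nabla\varphi\in L^2(\mathbb R^2_+;\mathbb R^2)$ and $\varphi(\cdot,0)\in L^2((0,\infty))$. -/

import Mathlib

open MeasureTheory Filter Topology Set
open scoped ContDiff ENNReal

/-! Points of the plane are pairs `p = (x, y) : ℝ × ℝ`, with the two-dimensional Lebesgue measure.
Only squares of coordinates are used below, never the (supremum) norm of `ℝ × ℝ`. -/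

noncomputable section

namespace MixedHalfPlane

/-- The open upper half-plane. -/
def halfPlane : Set (ℝ × ℝ) := {p | 0 < p.2}

/-- The open upper half-disc of radius `R` centred at the origin. -/
def halfDisc (R : ℝ) : Set (ℝ × ℝ) := {p | p.1 ^ 2 + p.2 ^ 2 < R ^ 2 ∧ 0 < p.2}

/-- The classical gradient `(∂φ/∂x, ∂φ/∂y)`. -/
def classicalGrad (φ : ℝ × ℝ → ℝ) (p : ℝ × ℝ) : ℝ × ℝ :=
  (fderiv ℝ φ p (1, 0), fderiv ℝ φ p (0, 1))

/-- `g` is a weak (distributional) gradient of `w` in the open upper half-plane. -/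
structure IsWeakGrad (w : ℝ × ℝ → ℝ) (g : ℝ × ℝ → ℝ × ℝ) : Prop where
  locallyIntegrableOn : LocallyIntegrableOn w halfPlane
  locallyIntegrableOn_grad : LocallyIntegrableOn g halfPlane
  integral_fst : ∀ φ : ℝ × ℝ → ℝ, ContDiff ℝ ∞ φ → HasCompactSupport φ →
    tsupport φ ⊆ halfPlane →
    ∫ p in halfPlane, w p * (classicalGrad φ p).1 = -∫ p in halfPlane, (g p).1 * φ p
  integral_snd : ∀ φ : ℝ × ℝ → ℝ, ContDiff ℝ ∞ φ → HasCompactSupport φ →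
    tsupport φ ⊆ halfPlane →
    ∫ p in halfPlane, w p * (classicalGrad φ p).2 = -∫ p in halfPlane, (g p).2 * φ p

open Classical in
/-- The weak gradient of `w` in the upper half-plane. It is unique up to null sets when it exists,
as it does for every member of `H`; the value is `0` when it does not exist. -/
def weakGrad (w : ℝ × ℝ → ℝ) : ℝ × ℝ → ℝ × ℝ :=
  if h : ∃ g, IsWeakGrad w g then h.choose else 0

/-- The space `H` of the functions that are weakly differentiable in the upper half-plane and are,
together with their weak gradient, square integrable on every half-disc `B_R⁺(0)`. -/
def H : Set (ℝ × ℝ → ℝ) :=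
  {w | (∃ g, IsWeakGrad w g) ∧ ∀ R : ℝ, 0 < R →
    MemLp w 2 (volume.restrict (halfDisc R)) ∧
    MemLp (fun p => (weakGrad w p).1) 2 (volume.restrict (halfDisc R)) ∧
    MemLp (fun p => (weakGrad w p).2) 2 (volume.restrict (halfDisc R))}

/-- `τ` is the trace of `w ∈ H` on the positive real axis: on every half-disc `B_R⁺(0)` there are
functions, smooth up to the boundary, that converge to `w` in `H¹(B_R⁺(0))` and whose restrictions
to the segment `(0, R) × {0}` converge to `τ` in `L²(0, R)`. -/
def IsTrace (w : ℝ × ℝ → ℝ) (τ : ℝ → ℝ) : Prop :=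
  ∀ R : ℝ, 0 < R → MemLp τ 2 (volume.restrict (Ioo 0 R)) ∧
    ∃ φ : ℕ → ℝ × ℝ → ℝ, (∀ n, ContDiff ℝ ∞ (φ n)) ∧
      Tendsto (fun n => eLpNorm (fun p => φ n p - w p) 2 (volume.restrict (halfDisc R)))
        atTop (𝓝 0) ∧
      Tendsto (fun n => eLpNorm (fun p => (classicalGrad (φ n) p).1 - (weakGrad w p).1) 2
        (volume.restrict (halfDisc R))) atTop (𝓝 0) ∧
      Tendsto (fun n => eLpNorm (fun p => (classicalGrad (φ n) p).2 - (weakGrad w p).2) 2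
        (volume.restrict (halfDisc R))) atTop (𝓝 0) ∧
      Tendsto (fun n => eLpNorm (fun x => φ n (x, 0) - τ x) 2 (volume.restrict (Ioo 0 R)))
        atTop (𝓝 0)

open Classical in
/-- The trace `w(·, 0)` of `w` on the positive real axis. By the trace theorem it exists for every
`w ∈ H`, and it is unique up to null sets; off `H` the value may be the default `0`. -/
def trace (w : ℝ × ℝ → ℝ) : ℝ → ℝ :=
  if h : ∃ τ, IsTrace w τ then h.choose else 0

/-- The functional
`J(w) = ∫_{ℝ²₊} |∇w|² + ∫₀¹ (w(x,0)² - c x^{-1/2} w(x,0)) dx + ∫₁^∞ (w(x,0) - (c/2) x^{-1/2})² dx`.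
The first and the last term may be `+∞`; the integrand of the middle term is integrable on `(0, 1)`
for every `w ∈ H`. -/
def J (c : ℝ) (w : ℝ × ℝ → ℝ) : EReal :=
  ((∫⁻ p in halfPlane, ENNReal.ofReal ((weakGrad w p).1 ^ 2 + (weakGrad w p).2 ^ 2) : ℝ≥0∞) : EReal)
  + ((∫ x in Ioo (0 : ℝ) 1,
      (trace w x ^ 2 - c * x ^ (-(1 / 2) : ℝ) * trace w x) : ℝ) : EReal)
  + ((∫⁻ x in Ioi (1 : ℝ),
      ENNReal.ofReal ((trace w x - c / 2 * x ^ (-(1 / 2) : ℝ)) ^ 2) : ℝ≥0∞) : EReal)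

/-- The infimum of `J` over `H`, in the extended reals. -/
def A (c : ℝ) : EReal := ⨅ w ∈ H, J c w

/-- `w` is a weak solution of the mixed Neumann-Robin problem
`Δw = 0` in `ℝ²₊`, `∂_ν w = 0` on `(-∞, 0) × {0}`,
`∂_ν w + w = (c/2) x^{-1/2}` on `(0, ∞) × {0}`:
`∫_{ℝ²₊} ∇w · ∇φ + ∫₀^∞ (w(x,0) - (c/2) x^{-1/2}) φ(x,0) dx = 0`
for every `φ ∈ H` with `∇φ ∈ L²(ℝ²₊)` and with trace `ζ = φ(·,0) ∈ L²(0,∞)`, where both integrals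
converge absolutely. All functions in `H` that vanish off a half-disc, and in particular all
restrictions of functions in `C_c^∞(ℝ²)`, are among these test functions. -/
def IsWeakSolution (c : ℝ) (w : ℝ × ℝ → ℝ) : Prop :=
  ∀ φ ∈ H, ∀ ζ : ℝ → ℝ, IsTrace φ ζ →
    MemLp (fun p => (weakGrad φ p).1) 2 (volume.restrict halfPlane) →
    MemLp (fun p => (weakGrad φ p).2) 2 (volume.restrict halfPlane) →
    MemLp ζ 2 (volume.restrict (Ioi 0)) →
    IntegrableOn (fun p => (weakGrad w p).1 * (weakGrad φ p).1
      + (weakGrad w p).2 * (weakGrad φ p).2) halfPlane ∧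
    IntegrableOn (fun x => (trace w x - c / 2 * x ^ (-(1 / 2) : ℝ)) * ζ x) (Ioi 0) ∧
    (∫ p in halfPlane, ((weakGrad w p).1 * (weakGrad φ p).1
      + (weakGrad w p).2 * (weakGrad φ p).2))
      + ∫ x in Ioi (0 : ℝ), (trace w x - c / 2 * x ^ (-(1 / 2) : ℝ)) * ζ x = 0

end MixedHalfPlane

end

/-!
The argument takes place in the Hilbert space `EnergySpace = L²(ℝ²₊)² × L²(0, ∞)`. A function `w ∈ H`
with `J c w < ∞` is represented there by `k = (∂w/∂x, ∂w/∂y, w(·, 0) - (c/2) x ^ (-1/2) 1_{x > 1})`,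
and then `J c w = ‖k‖² - c ∫₀¹ x ^ (-1/2) w(x, 0) dx` (`J_eq`). If the last integral is a bounded
linear functional `⟨f, k⟩` of `k`, completing the square turns `J c w` into the squared distance of
`k` to `(c/2) f`, up to an additive constant. The representatives form a closed, convex, nonempty
(indeed affine) set, so the distance is attained, and the vanishing of its first variation is the
weak formulation. Four facts carry the proof.

* **Boundedness of the linear term** (`lintegral_weight_mul_le`). The weight `x ^ (-1/2)` just fails
  to be square integrable on `(0, 1)`, so the `L²` bound on the trace does not suffice and the
  gradient is needed. The point `(x, 0)` is joined to `(t, 0)` by the path through `(x, √x)` and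
  `(t, √x)`, and the fundamental theorem of calculus along it is averaged over `t`. The theorems of
  Hahn-Banach and Riesz then give `f` (`exists_forall_weightIntegral_eq_inner`).
* **Completeness** (`exists_mem_H_of_tendsto`). By a Poincaré inequality with a boundary term on the
  positive axis (`exists_poincare_bound`), convergence of gradients and traces implies convergence in
  `L²` of every half-disc; the weak gradient is a closed operator, and the trace inequality
  (`exists_trace_bound`) identifies the trace of the limit.
* **Traces** (`exists_isTrace`). The estimates are proved for smooth functions by integration along
  segments, and pass to `H` by density (`exists_isApprox`): mollification with kernels supported
  below the axis evaluates a function of `ℝ²₊` only at points of `ℝ²₊`, so that no extension across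
  the boundary is needed.
* **Nonemptiness** (`exists_represents_profile`). The function `(1 + |x|²) ^ (-1/4)` has a square
  integrable gradient and equals `x ^ (-1/2)` on the axis up to a square integrable error at infinity.
-/

namespace MixedHalfPlane

/-! ### Half-discs and rectangles -/

theorem isOpen_halfPlane : IsOpen halfPlane := isOpen_lt continuous_const continuous_snd

theorem isOpen_halfDisc (R : ℝ) : IsOpen (halfDisc R) :=
  (isOpen_lt (f := fun p : ℝ × ℝ => p.1 ^ 2 + p.2 ^ 2) (g := fun _ => R ^ 2) (by fun_prop)
    (by fun_prop)).inter isOpen_halfPlane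

theorem measurableSet_halfPlane : MeasurableSet halfPlane := isOpen_halfPlane.measurableSet

theorem measurableSet_halfDisc (R : ℝ) : MeasurableSet (halfDisc R) :=
  (isOpen_halfDisc R).measurableSet

theorem halfDisc_subset_halfPlane (R : ℝ) : halfDisc R ⊆ halfPlane := fun _ hp => hp.2

theorem halfDisc_mono {R S : ℝ} (hR : 0 ≤ R) (h : R ≤ S) : halfDisc R ⊆ halfDisc S :=
  fun _ hp => ⟨hp.1.trans_le (pow_le_pow_left₀ hR h 2), hp.2⟩

/-- The rectangle `(-R, R) × (0, R)`, on which the estimates for smooth functions are carried out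
by integration along horizontal and vertical segments. -/
def rect (R : ℝ) : Set (ℝ × ℝ) := Ioo (-R) R ×ˢ Ioo 0 R

theorem halfDisc_subset_rect {R : ℝ} (hR : 0 < R) : halfDisc R ⊆ rect R := by
  rintro ⟨x, y⟩ ⟨h1, h2⟩
  simp only at h1 h2
  have hx := abs_lt_of_sq_lt_sq' (a := x) (b := R) (by nlinarith [sq_nonneg y]) hR.le
  have hy := abs_lt_of_sq_lt_sq' (a := y) (b := R) (by nlinarith [sq_nonneg x]) hR.le
  exact ⟨hx, h2, hy.2⟩

theorem rect_subset_halfDisc {R : ℝ} (hR : 0 < R) : rect R ⊆ halfDisc (2 * R) := by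
  rintro ⟨x, y⟩ ⟨⟨h1, h2⟩, h3, h4⟩
  simp only at h1 h2 h3 h4
  refine ⟨?_, h3⟩
  simp only
  nlinarith

instance isFiniteMeasure_restrict_halfDisc (R : ℝ) :
    IsFiniteMeasure (volume.restrict (halfDisc R)) := by
  refine ⟨?_⟩
  rw [Measure.restrict_apply_univ]
  have h1 : halfDisc R ⊆ rect (|R| + 1) :=
    fun p hp => halfDisc_subset_rect (by positivity)
      ⟨hp.1.trans_le (by rw [← sq_abs]; exact pow_le_pow_left₀ (abs_nonneg R) (by linarith) 2), hp.2⟩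
  refine (measure_mono h1).trans_lt ?_
  have : rect (|R| + 1) ⊆ Icc (-(|R| + 1)) (|R| + 1) ×ˢ Icc 0 (|R| + 1) :=
    prod_mono Ioo_subset_Icc_self Ioo_subset_Icc_self
  exact (measure_mono this).trans_lt (isCompact_Icc.prod isCompact_Icc).measure_lt_top

theorem exists_mem_halfDisc {p : ℝ × ℝ} (hp : p ∈ halfPlane) : ∃ n : ℕ, p ∈ halfDisc (n + 1 : ℝ) := by
  obtain ⟨n, hn⟩ := exists_nat_gt (p.1 ^ 2 + p.2 ^ 2)
  refine ⟨n, ?_, hp⟩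
  have : (0 : ℝ) ≤ n := n.cast_nonneg
  nlinarith

theorem ae_halfDisc_of_halfPlane {P : ℝ × ℝ → Prop} {R : ℝ}
    (h : ∀ᵐ p ∂volume.restrict halfPlane, P p) : ∀ᵐ p ∂volume.restrict (halfDisc R), P p :=
  ae_restrict_of_ae_restrict_of_subset (halfDisc_subset_halfPlane R) h

/-! ### Square norms -/

theorem eLpNorm_two_sq {α : Type*} [MeasurableSpace α] {μ : Measure α} (f : α → ℝ) :
    eLpNorm f 2 μ ^ 2 = ∫⁻ x, ‖f x‖ₑ ^ 2 ∂μ := by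
  rw [eLpNorm_eq_lintegral_rpow_enorm_toReal (by norm_num) (by norm_num), ← ENNReal.rpow_natCast,
    ← ENNReal.rpow_mul]
  norm_num

/-- Convergence in `L²` gives convergence of the squared norms. -/
theorem tendsto_eLpNorm_sq {α : Type*} [MeasurableSpace α] {μ : Measure α} {f : ℕ → α → ℝ}
    {g : α → ℝ} (hf : ∀ n, AEStronglyMeasurable (f n) μ) (hg : MemLp g 2 μ)
    (h : Tendsto (fun n => eLpNorm (fun x => f n x - g x) 2 μ) atTop (𝓝 0)) :
    Tendsto (fun n => eLpNorm (f n) 2 μ ^ 2) atTop (𝓝 (eLpNorm g 2 μ ^ 2)) := by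
  refine ENNReal.Tendsto.pow ?_
  have h1 : Tendsto (fun n => eLpNorm g 2 μ - eLpNorm (fun x => f n x - g x) 2 μ) atTop
      (𝓝 (eLpNorm g 2 μ)) := by
    simpa using ENNReal.Tendsto.sub (tendsto_const_nhds (x := eLpNorm g 2 μ)) h
      (Or.inl hg.eLpNorm_ne_top)
  have h2 : Tendsto (fun n => eLpNorm g 2 μ + eLpNorm (fun x => f n x - g x) 2 μ) atTop
      (𝓝 (eLpNorm g 2 μ)) := by
    simpa using Tendsto.add (tendsto_const_nhds (x := eLpNorm g 2 μ)) h
  refine tendsto_of_tendsto_of_tendsto_of_le_of_le h1 h2 (fun n => ?_) (fun n => ?_)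
  · rw [tsub_le_iff_right]
    have e : g = f n - (fun x => f n x - g x) := by ext x; simp
    calc eLpNorm g 2 μ = eLpNorm (f n - (fun x => f n x - g x)) 2 μ := by rw [← e]
      _ ≤ _ := eLpNorm_sub_le (hf n) ((hf n).sub hg.1) (by norm_num)
  · have e : f n = g + (fun x => f n x - g x) := by ext x; simp
    calc eLpNorm (f n) 2 μ = eLpNorm (g + (fun x => f n x - g x)) 2 μ := by rw [← e]
      _ ≤ _ := eLpNorm_add_le hg.1 ((hf n).sub hg.1) (by norm_num)

/-! ### Weak gradients and the space `H` -/

theorem integrableOn_mul_of_tsupport_subset {f ψ : ℝ × ℝ → ℝ}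
    (hf : LocallyIntegrableOn f halfPlane) (hψ : Continuous ψ) (hc : HasCompactSupport ψ)
    (hs : tsupport ψ ⊆ halfPlane) : Integrable (fun p => f p * ψ p) := by
  have h1 : IntegrableOn (fun p => f p * ψ p) (tsupport ψ) :=
    (hf.integrableOn_compact_subset hs hc).mul_continuousOn hψ.continuousOn hc
  rw [← integrableOn_iff_integrable_of_support_subset (s := tsupport ψ)]
  · exact h1
  · intro p hp
    exact subset_tsupport ψ (right_ne_zero_of_mul hp)

theorem contDiff_classicalGrad {φ : ℝ × ℝ → ℝ} (h : ContDiff ℝ ∞ φ) :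
    ContDiff ℝ ∞ (classicalGrad φ) := by
  have : ContDiff ℝ ∞ (fderiv ℝ φ) := h.fderiv_right (by simp)
  exact (this.clm_apply contDiff_const).prodMk (this.clm_apply contDiff_const)

theorem continuous_classicalGrad {φ : ℝ × ℝ → ℝ} (h : ContDiff ℝ ∞ φ) :
    Continuous (classicalGrad φ) := (contDiff_classicalGrad h).continuous

theorem tsupport_fderiv_apply_subset (φ : ℝ × ℝ → ℝ) (v : ℝ × ℝ) :
    tsupport (fun p => fderiv ℝ φ p v) ⊆ tsupport φ := by
  refine closure_minimal (fun p hp => ?_) (isClosed_tsupport φ)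
  refine support_fderiv_subset ℝ (f := φ) ?_
  intro h
  exact hp (by simp [h])

theorem hasCompactSupport_fderiv_apply {φ : ℝ × ℝ → ℝ} (h : HasCompactSupport φ) (v : ℝ × ℝ) :
    HasCompactSupport (fun p => fderiv ℝ φ p v) :=
  IsCompact.of_isClosed_subset h (isClosed_tsupport _) (tsupport_fderiv_apply_subset φ v)

theorem LocallyIntegrableOn.fst {g : ℝ × ℝ → ℝ × ℝ} (h : LocallyIntegrableOn g halfPlane) :
    LocallyIntegrableOn (fun p => (g p).1) halfPlane := fun p hp => by
  obtain ⟨s, hs, hi⟩ := h p hp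
  exact ⟨s, hs, hi.fst⟩

theorem LocallyIntegrableOn.snd {g : ℝ × ℝ → ℝ × ℝ} (h : LocallyIntegrableOn g halfPlane) :
    LocallyIntegrableOn (fun p => (g p).2) halfPlane := fun p hp => by
  obtain ⟨s, hs, hi⟩ := h p hp
  exact ⟨s, hs, hi.snd⟩

theorem ae_eq_of_forall_integral_mul_eq {f f' : ℝ × ℝ → ℝ} (hf : LocallyIntegrableOn f halfPlane)
    (hf' : LocallyIntegrableOn f' halfPlane)
    (h : ∀ φ : ℝ × ℝ → ℝ, ContDiff ℝ ∞ φ → HasCompactSupport φ → tsupport φ ⊆ halfPlane →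
      ∫ p in halfPlane, f p * φ p = ∫ p in halfPlane, f' p * φ p) :
    f =ᵐ[volume.restrict halfPlane] f' := by
  have key := isOpen_halfPlane.ae_eq_zero_of_integral_contDiff_smul_eq_zero (μ := volume)
    (hf.sub hf') (fun φ h1 h2 h3 => ?_)
  · rw [EventuallyEq, ae_restrict_iff' measurableSet_halfPlane]
    filter_upwards [key] with p hp hpm
    have := hp hpm
    simpa [sub_eq_zero] using this
  · have i1 := integrableOn_mul_of_tsupport_subset hf h1.continuous h2 h3
    have i2 := integrableOn_mul_of_tsupport_subset hf' h1.continuous h2 h3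
    have e := h φ h1 h2 h3
    have hsupp : ∀ u : ℝ × ℝ → ℝ, ∫ p in halfPlane, u p * φ p = ∫ p, u p * φ p := fun u =>
      setIntegral_eq_integral_of_forall_compl_eq_zero fun p hp => by
        rw [image_eq_zero_of_notMem_tsupport fun hp' => hp (h3 hp'), mul_zero]
    rw [hsupp, hsupp] at e
    calc ∫ p, φ p • (f - f') p = ∫ p, (f p * φ p - f' p * φ p) := by
          congr 1; ext p; simp; ring
      _ = 0 := by rw [integral_sub i1 i2, e, sub_self]

/-- The weak gradient is unique up to null sets. -/
theorem IsWeakGrad.ae_eq {w : ℝ × ℝ → ℝ} {g g' : ℝ × ℝ → ℝ × ℝ} (h : IsWeakGrad w g)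
    (h' : IsWeakGrad w g') : g =ᵐ[volume.restrict halfPlane] g' := by
  have e1 := ae_eq_of_forall_integral_mul_eq (LocallyIntegrableOn.fst h.locallyIntegrableOn_grad)
    (LocallyIntegrableOn.fst h'.locallyIntegrableOn_grad) fun φ h1 h2 h3 => by
      rw [← neg_inj, ← h.integral_fst φ h1 h2 h3, h'.integral_fst φ h1 h2 h3]
  have e2 := ae_eq_of_forall_integral_mul_eq (LocallyIntegrableOn.snd h.locallyIntegrableOn_grad)
    (LocallyIntegrableOn.snd h'.locallyIntegrableOn_grad) fun φ h1 h2 h3 => by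
      rw [← neg_inj, ← h.integral_snd φ h1 h2 h3, h'.integral_snd φ h1 h2 h3]
  filter_upwards [e1, e2] with p h1 h2
  exact Prod.ext h1 h2

theorem IsWeakGrad.isWeakGrad_weakGrad {w : ℝ × ℝ → ℝ} {g : ℝ × ℝ → ℝ × ℝ} (h : IsWeakGrad w g) :
    IsWeakGrad w (weakGrad w) := by
  have hex : ∃ g, IsWeakGrad w g := ⟨g, h⟩
  rw [weakGrad, dif_pos hex]
  exact hex.choose_spec

theorem IsWeakGrad.weakGrad_ae_eq {w : ℝ × ℝ → ℝ} {g : ℝ × ℝ → ℝ × ℝ} (h : IsWeakGrad w g) :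
    weakGrad w =ᵐ[volume.restrict halfPlane] g := h.isWeakGrad_weakGrad.ae_eq h

theorem isWeakGrad_of_mem_H {w : ℝ × ℝ → ℝ} (hw : w ∈ H) : IsWeakGrad w (weakGrad w) :=
  hw.1.choose_spec.isWeakGrad_weakGrad

theorem mem_H_of_isWeakGrad {w : ℝ × ℝ → ℝ} {g : ℝ × ℝ → ℝ × ℝ} (h : IsWeakGrad w g)
    (hL : ∀ R : ℝ, 0 < R → MemLp w 2 (volume.restrict (halfDisc R)) ∧
      MemLp (fun p => (g p).1) 2 (volume.restrict (halfDisc R)) ∧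
      MemLp (fun p => (g p).2) 2 (volume.restrict (halfDisc R))) : w ∈ H := by
  refine ⟨⟨g, h⟩, fun R hR => ⟨(hL R hR).1, ?_, ?_⟩⟩
  · exact (hL R hR).2.1.ae_eq (ae_halfDisc_of_halfPlane (h.weakGrad_ae_eq.symm.mono
      fun p hp => by simp only [hp]))
  · exact (hL R hR).2.2.ae_eq (ae_halfDisc_of_halfPlane (h.weakGrad_ae_eq.symm.mono
      fun p hp => by simp only [hp]))

theorem locallyIntegrableOn_of_memLp_halfDisc {f : ℝ × ℝ → ℝ}
    (h : ∀ R : ℝ, 0 < R → MemLp f 2 (volume.restrict (halfDisc R))) :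
    LocallyIntegrableOn f halfPlane := fun p hp => by
  obtain ⟨n, hn⟩ := exists_mem_halfDisc hp
  refine ⟨halfDisc (n + 1), mem_nhdsWithin_of_mem_nhds ((isOpen_halfDisc _).mem_nhds hn), ?_⟩
  exact (h _ (by positivity)).integrable (by norm_num)

theorem IsWeakGrad.add_smul {w v : ℝ × ℝ → ℝ} {g k : ℝ × ℝ → ℝ × ℝ} (hw : IsWeakGrad w g)
    (hv : IsWeakGrad v k) (t : ℝ) :
    IsWeakGrad (fun p => w p + t * v p) (fun p => g p + t • k p) where
  locallyIntegrableOn := hw.locallyIntegrableOn.add (hv.locallyIntegrableOn.smul t)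
  locallyIntegrableOn_grad := hw.locallyIntegrableOn_grad.add (hv.locallyIntegrableOn_grad.smul t)
  integral_fst φ h1 h2 h3 := by
    have c1 : Continuous fun p => (classicalGrad φ p).1 := (continuous_classicalGrad h1).fst
    have s1 := tsupport_fderiv_apply_subset φ (1, 0)
    have k1 := hasCompactSupport_fderiv_apply h2 (1, 0)
    have i1 := (integrableOn_mul_of_tsupport_subset hw.locallyIntegrableOn c1 k1
      (s1.trans h3)).integrableOn (s := halfPlane)
    have i2 := (integrableOn_mul_of_tsupport_subset hv.locallyIntegrableOn c1 k1
      (s1.trans h3)).integrableOn (s := halfPlane)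
    have i3 := (integrableOn_mul_of_tsupport_subset (LocallyIntegrableOn.fst
      hw.locallyIntegrableOn_grad) h1.continuous h2 h3).integrableOn (s := halfPlane)
    have i4 := (integrableOn_mul_of_tsupport_subset (LocallyIntegrableOn.fst
      hv.locallyIntegrableOn_grad) h1.continuous h2 h3).integrableOn (s := halfPlane)
    simp only [Prod.fst_add, Prod.smul_fst, smul_eq_mul, add_mul, mul_assoc]
    rw [integral_add i1 (i2.const_mul t), integral_add i3 (i4.const_mul t), integral_const_mul,
      integral_const_mul, hw.integral_fst φ h1 h2 h3, hv.integral_fst φ h1 h2 h3]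
    ring
  integral_snd φ h1 h2 h3 := by
    have c1 : Continuous fun p => (classicalGrad φ p).2 := (continuous_classicalGrad h1).snd
    have s1 := tsupport_fderiv_apply_subset φ (0, 1)
    have k1 := hasCompactSupport_fderiv_apply h2 (0, 1)
    have i1 := (integrableOn_mul_of_tsupport_subset hw.locallyIntegrableOn c1 k1
      (s1.trans h3)).integrableOn (s := halfPlane)
    have i2 := (integrableOn_mul_of_tsupport_subset hv.locallyIntegrableOn c1 k1
      (s1.trans h3)).integrableOn (s := halfPlane)
    have i3 := (integrableOn_mul_of_tsupport_subset (LocallyIntegrableOn.snd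
      hw.locallyIntegrableOn_grad) h1.continuous h2 h3).integrableOn (s := halfPlane)
    have i4 := (integrableOn_mul_of_tsupport_subset (LocallyIntegrableOn.snd
      hv.locallyIntegrableOn_grad) h1.continuous h2 h3).integrableOn (s := halfPlane)
    simp only [Prod.snd_add, Prod.smul_snd, smul_eq_mul, add_mul, mul_assoc]
    rw [integral_add i1 (i2.const_mul t), integral_add i3 (i4.const_mul t), integral_const_mul,
      integral_const_mul, hw.integral_snd φ h1 h2 h3, hv.integral_snd φ h1 h2 h3]
    ring

theorem add_smul_mem_H {w v : ℝ × ℝ → ℝ} (hw : w ∈ H) (hv : v ∈ H) (t : ℝ) :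
    (fun p => w p + t * v p) ∈ H :=
  mem_H_of_isWeakGrad ((isWeakGrad_of_mem_H hw).add_smul (isWeakGrad_of_mem_H hv) t) fun R hR =>
    ⟨(hw.2 R hR).1.add ((hv.2 R hR).1.const_mul t),
      (hw.2 R hR).2.1.add ((hv.2 R hR).2.1.const_mul t),
      (hw.2 R hR).2.2.add ((hv.2 R hR).2.2.const_mul t)⟩

theorem weakGrad_add_smul {w v : ℝ × ℝ → ℝ} (hw : w ∈ H) (hv : v ∈ H) (t : ℝ) :
    weakGrad (fun p => w p + t * v p)
      =ᵐ[volume.restrict halfPlane] fun p => weakGrad w p + t • weakGrad v p :=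
  ((isWeakGrad_of_mem_H hw).add_smul (isWeakGrad_of_mem_H hv) t).weakGrad_ae_eq

/-- Smooth functions have their classical gradient as weak gradient. -/
theorem isWeakGrad_classicalGrad {u : ℝ × ℝ → ℝ} (hu : ContDiff ℝ ∞ u) :
    IsWeakGrad u (classicalGrad u) := by
  have hloc : LocallyIntegrableOn u halfPlane :=
    hu.continuous.locallyIntegrable.locallyIntegrableOn _
  have hlocg : LocallyIntegrableOn (classicalGrad u) halfPlane :=
    (continuous_classicalGrad hu).locallyIntegrable.locallyIntegrableOn _
  have key : ∀ (v : ℝ × ℝ) (φ : ℝ × ℝ → ℝ), ContDiff ℝ ∞ φ → HasCompactSupport φ →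
      tsupport φ ⊆ halfPlane → ∫ p in halfPlane, u p * fderiv ℝ φ p v
        = -∫ p in halfPlane, fderiv ℝ u p v * φ p := by
    intro v φ h1 h2 h3
    have cu : Continuous fun p => fderiv ℝ u p v :=
      (hu.continuous_fderiv (by simp)).clm_apply continuous_const
    have cφ : Continuous fun p => fderiv ℝ φ p v :=
      (h1.continuous_fderiv (by simp)).clm_apply continuous_const
    have h4 := tsupport_fderiv_apply_subset φ v
    rw [setIntegral_eq_integral_of_forall_compl_eq_zero fun p hp => by
        rw [image_eq_zero_of_notMem_tsupport fun hp' => hp (h3 (h4 hp')), mul_zero],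
      setIntegral_eq_integral_of_forall_compl_eq_zero fun p hp => by
        rw [image_eq_zero_of_notMem_tsupport fun hp' => hp (h3 hp'), mul_zero]]
    refine integral_mul_fderiv_eq_neg_fderiv_mul_of_integrable ?_ ?_ ?_
      (fun p _ => hu.differentiable (by simp) p) (fun p _ => h1.differentiable (by simp) p)
    · exact integrableOn_mul_of_tsupport_subset (cu.locallyIntegrable.locallyIntegrableOn _)
        h1.continuous h2 h3
    · exact integrableOn_mul_of_tsupport_subset hloc cφ (hasCompactSupport_fderiv_apply h2 v)
        (h4.trans h3)
    · exact integrableOn_mul_of_tsupport_subset hloc h1.continuous h2 h3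
  exact ⟨hloc, hlocg, key (1, 0), key (0, 1)⟩

theorem memLp_halfDisc_of_continuous {u : ℝ × ℝ → ℝ} (hu : Continuous u) (R : ℝ) (p : ℝ≥0∞) :
    MemLp u p (volume.restrict (halfDisc R)) := by
  have hs : halfDisc R ⊆ Icc (-|R|) |R| ×ˢ Icc (-|R|) |R| := fun q hq =>
    ⟨abs_le.1 (sq_le_sq.1 (by nlinarith [hq.1, sq_nonneg q.2])),
      abs_le.1 (sq_le_sq.1 (by nlinarith [hq.1, sq_nonneg q.1]))⟩
  obtain ⟨C, hC⟩ := ((isCompact_Icc (a := -|R|) (b := |R|)).prod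
    (isCompact_Icc (a := -|R|) (b := |R|))).exists_bound_of_continuousOn hu.continuousOn
  refine MemLp.of_bound hu.aestronglyMeasurable C ?_
  filter_upwards [ae_restrict_mem (measurableSet_halfDisc R)] with q hq using hC q (hs hq)

theorem mem_H_of_contDiff {u : ℝ × ℝ → ℝ} (hu : ContDiff ℝ ∞ u) : u ∈ H :=
  mem_H_of_isWeakGrad (isWeakGrad_classicalGrad hu) fun R _ =>
    ⟨memLp_halfDisc_of_continuous hu.continuous R 2,
      memLp_halfDisc_of_continuous (continuous_classicalGrad hu).fst R 2,
      memLp_halfDisc_of_continuous (continuous_classicalGrad hu).snd R 2⟩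

/-! ### Estimates for smooth functions -/

theorem ennreal_add_sq_le (a b : ℝ≥0∞) : (a + b) ^ 2 ≤ 4 * (a ^ 2 + b ^ 2) := by
  have h : a + b ≤ 2 * max a b := by
    rw [two_mul]; exact add_le_add (le_max_left _ _) (le_max_right _ _)
  calc (a + b) ^ 2 ≤ (2 * max a b) ^ 2 := pow_le_pow_left' h 2
    _ = 4 * max a b ^ 2 := by rw [mul_pow]; norm_num
    _ ≤ 4 * (a ^ 2 + b ^ 2) := by
      gcongr
      rcases max_choice a b with h | h <;> rw [h]
      · exact le_self_add
      · exact le_add_self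

theorem ennreal_mul_le_sq_add_sq (a b : ℝ≥0∞) : a * b ≤ a ^ 2 + b ^ 2 := by
  rcases le_total a b with h | h
  · calc a * b ≤ b * b := by gcongr
      _ ≤ _ := by rw [sq b]; exact le_add_self
  · calc a * b ≤ a * a := by gcongr
      _ ≤ _ := by rw [sq a]; exact le_self_add

theorem ennreal_le_one_add_sq (a : ℝ≥0∞) : a ≤ 1 + a ^ 2 := by
  simpa using ennreal_mul_le_sq_add_sq 1 a

theorem lintegral_sq_le {α : Type*} [MeasurableSpace α] {μ : Measure α} {f : α → ℝ≥0∞}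
    (hf : AEMeasurable f μ) : (∫⁻ x, f x ∂μ) ^ 2 ≤ μ univ * ∫⁻ x, f x ^ 2 ∂μ := by
  have h := ENNReal.lintegral_mul_le_Lp_mul_Lq μ Real.HolderConjugate.two_two hf
    (aemeasurable_const (b := (1 : ℝ≥0∞)))
  simp only [Pi.mul_apply, mul_one, ENNReal.one_rpow, lintegral_one] at h
  calc (∫⁻ x, f x ∂μ) ^ 2 ≤ _ := pow_le_pow_left' h 2
    _ = _ := by
      rw [mul_pow, ← ENNReal.rpow_natCast, ← ENNReal.rpow_natCast, ← ENNReal.rpow_mul,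
        ← ENNReal.rpow_mul]
      norm_num [mul_comm]

theorem enorm_le_add_lintegral_deriv {f f' : ℝ → ℝ} (h : ∀ x, HasDerivAt f (f' x) x)
    (hc : Continuous f') {a b : ℝ} {s : Set ℝ} (hs : uIoc a b ⊆ s) :
    ‖f b‖ₑ ≤ ‖f a‖ₑ + ∫⁻ u in s, ‖f' u‖ₑ := by
  have e : f b = f a + ∫ u in a..b, f' u := by
    rw [intervalIntegral.integral_eq_sub_of_hasDerivAt (fun x _ => h x) (hc.intervalIntegrable a b)]
    ring
  calc ‖f b‖ₑ ≤ ‖f a‖ₑ + ‖∫ u in a..b, f' u‖ₑ := by rw [e]; exact enorm_add_le _ _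
    _ ≤ ‖f a‖ₑ + ∫⁻ u in s, ‖f' u‖ₑ := by
      gcongr
      calc ‖∫ u in a..b, f' u‖ₑ = ‖∫ u in uIoc a b, f' u‖ₑ := by
            simp only [enorm_eq_nnnorm, ENNReal.coe_inj, ← NNReal.coe_inj, coe_nnnorm,
              intervalIntegral.norm_intervalIntegral_eq]
        _ ≤ ∫⁻ u in uIoc a b, ‖f' u‖ₑ := enorm_integral_le_lintegral_enorm _
        _ ≤ _ := lintegral_mono_set hs

theorem hasDerivAt_fst {φ : ℝ × ℝ → ℝ} (h : ContDiff ℝ ∞ φ) (x y : ℝ) :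
    HasDerivAt (fun u => φ (u, y)) (classicalGrad φ (x, y)).1 x :=
  ((h.differentiable (by simp) (x, y)).hasFDerivAt).comp_hasDerivAt x
    ((hasDerivAt_id x).prodMk (hasDerivAt_const x y))

theorem hasDerivAt_snd {φ : ℝ × ℝ → ℝ} (h : ContDiff ℝ ∞ φ) (x y : ℝ) :
    HasDerivAt (fun u => φ (x, u)) (classicalGrad φ (x, y)).2 y :=
  ((h.differentiable (by simp) (x, y)).hasFDerivAt).comp_hasDerivAt y
    ((hasDerivAt_const y x).prodMk (hasDerivAt_id y))

theorem setLIntegral_prod_eq {s t : Set ℝ} {F : ℝ × ℝ → ℝ≥0∞}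
    (hF : AEMeasurable F (volume.restrict (s ×ˢ t))) :
    ∫⁻ p in s ×ˢ t, F p = ∫⁻ x in s, ∫⁻ y in t, F (x, y) := by
  rw [Measure.volume_eq_prod, ← Measure.prod_restrict] at hF ⊢
  exact lintegral_prod F hF

theorem setLIntegral_prod_symm_eq {s t : Set ℝ} {F : ℝ × ℝ → ℝ≥0∞}
    (hF : AEMeasurable F (volume.restrict (s ×ˢ t))) :
    ∫⁻ p in s ×ˢ t, F p = ∫⁻ y in t, ∫⁻ x in s, F (x, y) := by
  rw [Measure.volume_eq_prod, ← Measure.prod_restrict] at hF ⊢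
  exact lintegral_prod_symm F hF

theorem square_subset_rect {R : ℝ} (hR : 0 < R) : Ioo 0 R ×ˢ Ioo 0 R ⊆ rect R :=
  prod_mono (Ioo_subset_Ioo_left (by linarith)) le_rfl

section Smooth

variable {φ : ℝ × ℝ → ℝ}

theorem enorm_le_vertical (h : ContDiff ℝ ∞ φ) {R : ℝ} (x : ℝ) {a b : ℝ} (hs : uIoc a b ⊆ Ioo 0 R) :
    ‖φ (x, b)‖ₑ ≤ ‖φ (x, a)‖ₑ + ∫⁻ u in Ioo 0 R, ‖(classicalGrad φ (x, u)).2‖ₑ :=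
  enorm_le_add_lintegral_deriv (fun y => hasDerivAt_snd h x y)
    ((continuous_classicalGrad h).snd.comp (by fun_prop)) hs

theorem enorm_le_horizontal (h : ContDiff ℝ ∞ φ) (y : ℝ) {a b : ℝ} {s : Set ℝ}
    (hs : uIoc a b ⊆ s) :
    ‖φ (b, y)‖ₑ ≤ ‖φ (a, y)‖ₑ + ∫⁻ u in s, ‖(classicalGrad φ (u, y)).1‖ₑ :=
  enorm_le_add_lintegral_deriv (fun x => hasDerivAt_fst h x y)
    ((continuous_classicalGrad h).fst.comp (by fun_prop)) hs

theorem uIoc_zero_subset {R y : ℝ} (hy : y ∈ Ioo 0 R) : uIoc 0 y ⊆ Ioo 0 R := by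
  rw [uIoc_of_le hy.1.le]
  exact fun u hu => ⟨hu.1, hu.2.trans_lt hy.2⟩

theorem uIoc_subset_Ioo {a b x y : ℝ} (hx : x ∈ Ioo a b) (hy : y ∈ Ioo a b) :
    uIoc x y ⊆ Ioo a b := fun _ hu =>
  ⟨(lt_min hx.1 hy.1).trans hu.1, hu.2.trans_lt (max_lt hx.2 hy.2)⟩

theorem lintegral_enorm_sq_Ioo_le {f : ℝ → ℝ} (hf : Continuous f) {a b : ℝ} :
    (∫⁻ u in Ioo a b, ‖f u‖ₑ) ^ 2 ≤ ENNReal.ofReal (b - a) * ∫⁻ u in Ioo a b, ‖f u‖ₑ ^ 2 := by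
  have := lintegral_sq_le (μ := volume.restrict (Ioo a b)) hf.enorm.measurable.aemeasurable
  rwa [Measure.restrict_apply_univ, Real.volume_Ioo] at this

/-- Trace inequality for smooth functions, by integration along vertical segments. -/
theorem lintegral_boundary_sq_le (h : ContDiff ℝ ∞ φ) {R : ℝ} (hR : 0 < R) :
    ENNReal.ofReal R * ∫⁻ x in Ioo 0 R, ‖φ (x, 0)‖ₑ ^ 2 ≤
      4 * (∫⁻ p in rect R, ‖φ p‖ₑ ^ 2) +
        4 * ENNReal.ofReal R ^ 2 * ∫⁻ p in rect R, ‖(classicalGrad φ p).2‖ₑ ^ 2 := by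
  have cφ := h.continuous
  have mφ := cφ.measurable
  have cy := (continuous_classicalGrad h).snd
  have cy' : ∀ x, Continuous fun u => (classicalGrad φ (x, u)).2 := fun x =>
    cy.comp (Continuous.prodMk_right x)
  have m1 : Measurable fun p => ‖φ p‖ₑ ^ 2 := by fun_prop
  have m2 : Measurable fun p => ‖(classicalGrad φ p).2‖ₑ ^ 2 := by fun_prop
  have pt : ∀ x, ∀ y ∈ Ioo 0 R, ‖φ (x, 0)‖ₑ ^ 2 ≤ 4 * ‖φ (x, y)‖ₑ ^ 2 +
      4 * (ENNReal.ofReal R * ∫⁻ u in Ioo 0 R, ‖(classicalGrad φ (x, u)).2‖ₑ ^ 2) := by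
    intro x y hy
    have h1 := enorm_le_vertical h (R := R) x (a := y) (b := 0)
      (by rw [uIoc_comm]; exact uIoc_zero_subset hy)
    have h2 := lintegral_enorm_sq_Ioo_le (cy' x) (a := 0) (b := R)
    rw [sub_zero] at h2
    calc _ ≤ _ := pow_le_pow_left' h1 2
      _ ≤ _ := ennreal_add_sq_le _ _
      _ ≤ _ := by rw [mul_add]; gcongr
  have pt2 : ∀ x, ENNReal.ofReal R * ‖φ (x, 0)‖ₑ ^ 2 ≤ 4 * (∫⁻ y in Ioo 0 R, ‖φ (x, y)‖ₑ ^ 2) +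
      4 * ENNReal.ofReal R ^ 2 * ∫⁻ u in Ioo 0 R, ‖(classicalGrad φ (x, u)).2‖ₑ ^ 2 := by
    intro x
    have := setLIntegral_mono' (μ := volume) measurableSet_Ioo (pt x)
    rw [setLIntegral_const, Real.volume_Ioo, sub_zero, lintegral_add_right _ measurable_const,
      setLIntegral_const, Real.volume_Ioo, sub_zero, lintegral_const_mul _ (by fun_prop)] at this
    rw [mul_comm]
    refine this.trans (le_of_eq ?_)
    ring
  calc ENNReal.ofReal R * ∫⁻ x in Ioo 0 R, ‖φ (x, 0)‖ₑ ^ 2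
      = ∫⁻ x in Ioo 0 R, ENNReal.ofReal R * ‖φ (x, 0)‖ₑ ^ 2 :=
        (lintegral_const_mul _ (by fun_prop)).symm
    _ ≤ ∫⁻ x in Ioo 0 R, (4 * (∫⁻ y in Ioo 0 R, ‖φ (x, y)‖ₑ ^ 2) +
        4 * ENNReal.ofReal R ^ 2 * ∫⁻ u in Ioo 0 R, ‖(classicalGrad φ (x, u)).2‖ₑ ^ 2) :=
        lintegral_mono pt2
    _ = 4 * (∫⁻ p in Ioo 0 R ×ˢ Ioo 0 R, ‖φ p‖ₑ ^ 2) +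
        4 * ENNReal.ofReal R ^ 2 * ∫⁻ p in Ioo 0 R ×ˢ Ioo 0 R, ‖(classicalGrad φ p).2‖ₑ ^ 2 := by
      rw [setLIntegral_prod_eq m1.aemeasurable, setLIntegral_prod_eq m2.aemeasurable,
        lintegral_add_left (by fun_prop), lintegral_const_mul _ (by fun_prop),
        lintegral_const_mul _ (by fun_prop)]
    _ ≤ _ := by
      gcongr
      · exact square_subset_rect hR
      · exact square_subset_rect hR

/-- Poincaré inequality for smooth functions, with a boundary term on the positive axis only:
`(x, y)` is joined to the boundary point `(t, 0)`, `0 < t < R`, through `(t, y)`, and the result is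
averaged over `t`. -/
theorem lintegral_rect_sq_le {R : ℝ} (hR : 0 < R) : ∃ C : ℝ≥0∞, C ≠ ⊤ ∧
    ∀ φ : ℝ × ℝ → ℝ, ContDiff ℝ ∞ φ → ∫⁻ p in rect R, ‖φ p‖ₑ ^ 2 ≤
      C * ((∫⁻ x in Ioo 0 R, ‖φ (x, 0)‖ₑ ^ 2) + (∫⁻ p in rect R, ‖(classicalGrad φ p).1‖ₑ ^ 2)
        + ∫⁻ p in rect R, ‖(classicalGrad φ p).2‖ₑ ^ 2) := by
  set ρ := ENNReal.ofReal R with hρ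
  have hρ0 : ρ ≠ 0 := by simpa [hρ] using hR
  have hρt : ρ ≠ ⊤ := ENNReal.ofReal_ne_top
  set V := volume (rect R) with hV
  have hVt : V ≠ ⊤ := ((measure_mono (rect_subset_halfDisc hR)).trans_lt (by
    have := measure_lt_top (volume.restrict (halfDisc (2 * R))) univ
    rwa [Measure.restrict_apply_univ] at this)).ne
  set σ := ENNReal.ofReal (R - -R) with hσ
  have hσt : σ ≠ ⊤ := ENNReal.ofReal_ne_top
  refine ⟨ρ⁻¹ * (16 * V + 16 * ρ * V + 4 * ρ * σ * σ), by finiteness, fun φ h => ?_⟩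
  have cφ := h.continuous
  have mφ := cφ.measurable
  have cx := (continuous_classicalGrad h).fst
  have cy := (continuous_classicalGrad h).snd
  have cx' : ∀ y, Continuous fun u => (classicalGrad φ (u, y)).1 := fun y =>
    cx.comp (Continuous.prodMk_left y)
  have cy' : ∀ x, Continuous fun u => (classicalGrad φ (x, u)).2 := fun x =>
    cy.comp (Continuous.prodMk_right x)
  have m0 : Measurable fun p => ‖φ p‖ₑ ^ 2 := by fun_prop
  have m1 : Measurable fun p => ‖(classicalGrad φ p).1‖ₑ ^ 2 := by fun_prop
  have m2 : Measurable fun p => ‖(classicalGrad φ p).2‖ₑ ^ 2 := by fun_prop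
  set T := ∫⁻ x in Ioo 0 R, ‖φ (x, 0)‖ₑ ^ 2
  set E1 := ∫⁻ p in rect R, ‖(classicalGrad φ p).1‖ₑ ^ 2 with hE1
  set E2 := ∫⁻ p in rect R, ‖(classicalGrad φ p).2‖ₑ ^ 2 with hE2
  set G : ℝ → ℝ≥0∞ := fun y => ∫⁻ u in Ioo (-R) R, ‖(classicalGrad φ (u, y)).1‖ₑ ^ 2 with hG
  have mG : Measurable G := Measurable.lintegral_prod_left' (f := fun p : ℝ × ℝ =>
    ‖(classicalGrad φ p).1‖ₑ ^ 2) m1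
  -- the squared path estimate through `(t, y)`, to be averaged over `t`
  have pt : ∀ p ∈ rect R, ∀ t ∈ Ioo 0 R, ‖φ p‖ₑ ^ 2 ≤ 16 * ‖φ (t, 0)‖ₑ ^ 2 +
      16 * ρ * (∫⁻ u in Ioo 0 R, ‖(classicalGrad φ (t, u)).2‖ₑ ^ 2) + 4 * σ * G p.2 := by
    rintro ⟨x, y⟩ ⟨hx, hy⟩ t ht
    have ht' : t ∈ Ioo (-R) R := ⟨by linarith [ht.1], ht.2⟩
    have h1 := enorm_le_horizontal h y (uIoc_subset_Ioo ht' hx)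
    have h2 := enorm_le_vertical h (R := R) t (uIoc_zero_subset hy)
    have h3 := lintegral_enorm_sq_Ioo_le (cy' t) (a := 0) (b := R)
    have h4 := lintegral_enorm_sq_Ioo_le (cx' y) (a := -R) (b := R)
    rw [sub_zero] at h3
    have h5 : ‖φ (t, y)‖ₑ ^ 2 ≤ _ := (pow_le_pow_left' h2 2).trans (ennreal_add_sq_le _ _)
    calc ‖φ (x, y)‖ₑ ^ 2 ≤ _ := (pow_le_pow_left' h1 2).trans (ennreal_add_sq_le _ _)
      _ ≤ 4 * (4 * (‖φ (t, 0)‖ₑ ^ 2 + ρ * (∫⁻ u in Ioo 0 R, ‖(classicalGrad φ (t, u)).2‖ₑ ^ 2))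
          + σ * G y) := by
        gcongr
        exact h5.trans (by gcongr)
      _ = _ := by ring
  have hsq : ∫⁻ t in Ioo 0 R, ∫⁻ u in Ioo 0 R, ‖(classicalGrad φ (t, u)).2‖ₑ ^ 2 ≤ E2 := by
    rw [← setLIntegral_prod_eq (F := fun p => ‖(classicalGrad φ p).2‖ₑ ^ 2) m2.aemeasurable]
    exact lintegral_mono_set (square_subset_rect hR)
  have pt2 : ∀ p ∈ rect R, ρ * ‖φ p‖ₑ ^ 2 ≤ 16 * T + 16 * ρ * E2 + 4 * ρ * σ * G p.2 := by
    intro p hp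
    have := setLIntegral_mono' (μ := volume) measurableSet_Ioo (pt p hp)
    rw [setLIntegral_const, Real.volume_Ioo, sub_zero, lintegral_add_right _ measurable_const,
      setLIntegral_const, Real.volume_Ioo, sub_zero, lintegral_add_left (by fun_prop),
      lintegral_const_mul _ (by fun_prop), lintegral_const_mul _ (by fun_prop)] at this
    rw [mul_comm]
    refine this.trans ?_
    calc _ ≤ 16 * T + 16 * ρ * E2 + 4 * σ * G p.2 * ρ := by gcongr
      _ = _ := by ring
  have hGint : ∫⁻ p in rect R, G p.2 = σ * E1 := by
    rw [rect, setLIntegral_prod_eq (F := fun p => G p.2) (by fun_prop)]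
    change ∫⁻ _ in Ioo (-R) R, (∫⁻ y in Ioo 0 R, G y) = _
    rw [setLIntegral_const, Real.volume_Ioo, mul_comm, hE1, rect, setLIntegral_prod_symm_eq m1.aemeasurable]
  have fin : ρ * ∫⁻ p in rect R, ‖φ p‖ₑ ^ 2 ≤ (16 * T + 16 * ρ * E2) * V + 4 * ρ * σ * (σ * E1) := by
    have := setLIntegral_mono' (μ := volume) (measurableSet_Ioo.prod measurableSet_Ioo) pt2
    rwa [lintegral_const_mul _ m0, lintegral_add_left measurable_const, setLIntegral_const,
      lintegral_const_mul _ (by fun_prop), hGint] at this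
  calc ∫⁻ p in rect R, ‖φ p‖ₑ ^ 2 = ρ⁻¹ * (ρ * ∫⁻ p in rect R, ‖φ p‖ₑ ^ 2) := by
        rw [← mul_assoc, ENNReal.inv_mul_cancel hρ0 hρt, one_mul]
    _ ≤ ρ⁻¹ * ((16 * T + 16 * ρ * E2) * V + 4 * ρ * σ * (σ * E1)) := by gcongr
    _ = ρ⁻¹ * (16 * V * T + 16 * ρ * V * E2 + 4 * ρ * σ * σ * E1) := by ring
    _ ≤ ρ⁻¹ * ((16 * V + 16 * ρ * V + 4 * ρ * σ * σ) * T + (16 * V + 16 * ρ * V + 4 * ρ * σ * σ) * E2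
          + (16 * V + 16 * ρ * V + 4 * ρ * σ * σ) * E1) := by
        gcongr
        · exact le_self_add.trans le_self_add
        · exact le_add_self.trans le_self_add
        · exact le_add_self
    _ = _ := by ring

theorem lintegral_Ioo_rpow_neg_half_ne_top :
    ∫⁻ x in Ioo (0 : ℝ) 1, ENNReal.ofReal (x ^ (-(1 / 2) : ℝ)) ≠ ⊤ := by
  have h : IntegrableOn (fun x : ℝ => x ^ (-(1 / 2) : ℝ)) (Ioo 0 1) :=
    (intervalIntegral.integrableOn_Ioo_rpow_iff one_pos).2 (by norm_num)
  exact h.lintegral_lt_top.ne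

theorem lintegral_Ioo_rpow_mul_comp_sqrt (G : ℝ → ℝ≥0∞) :
    ∫⁻ x in Ioo (0 : ℝ) 1, ENNReal.ofReal (x ^ (-(1 / 2) : ℝ)) * G (√x)
      = 2 * ∫⁻ y in Ioo (0 : ℝ) 1, G y := by
  have himg : Real.sqrt '' Ioo (0 : ℝ) 1 = Ioo 0 1 := by
    ext y
    constructor
    · rintro ⟨x, hx, rfl⟩
      exact ⟨Real.sqrt_pos.2 hx.1, (Real.sqrt_lt' one_pos).2 (by simpa using hx.2)⟩
    · intro hy
      exact ⟨y ^ 2, ⟨by have := hy.1; positivity, by nlinarith [hy.1, hy.2]⟩, Real.sqrt_sq hy.1.le⟩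
  have h := lintegral_image_eq_lintegral_abs_deriv_mul (s := Ioo (0 : ℝ) 1) (f := Real.sqrt)
    (f' := fun x => 1 / (2 * √x)) measurableSet_Ioo
    (fun x hx => (Real.hasDerivAt_sqrt hx.1.ne').hasDerivWithinAt)
    (fun x hx y hy hxy => (Real.sqrt_inj hx.1.le hy.1.le).1 hxy) G
  rw [himg] at h
  rw [h, ← lintegral_const_mul' _ _ (by norm_num)]
  refine setLIntegral_congr_fun measurableSet_Ioo fun x hx => ?_
  rw [← mul_assoc]
  congr 1
  have hs := Real.sqrt_pos.2 hx.1
  rw [abs_of_pos (by positivity), ← ENNReal.ofReal_ofNat 2, ← ENNReal.ofReal_mul (by norm_num),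
    Real.rpow_neg hx.1.le, ← Real.sqrt_eq_rpow]
  congr 1
  field_simp

/-- The weighted boundary estimate for smooth functions, which makes the linear term of `J` finite
although `x ^ (-1/2)` is not square integrable on `(0, 1)`. The point `(x, 0)` is joined to `(t, 0)`
through `(x, √x)` and `(t, √x)`, and the result is averaged over `t ∈ (0, 1)`. The vertical segment
is short enough for `x⁻¹` to be integrable over `{0 < y < √x}`, while the weight `x ^ (-1/2)`
becomes constant in the variable `√x` on the horizontal segment. -/
theorem lintegral_weight_mul_le : ∃ C : ℝ≥0∞, C ≠ ⊤ ∧ ∀ φ : ℝ × ℝ → ℝ, ContDiff ℝ ∞ φ →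
    ∫⁻ x in Ioo (0 : ℝ) 1, ENNReal.ofReal (x ^ (-(1 / 2) : ℝ)) * ‖φ (x, 0)‖ₑ ≤
      C * (1 + (∫⁻ x in Ioo (0 : ℝ) 1, ‖φ (x, 0)‖ₑ ^ 2)
        + (∫⁻ p in rect 1, ‖(classicalGrad φ p).1‖ₑ ^ 2)
        + ∫⁻ p in rect 1, ‖(classicalGrad φ p).2‖ₑ ^ 2) := by
  set k : ℝ → ℝ≥0∞ := fun x => ENNReal.ofReal (x ^ (-(1 / 2) : ℝ)) with hk
  set W := ∫⁻ x in Ioo (0 : ℝ) 1, k x with hW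
  have hWt : W ≠ ⊤ := lintegral_Ioo_rpow_neg_half_ne_top
  have mk : Measurable k := by fun_prop
  refine ⟨3 * W + 3, by finiteness, fun φ h => ?_⟩
  have cφ := h.continuous
  have mφ := cφ.measurable
  have cx := (continuous_classicalGrad h).fst
  have cy := (continuous_classicalGrad h).snd
  have mx := cx.measurable
  have my := cy.measurable
  have cy' : ∀ x, Continuous fun u => (classicalGrad φ (x, u)).2 := fun x =>
    cy.comp (Continuous.prodMk_right x)
  have cx' : ∀ y, Continuous fun u => (classicalGrad φ (u, y)).1 := fun y =>
    cx.comp (Continuous.prodMk_left y)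
  have m1 : Measurable fun p => ‖(classicalGrad φ p).1‖ₑ ^ 2 := by fun_prop
  have m2 : Measurable fun p => ‖(classicalGrad φ p).2‖ₑ ^ 2 := by fun_prop
  set T := ∫⁻ x in Ioo (0 : ℝ) 1, ‖φ (x, 0)‖ₑ ^ 2
  set E1 := ∫⁻ p in rect 1, ‖(classicalGrad φ p).1‖ₑ ^ 2 with hE1
  set E2 := ∫⁻ p in rect 1, ‖(classicalGrad φ p).2‖ₑ ^ 2 with hE2
  set G : ℝ → ℝ≥0∞ := fun y => ∫⁻ u in Ioo (0 : ℝ) 1, ‖(classicalGrad φ (u, y)).1‖ₑ with hG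
  have mG : Measurable G := Measurable.lintegral_prod_left' (f := fun p : ℝ × ℝ =>
    ‖(classicalGrad φ p).1‖ₑ) (by fun_prop)
  -- `S` is swept out by the vertical segments from `(x, 0)` to `(x, √x)`
  set S : Set (ℝ × ℝ) := {p | p.2 ≤ √p.1} with hS
  have mS : MeasurableSet S := measurableSet_le measurable_snd (by fun_prop)
  set Hv : ℝ × ℝ → ℝ≥0∞ := S.indicator (fun p => ‖(classicalGrad φ p).2‖ₑ) with hHv
  have mHv : Measurable Hv := Measurable.indicator (by fun_prop) mS
  set Hk : ℝ × ℝ → ℝ≥0∞ := S.indicator (fun p => k p.1) with hHk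
  have mHk : Measurable Hk := Measurable.indicator (by fun_prop) mS
  -- along `(x, 0)`, `(x, √x)`, `(t, √x)`, `(t, 0)`
  have pt : ∀ x ∈ Ioo (0 : ℝ) 1, ∀ t ∈ Ioo (0 : ℝ) 1, ‖φ (x, 0)‖ₑ ≤ ‖φ (t, 0)‖ₑ +
      (∫⁻ u in Ioo (0 : ℝ) 1, ‖(classicalGrad φ (t, u)).2‖ₑ) + (G (√x) +
        ∫⁻ u in Ioo (0 : ℝ) 1, Hv (x, u)) := by
    intro x hx t ht
    have hy : √x ∈ Ioo (0 : ℝ) 1 :=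
      ⟨Real.sqrt_pos.2 hx.1, (Real.sqrt_lt' one_pos).2 (by simpa using hx.2)⟩
    have h1 := enorm_le_vertical h (R := 1) t (uIoc_zero_subset hy)
    have h2 := enorm_le_horizontal h (√x) (uIoc_subset_Ioo ht hx)
    have h3 := enorm_le_add_lintegral_deriv (a := √x) (b := 0) (fun y => hasDerivAt_snd h x y)
      (cy' x) (s := Ioc 0 (√x)) (by rw [uIoc_comm, uIoc_of_le hy.1.le])
    have h4 : ∫⁻ u in Ioc 0 (√x), ‖(classicalGrad φ (x, u)).2‖ₑ
        ≤ ∫⁻ u in Ioo (0 : ℝ) 1, Hv (x, u) := by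
      have e : ∀ u ∈ Ioc 0 (√x), ‖(classicalGrad φ (x, u)).2‖ₑ = Hv (x, u) := fun u hu => by
        rw [hHv, indicator_of_mem]
        exact hu.2
      rw [setLIntegral_congr_fun measurableSet_Ioc e]
      exact lintegral_mono_set fun u hu => ⟨hu.1, hu.2.trans_lt hy.2⟩
    calc ‖φ (x, 0)‖ₑ ≤ _ := h3
      _ ≤ (‖φ (t, 0)‖ₑ + (∫⁻ u in Ioo (0 : ℝ) 1, ‖(classicalGrad φ (t, u)).2‖ₑ) + G (√x)) +
          ∫⁻ u in Ioo (0 : ℝ) 1, Hv (x, u) := by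
        gcongr
        exact h2.trans (by gcongr)
      _ = _ := by ring
  have sq1 : ∫⁻ t in Ioo (0 : ℝ) 1, ∫⁻ u in Ioo (0 : ℝ) 1, ‖(classicalGrad φ (t, u)).2‖ₑ ^ 2
      ≤ E2 := by
    rw [← setLIntegral_prod_eq (F := fun p => ‖(classicalGrad φ p).2‖ₑ ^ 2) m2.aemeasurable]
    exact lintegral_mono_set (square_subset_rect one_pos)
  have sq2 : ∫⁻ t in Ioo (0 : ℝ) 1, ∫⁻ u in Ioo (0 : ℝ) 1, ‖(classicalGrad φ (t, u)).2‖ₑ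
      ≤ 1 + E2 := by
    calc _ ≤ ∫⁻ t in Ioo (0 : ℝ) 1, ∫⁻ u in Ioo (0 : ℝ) 1,
          (1 + ‖(classicalGrad φ (t, u)).2‖ₑ ^ 2) :=
          lintegral_mono fun t => lintegral_mono fun u => ennreal_le_one_add_sq _
      _ = 1 + ∫⁻ t in Ioo (0 : ℝ) 1, ∫⁻ u in Ioo (0 : ℝ) 1, ‖(classicalGrad φ (t, u)).2‖ₑ ^ 2 := by
          simp [lintegral_add_left]
      _ ≤ _ := by gcongr
  have bT : ∫⁻ t in Ioo (0 : ℝ) 1, ‖φ (t, 0)‖ₑ ≤ 1 + T := by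
    calc _ ≤ ∫⁻ t in Ioo (0 : ℝ) 1, (1 + ‖φ (t, 0)‖ₑ ^ 2) :=
          lintegral_mono fun t => ennreal_le_one_add_sq _
      _ = _ := by simp [lintegral_add_left, T]
  have bG : ∫⁻ y in Ioo (0 : ℝ) 1, G y ≤ 1 + E1 := by
    rw [hG, ← setLIntegral_prod_symm_eq (F := fun p => ‖(classicalGrad φ p).1‖ₑ)
      (by fun_prop)]
    calc _ ≤ ∫⁻ p in Ioo (0 : ℝ) 1 ×ˢ Ioo (0 : ℝ) 1, (1 + ‖(classicalGrad φ p).1‖ₑ ^ 2) :=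
          lintegral_mono fun t => ennreal_le_one_add_sq _
      _ = 1 + ∫⁻ p in Ioo (0 : ℝ) 1 ×ˢ Ioo (0 : ℝ) 1, ‖(classicalGrad φ p).1‖ₑ ^ 2 := by
          rw [lintegral_add_left measurable_const, setLIntegral_const, Measure.volume_eq_prod,
            Measure.prod_prod]
          simp
      _ ≤ _ := by gcongr; exact lintegral_mono_set (square_subset_rect one_pos)
  have bH : ∫⁻ x in Ioo (0 : ℝ) 1, k x * ∫⁻ u in Ioo (0 : ℝ) 1, Hv (x, u) ≤ W + E2 := by
    -- `∫₀^{√x} x⁻¹ dy = x ^ (-1/2)`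
    have hk2 : ∀ x ∈ Ioo (0 : ℝ) 1, ∫⁻ u in Ioo (0 : ℝ) 1, Hk (x, u) ^ 2 ≤ k x := by
      intro x hx
      have hsx := Real.sqrt_pos.2 hx.1
      calc ∫⁻ u in Ioo (0 : ℝ) 1, Hk (x, u) ^ 2
          ≤ ∫⁻ u in Ioo (0 : ℝ) 1, (Ioc 0 (√x)).indicator (fun _ => k x ^ 2) u := by
            refine setLIntegral_mono' measurableSet_Ioo fun u hu => ?_
            by_cases hux : u ≤ √x
            · rw [indicator_of_mem (show u ∈ Ioc 0 (√x) from ⟨hu.1, hux⟩), hHk,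
                indicator_of_mem (show (x, u) ∈ S from hux)]
            · rw [hHk, indicator_of_notMem (show (x, u) ∉ S from hux)]
              simp
        _ ≤ ∫⁻ u, (Ioc 0 (√x)).indicator (fun _ => k x ^ 2) u := setLIntegral_le_lintegral _ _
        _ = k x ^ 2 * ENNReal.ofReal (√x) := by
            rw [lintegral_indicator measurableSet_Ioc, setLIntegral_const, Real.volume_Ioc, sub_zero]
        _ = k x := by
            have hpos : (0 : ℝ) ≤ x ^ (-(1 / 2) : ℝ) := Real.rpow_nonneg hx.1.le _
            rw [hk]
            simp only
            rw [← ENNReal.ofReal_pow hpos, ← ENNReal.ofReal_mul (by positivity), sq,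
              mul_assoc, Real.rpow_neg hx.1.le, ← Real.sqrt_eq_rpow]
            congr 1
            field_simp
    calc ∫⁻ x in Ioo (0 : ℝ) 1, k x * ∫⁻ u in Ioo (0 : ℝ) 1, Hv (x, u)
        ≤ ∫⁻ x in Ioo (0 : ℝ) 1, (k x + ∫⁻ u in Ioo (0 : ℝ) 1, ‖(classicalGrad φ (x, u)).2‖ₑ ^ 2) := by
          refine setLIntegral_mono' measurableSet_Ioo fun x hx => ?_
          rw [← lintegral_const_mul _ (by fun_prop)]
          calc ∫⁻ u in Ioo (0 : ℝ) 1, k x * Hv (x, u)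
              ≤ ∫⁻ u in Ioo (0 : ℝ) 1, (Hk (x, u) ^ 2 + ‖(classicalGrad φ (x, u)).2‖ₑ ^ 2) := by
                refine lintegral_mono fun u => ?_
                by_cases hux : (x, u) ∈ S
                · rw [hHv, hHk, indicator_of_mem hux, indicator_of_mem hux]
                  exact ennreal_mul_le_sq_add_sq _ _
                · rw [hHv, indicator_of_notMem hux, mul_zero]
                  exact bot_le
            _ = (∫⁻ u in Ioo (0 : ℝ) 1, Hk (x, u) ^ 2)
                + ∫⁻ u in Ioo (0 : ℝ) 1, ‖(classicalGrad φ (x, u)).2‖ₑ ^ 2 :=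
                lintegral_add_left (by fun_prop) _
            _ ≤ _ := by gcongr; exact hk2 x hx
      _ ≤ W + E2 := by
          rw [lintegral_add_left mk]
          gcongr
  have pt2 : ∀ x ∈ Ioo (0 : ℝ) 1, ‖φ (x, 0)‖ₑ ≤ (2 + T + E2) + (G (√x) +
        ∫⁻ u in Ioo (0 : ℝ) 1, Hv (x, u)) := by
    intro x hx
    have := setLIntegral_mono' (μ := volume) measurableSet_Ioo (pt x hx)
    rw [setLIntegral_const, Real.volume_Ioo, sub_zero, ENNReal.ofReal_one, mul_one,
      lintegral_add_right _ measurable_const, setLIntegral_const, Real.volume_Ioo, sub_zero,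
      ENNReal.ofReal_one, mul_one, lintegral_add_left (by fun_prop)] at this
    refine this.trans (add_le_add ?_ le_rfl)
    calc _ ≤ (1 + T) + (1 + E2) := add_le_add bT sq2
      _ = (1 + 1) + T + E2 := by ring
      _ = _ := by norm_num
  calc ∫⁻ x in Ioo (0 : ℝ) 1, k x * ‖φ (x, 0)‖ₑ
      ≤ ∫⁻ x in Ioo (0 : ℝ) 1, (k x * (2 + T + E2) + (k x * G (√x)
          + k x * ∫⁻ u in Ioo (0 : ℝ) 1, Hv (x, u))) :=
        setLIntegral_mono' measurableSet_Ioo fun x hx => by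
          rw [← mul_add, ← mul_add]; gcongr; exact pt2 x hx
    _ = W * (2 + T + E2) + (2 * (∫⁻ y in Ioo (0 : ℝ) 1, G y)
          + ∫⁻ x in Ioo (0 : ℝ) 1, k x * ∫⁻ u in Ioo (0 : ℝ) 1, Hv (x, u)) := by
        rw [lintegral_add_left (by fun_prop), lintegral_add_left (by fun_prop),
          lintegral_mul_const _ mk, lintegral_Ioo_rpow_mul_comp_sqrt]
    _ ≤ W * (2 + T + E2) + (2 * (1 + E1) + (W + E2)) := by gcongr
    -- the nonnegative remainder completes the sum to a product
    _ ≤ W * (2 + T + E2) + (2 * (1 + E1) + (W + E2)) +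
        (1 + 3 * T + 2 * W * T + 3 * W * E1 + E1 + 2 * E2 + 2 * W * E2) := le_self_add
    _ = (3 * W + 3) * (1 + T + E1 + E2) := by ring

end Smooth

/-! ### Mollification -/

/-- Translations are continuous in `L²(ℝ²)`. -/
theorem exists_eLpNorm_translate_sub_le {f : ℝ × ℝ → ℝ} (hf : MemLp f 2) {ε : ℝ≥0∞} (hε : ε ≠ 0) :
    ∃ δ : ℝ, 0 < δ ∧ ∀ z : ℝ × ℝ, ‖z‖ < δ → eLpNorm (fun p => f (p - z) - f p) 2 ≤ ε := by
  set g : ℝ × ℝ → C(ℝ × ℝ, ℝ × ℝ) := fun z => ⟨fun p => p - z, by fun_prop⟩ with hg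
  have hgc : Continuous g := by
    refine ContinuousMap.continuous_of_continuous_uncurry _ ?_
    simp only [hg, Function.uncurry_def, ContinuousMap.coe_mk]
    fun_prop
  have hgm : ∀ z, MeasurePreserving (g z) volume volume := fun z =>
    measurePreserving_sub_right volume z
  have hcont : Continuous fun z => Lp.compMeasurePreserving (g z) (hgm z) (hf.toLp f) :=
    Continuous.compMeasurePreservingLp continuous_const hgc hgm (by norm_num)
  have h1 : ∀ᶠ z in 𝓝 (0 : ℝ × ℝ), edist (Lp.compMeasurePreserving (g z) (hgm z) (hf.toLp f))
      (Lp.compMeasurePreserving (g 0) (hgm 0) (hf.toLp f)) ≤ ε := by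
    have := (hcont.tendsto 0).edist (tendsto_const_nhds
      (x := Lp.compMeasurePreserving (g 0) (hgm 0) (hf.toLp f)))
    rw [edist_self] at this
    exact (this.eventually (gt_mem_nhds (pos_iff_ne_zero.2 hε))).mono fun z hz => le_of_lt hz
  obtain ⟨δ, hδ, hball⟩ := Metric.eventually_nhds_iff.1 h1
  refine ⟨δ, hδ, fun z hz => ?_⟩
  have h2 := hball (y := z) (by simpa using hz)
  rw [Lp.edist_def] at h2
  refine le_trans (le_of_eq (eLpNorm_congr_ae ?_)) h2
  have e : ∀ z, (Lp.compMeasurePreserving (g z) (hgm z) (hf.toLp f) : ℝ × ℝ → ℝ)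
      =ᵐ[volume] fun p => f (p - z) := fun z => by
    refine (Lp.coeFn_compMeasurePreserving (hf.toLp f) (hgm z)).trans ?_
    exact (hgm z).quasiMeasurePreserving.ae_eq_comp hf.coeFn_toLp
  filter_upwards [e z, e 0] with p h1 h2
  rw [Pi.sub_apply, h1, h2, sub_zero]

/-- Convolution with a kernel concentrated near the origin is close to the identity in `L²`. -/
theorem eLpNorm_convolution_sub_le {f κ : ℝ × ℝ → ℝ} (hf : MemLp f 2) {ε : ℝ≥0∞} {δ : ℝ}
    (hδ : ∀ z : ℝ × ℝ, ‖z‖ < δ → eLpNorm (fun p => f (p - z) - f p) 2 ≤ ε)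
    (hκ : Continuous κ) (hκc : HasCompactSupport κ) (hκ0 : ∀ z, 0 ≤ κ z) (hκ1 : ∫ z, κ z = 1)
    (hκs : ∀ z, κ z ≠ 0 → ‖z‖ < δ) :
    eLpNorm (fun p => (∫ q, f q * κ (p - q)) - f p) 2 ≤ ε := by
  set k : ℝ × ℝ → ℝ≥0∞ := fun z => ENNReal.ofReal (κ z) with hk
  have mk : Measurable k := by fun_prop
  have ik : Integrable κ := hκ.integrable_of_hasCompactSupport hκc
  have hk1 : ∫⁻ z, k z = 1 := by
    rw [hk, ← ofReal_integral_eq_lintegral_ofReal ik (ae_of_all _ hκ0), hκ1, ENNReal.ofReal_one]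
  have hloc : LocallyIntegrable f := hf.locallyIntegrable (by norm_num)
  have mF : AEMeasurable (fun r : (ℝ × ℝ) × (ℝ × ℝ) => ‖f (r.1 - r.2) - f r.1‖ₑ ^ 2 * k r.2)
      (volume.prod volume) := by
    have h1 : AEStronglyMeasurable (fun r : (ℝ × ℝ) × (ℝ × ℝ) => f (r.1 - r.2))
        (volume.prod volume) := hf.1.comp_quasiMeasurePreserving
      (quasiMeasurePreserving_sub_of_right_invariant volume volume)
    have h2 : AEStronglyMeasurable (fun r : (ℝ × ℝ) × (ℝ × ℝ) => f r.1)
        (volume.prod volume) := hf.1.comp_quasiMeasurePreserving Measure.quasiMeasurePreserving_fst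
    exact ((h1.sub h2).enorm.pow_const 2).mul (mk.comp measurable_snd).aemeasurable
  -- Jensen's inequality for the probability density `κ`
  have pt : ∀ p, ‖(∫ q, f q * κ (p - q)) - f p‖ₑ ^ 2 ≤ ∫⁻ z, ‖f (p - z) - f p‖ₑ ^ 2 * k z := by
    intro p
    have i1 : Integrable fun z => f (p - z) * κ z := by
      have := hκc.convolutionExists_right (ContinuousLinearMap.mul ℝ ℝ) hloc hκ p
      simpa using this.integrable_swap
    have e1 : ∫ q, f q * κ (p - q) = ∫ z, f (p - z) * κ z := by
      rw [← integral_sub_left_eq_self (fun q => f q * κ (p - q)) volume p]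
      simp
    have e2 : (∫ q, f q * κ (p - q)) - f p = ∫ z, (f (p - z) - f p) * κ z := by
      simp_rw [sub_mul]
      rw [integral_sub i1 (ik.const_mul _), integral_const_mul, hκ1, e1, mul_one]
    have m1 : AEMeasurable (fun z => ‖f (p - z) - f p‖ₑ) := by
      refine (AEStronglyMeasurable.sub ?_ aestronglyMeasurable_const).enorm
      exact hf.1.comp_quasiMeasurePreserving
        (quasiMeasurePreserving_sub_left_of_right_invariant volume p)
    have mw : AEMeasurable (fun z => ‖f (p - z) - f p‖ₑ) (volume.withDensity k) :=
      m1.mono_ac (withDensity_absolutelyContinuous _ _)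
    have cs := lintegral_sq_le mw
    rw [withDensity_apply _ MeasurableSet.univ, Measure.restrict_univ, hk1, one_mul,
      lintegral_withDensity_eq_lintegral_mul₀ mk.aemeasurable m1,
      lintegral_withDensity_eq_lintegral_mul₀ mk.aemeasurable (m1.pow_const 2)] at cs
    calc _ ≤ (∫⁻ z, (k * fun z => ‖f (p - z) - f p‖ₑ) z) ^ 2 := by
          refine pow_le_pow_left' ?_ 2
          rw [e2]
          refine (enorm_integral_le_lintegral_enorm _).trans (le_of_eq ?_)
          refine lintegral_congr fun z => ?_
          rw [enorm_mul, mul_comm, Pi.mul_apply, hk, Real.enorm_of_nonneg (hκ0 z)]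
      _ ≤ _ := cs
      _ = _ := lintegral_congr fun z => by rw [Pi.mul_apply, mul_comm]
  have hsq : eLpNorm (fun p => (∫ q, f q * κ (p - q)) - f p) 2 ^ 2 ≤ ε ^ 2 := by
    rw [eLpNorm_two_sq]
    calc _ ≤ ∫⁻ p, ∫⁻ z, ‖f (p - z) - f p‖ₑ ^ 2 * k z := lintegral_mono pt
      _ = ∫⁻ z, ∫⁻ p, ‖f (p - z) - f p‖ₑ ^ 2 * k z := lintegral_lintegral_swap mF
      _ ≤ ∫⁻ z, ε ^ 2 * k z := by
        refine lintegral_mono fun z => ?_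
        rw [lintegral_mul_const' _ _ ENNReal.ofReal_ne_top, ← eLpNorm_two_sq]
        by_cases hz : κ z = 0
        · simp [hk, hz]
        · gcongr
          exact hδ z (hκs z hz)
      _ = ε ^ 2 := by rw [lintegral_const_mul _ mk, hk1, mul_one]
  by_contra hlt
  exact absurd hsq (not_le.2 (ENNReal.pow_lt_pow_left (by norm_num) (not_le.1 hlt)))

/-- Mollifiers supported strictly below the horizontal axis: convolution with them uses the values
of a function of `ℝ²₊` at points of `ℝ²₊` only. -/
theorem exists_lower_mollifier {δ : ℝ} (hδ : 0 < δ) : ∃ κ : ℝ × ℝ → ℝ, ContDiff ℝ ∞ κ ∧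
    HasCompactSupport κ ∧ (∀ z, 0 ≤ κ z) ∧ ∫ z, κ z = 1 ∧
    ∀ z ∈ tsupport κ, ‖z‖ < δ ∧ z.2 < 0 := by
  let b : ContDiffBump ((0, -(δ / 2)) : ℝ × ℝ) := ⟨δ / 8, δ / 4, by linarith, by linarith⟩
  refine ⟨b.normed volume, b.contDiff_normed, b.hasCompactSupport_normed, b.nonneg_normed,
    b.integral_normed, fun z hz => ?_⟩
  rw [b.tsupport_normed_eq, Metric.mem_closedBall, Prod.dist_eq, max_le_iff, Real.dist_eq,
    Real.dist_eq] at hz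
  obtain ⟨h1, h2⟩ := hz
  simp only [sub_zero, sub_neg_eq_add, b] at h1 h2
  rw [abs_le] at h1 h2
  refine ⟨?_, by linarith⟩
  rw [Prod.norm_def, max_lt_iff, Real.norm_eq_abs, Real.norm_eq_abs, abs_lt, abs_lt]
  constructor <;> constructor <;> linarith

theorem sub_mem_halfDisc {R : ℝ} (hR : 0 < R) {p z : ℝ × ℝ} (hp : p ∈ halfDisc R) (hz : ‖z‖ < 1)
    (hz2 : z.2 < 0) : p - z ∈ halfDisc (R + 2) := by
  rw [Prod.norm_def, max_lt_iff, Real.norm_eq_abs, Real.norm_eq_abs, abs_lt, abs_lt] at hz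
  obtain ⟨⟨h1, h2⟩, h3, h4⟩ := hz
  obtain ⟨h5, h6⟩ := hp
  have h7 := abs_lt_of_sq_lt_sq' (a := p.1) (b := R) (by nlinarith [sq_nonneg p.2]) hR.le
  have h8 := abs_lt_of_sq_lt_sq' (a := p.2) (b := R) (by nlinarith [sq_nonneg p.1]) hR.le
  refine ⟨?_, by simp only [Prod.snd_sub]; linarith⟩
  simp only [Prod.fst_sub, Prod.snd_sub]
  nlinarith [mul_pos (sub_pos.2 h2) (sub_pos.2 h7.1), mul_pos (sub_pos.2 h2) (sub_pos.2 h7.2),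
    mul_pos (sub_pos.2 h1) (sub_pos.2 h7.1), mul_pos (sub_pos.2 h1) (sub_pos.2 h7.2),
    mul_pos (sub_pos.2 h3) (sub_pos.2 h8.1), mul_pos (sub_pos.2 h3) (sub_pos.2 h8.2)]

/-- `φ n` are smooth functions on the plane that approximate `w` in `H¹(B_R⁺(0))`. -/
structure IsApprox (R : ℝ) (w : ℝ × ℝ → ℝ) (φ : ℕ → ℝ × ℝ → ℝ) : Prop where
  contDiff : ∀ n, ContDiff ℝ ∞ (φ n)
  tendsto : Tendsto (fun n => eLpNorm (fun p => φ n p - w p) 2 (volume.restrict (halfDisc R)))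
    atTop (𝓝 0)
  tendsto_fst : Tendsto (fun n => eLpNorm (fun p => (classicalGrad (φ n) p).1 - (weakGrad w p).1) 2
    (volume.restrict (halfDisc R))) atTop (𝓝 0)
  tendsto_snd : Tendsto (fun n => eLpNorm (fun p => (classicalGrad (φ n) p).2 - (weakGrad w p).2) 2
    (volume.restrict (halfDisc R))) atTop (𝓝 0)

theorem eLpNorm_convolution_indicator_sub_le {g κ : ℝ × ℝ → ℝ} {R S : ℝ} (hR : 0 ≤ R) (hS : R ≤ S)
    (hg : MemLp ((halfDisc S).indicator g) 2) {ε : ℝ≥0∞} {δ : ℝ}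
    (hδ : ∀ z : ℝ × ℝ, ‖z‖ < δ → eLpNorm (fun p => (halfDisc S).indicator g (p - z)
      - (halfDisc S).indicator g p) 2 ≤ ε)
    (hκ : Continuous κ) (hκc : HasCompactSupport κ) (hκ0 : ∀ z, 0 ≤ κ z) (hκ1 : ∫ z, κ z = 1)
    (hκs : ∀ z, κ z ≠ 0 → ‖z‖ < δ) :
    eLpNorm (fun p => (∫ q, (halfDisc S).indicator g q * κ (p - q)) - g p) 2
      (volume.restrict (halfDisc R)) ≤ ε := by
  refine le_trans (le_trans (le_of_eq (eLpNorm_congr_ae ?_)) (eLpNorm_restrict_le _ _ _ _))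
    (eLpNorm_convolution_sub_le hg hδ hκ hκc hκ0 hκ1 hκs)
  filter_upwards [ae_restrict_mem (measurableSet_halfDisc R)] with p hp
  rw [indicator_of_mem (halfDisc_mono hR hS hp)]

/-- Smooth functions are dense in `H¹` of a half-disc, for functions of `H`. -/
theorem exists_isApprox {w : ℝ × ℝ → ℝ} (hw : w ∈ H) {R : ℝ} (hR : 0 < R) :
    ∃ φ, IsApprox R w φ := by
  set S := R + 2 with hS
  have hRS : R ≤ S := by linarith
  obtain ⟨L0, L1, L2⟩ := hw.2 S (by positivity)
  have hwg := isWeakGrad_of_mem_H hw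
  have M0 := (memLp_indicator_iff_restrict (measurableSet_halfDisc S)).2 L0
  have M1 := (memLp_indicator_iff_restrict (measurableSet_halfDisc S)).2 L1
  have M2 := (memLp_indicator_iff_restrict (measurableSet_halfDisc S)).2 L2
  set f := (halfDisc S).indicator w with hf
  have floc : LocallyIntegrable f := M0.locallyIntegrable (by norm_num)
  have key : ∀ n : ℕ, ∃ φ : ℝ × ℝ → ℝ, ContDiff ℝ ∞ φ ∧
      eLpNorm (fun p => φ p - w p) 2 (volume.restrict (halfDisc R)) ≤ ((n : ℝ≥0∞) + 1)⁻¹ ∧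
      eLpNorm (fun p => (classicalGrad φ p).1 - (weakGrad w p).1) 2
        (volume.restrict (halfDisc R)) ≤ ((n : ℝ≥0∞) + 1)⁻¹ ∧
      eLpNorm (fun p => (classicalGrad φ p).2 - (weakGrad w p).2) 2
        (volume.restrict (halfDisc R)) ≤ ((n : ℝ≥0∞) + 1)⁻¹ := by
    intro n
    set ε : ℝ≥0∞ := ((n : ℝ≥0∞) + 1)⁻¹
    have hε : ε ≠ 0 := ENNReal.inv_ne_zero.2 (by finiteness)
    obtain ⟨δ0, hδ0, H0⟩ := exists_eLpNorm_translate_sub_le M0 hε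
    obtain ⟨δ1, hδ1, H1⟩ := exists_eLpNorm_translate_sub_le M1 hε
    obtain ⟨δ2, hδ2, H2⟩ := exists_eLpNorm_translate_sub_le M2 hε
    obtain ⟨κ, k1, k2, k3, k4, k5⟩ := exists_lower_mollifier
      (δ := min (min δ0 δ1) (min δ2 1)) (by positivity)
    have k5' : ∀ z, κ z ≠ 0 → z ∈ tsupport κ := fun z hz => subset_tsupport κ hz
    have hcv : ContDiff ℝ ∞ (convolution f κ (ContinuousLinearMap.mul ℝ ℝ) volume) :=
      k2.contDiff_convolution_right (n := ⊤) (ContinuousLinearMap.mul ℝ ℝ) floc k1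
    have hφ : convolution f κ (ContinuousLinearMap.mul ℝ ℝ) volume
        = fun p => ∫ q, f q * κ (p - q) := by
      ext p; simp [convolution_def]
    have hder : ∀ v p, fderiv ℝ (convolution f κ (ContinuousLinearMap.mul ℝ ℝ) volume) p v
        = ∫ q, f q * fderiv ℝ κ (p - q) v := by
      intro v p
      rw [(k2.hasFDerivAt_convolution_right (ContinuousLinearMap.mul ℝ ℝ) floc
        (k1.of_le (by simp)) p).fderiv,
        convolution_precompR_apply (ContinuousLinearMap.mul ℝ ℝ) floc (k2.fderiv ℝ)
          (k1.continuous_fderiv (by simp)) p v, convolution_def]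
      simp
    -- the reflected and translated kernel is an admissible test function at points of the half-disc
    have hψ : ∀ p ∈ halfDisc R, ContDiff ℝ ∞ (fun q => κ (p - q)) ∧
        HasCompactSupport (fun q => κ (p - q)) ∧
        (∀ q ∈ tsupport (fun q => κ (p - q)), q ∈ halfDisc S) := by
      intro p hp
      have e : (fun q => κ (p - q)) = κ ∘ (Homeomorph.subLeft p) := rfl
      refine ⟨k1.comp (contDiff_const.sub contDiff_id), ?_, fun q hq => ?_⟩
      · rw [e]; exact k2.comp_homeomorph _
      · rw [e, tsupport_comp_eq_preimage] at hq
        obtain ⟨h1, h2⟩ := k5 (p - q) hq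
        have := sub_mem_halfDisc hR hp (h1.trans_le ((min_le_right _ _).trans (min_le_right _ _))) h2
        simpa using this
    have hfd : ∀ p q v, fderiv ℝ (fun q => κ (p - q)) q v = - fderiv ℝ κ (p - q) v := by
      intro p q v
      have h1 : HasFDerivAt (fun q => κ (p - q)) ((fderiv ℝ κ (p - q)).comp
          (-ContinuousLinearMap.id ℝ (ℝ × ℝ))) q :=
        HasFDerivAt.comp q ((k1.differentiable (by simp) (p - q)).hasFDerivAt)
          ((hasFDerivAt_id q).const_sub p)
      rw [h1.fderiv]; simp
    -- on the half-disc, the gradient of the mollification is the mollified weak gradient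
    have hgrad : ∀ (v : ℝ × ℝ) (g : ℝ × ℝ → ℝ), (∀ φ : ℝ × ℝ → ℝ, ContDiff ℝ ∞ φ →
        HasCompactSupport φ → tsupport φ ⊆ halfPlane →
        ∫ p in halfPlane, w p * fderiv ℝ φ p v = -∫ p in halfPlane, g p * φ p) →
        ∀ p ∈ halfDisc R, fderiv ℝ (convolution f κ (ContinuousLinearMap.mul ℝ ℝ) volume) p v
          = ∫ q, (halfDisc S).indicator g q * κ (p - q) := by
      intro v g hg p hp
      obtain ⟨c1, c2, c3⟩ := hψ p hp
      have h1 := hg _ c1 c2 fun q hq => halfDisc_subset_halfPlane S (c3 q hq)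
      have h2 := tsupport_fderiv_apply_subset (fun q => κ (p - q)) v
      have e1 : ∫ q in halfPlane, w q * fderiv ℝ (fun q => κ (p - q)) q v
          = - ∫ q, f q * fderiv ℝ κ (p - q) v := by
        rw [← integral_neg, ← integral_indicator measurableSet_halfPlane]
        congr 1
        ext q
        by_cases hq : q ∈ tsupport (fun q => κ (p - q))
        · rw [indicator_of_mem (halfDisc_subset_halfPlane S (c3 q hq)), hf,
            indicator_of_mem (c3 q hq), hfd]
          ring
        · have hz : fderiv ℝ (fun q => κ (p - q)) q v = 0 :=
            image_eq_zero_of_notMem_tsupport (f := fun q => fderiv ℝ (fun q => κ (p - q)) q v)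
              fun h => hq (h2 h)
          have hz' : fderiv ℝ κ (p - q) v = 0 := by rw [hfd] at hz; simpa using hz
          rw [hz', mul_zero, neg_zero]
          by_cases hqp : q ∈ halfPlane
          · rw [indicator_of_mem hqp, hz, mul_zero]
          · rw [indicator_of_notMem hqp]
      have e2 : ∫ q in halfPlane, g q * κ (p - q)
          = ∫ q, (halfDisc S).indicator g q * κ (p - q) := by
        rw [← integral_indicator measurableSet_halfPlane]
        congr 1
        ext q
        by_cases hq : q ∈ tsupport (fun q => κ (p - q))
        · rw [indicator_of_mem (halfDisc_subset_halfPlane S (c3 q hq)), indicator_of_mem (c3 q hq)]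
        · have hz : κ (p - q) = 0 :=
            image_eq_zero_of_notMem_tsupport (f := fun q => κ (p - q)) hq
          rw [hz, mul_zero]
          by_cases hqp : q ∈ halfPlane
          · rw [indicator_of_mem hqp, hz, mul_zero]
          · rw [indicator_of_notMem hqp]
      rw [hder, ← e2]
      rw [e1] at h1
      exact neg_inj.1 h1
    refine ⟨_, hcv, ?_, ?_, ?_⟩
    · rw [hφ]
      exact eLpNorm_convolution_indicator_sub_le hR.le hRS M0 H0 k1.continuous k2 k3 k4
        fun z hz => (k5 z (k5' z hz)).1.trans_le ((min_le_left _ _).trans (min_le_left _ _))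
    · refine le_trans (le_of_eq (eLpNorm_congr_ae ?_)) (eLpNorm_convolution_indicator_sub_le hR.le
        hRS M1 H1 k1.continuous k2 k3 k4
        fun z hz => (k5 z (k5' z hz)).1.trans_le ((min_le_left _ _).trans (min_le_right _ _)))
      filter_upwards [ae_restrict_mem (measurableSet_halfDisc R)] with p hp
      rw [← hgrad (1, 0) _ hwg.integral_fst p hp, classicalGrad]
    · refine le_trans (le_of_eq (eLpNorm_congr_ae ?_)) (eLpNorm_convolution_indicator_sub_le hR.le
        hRS M2 H2 k1.continuous k2 k3 k4
        fun z hz => (k5 z (k5' z hz)).1.trans_le ((min_le_right _ _).trans (min_le_left _ _)))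
      filter_upwards [ae_restrict_mem (measurableSet_halfDisc R)] with p hp
      rw [← hgrad (0, 1) _ hwg.integral_snd p hp, classicalGrad]
  choose φ h1 h2 h3 h4 using key
  have hlim : Tendsto (fun n : ℕ => ((n : ℝ≥0∞) + 1)⁻¹) atTop (𝓝 0) := by
    have := (tendsto_add_atTop_iff_nat 1).2 ENNReal.tendsto_inv_nat_nhds_zero
    simpa using this
  exact ⟨φ, h1, tendsto_of_tendsto_of_tendsto_of_le_of_le tendsto_const_nhds hlim
      (fun _ => bot_le) h2, tendsto_of_tendsto_of_tendsto_of_le_of_le tendsto_const_nhds hlim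
      (fun _ => bot_le) h3, tendsto_of_tendsto_of_tendsto_of_le_of_le tendsto_const_nhds hlim
      (fun _ => bot_le) h4⟩

/-! ### Traces -/

theorem eLpNorm_add_sq_le {α : Type*} [MeasurableSpace α] {μ : Measure α} {f g : α → ℝ}
    (hf : AEStronglyMeasurable f μ) (hg : AEStronglyMeasurable g μ) :
    eLpNorm (fun x => f x + g x) 2 μ ^ 2 ≤ 4 * (eLpNorm f 2 μ ^ 2 + eLpNorm g 2 μ ^ 2) :=
  (pow_le_pow_left' (eLpNorm_add_le hf hg (by norm_num)) 2).trans (ennreal_add_sq_le _ _)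

theorem eLpNorm_sub_sq_le_of_approx {α : Type*} [MeasurableSpace α] {μ : Measure α}
    {f g h : α → ℝ} (hf : AEStronglyMeasurable f μ) (hg : AEStronglyMeasurable g μ)
    (hh : AEStronglyMeasurable h μ) :
    eLpNorm (fun x => f x - g x) 2 μ ^ 2 ≤
      4 * (eLpNorm (fun x => f x - h x) 2 μ ^ 2 + eLpNorm (fun x => g x - h x) 2 μ ^ 2) := by
  have e : (fun x => f x - g x) = fun x => (f x - h x) + -(g x - h x) := by ext x; ring
  have e2 : eLpNorm (fun x => -(g x - h x)) 2 μ = eLpNorm (fun x => g x - h x) 2 μ :=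
    eLpNorm_neg (fun x => g x - h x) 2 μ
  rw [← e2, e]
  exact eLpNorm_add_sq_le (hf.sub hh) (hg.sub hh).neg

/-- Completeness of `L²`, for Cauchy sequences given by a bound on the squared distances. -/
theorem exists_tendsto_eLpNorm_of_sq_le {α : Type*} [MeasurableSpace α] {μ : Measure α}
    {f : ℕ → α → ℝ} (hf : ∀ n, MemLp (f n) 2 μ) {d : ℕ → ℝ≥0∞} (hd : Tendsto d atTop (𝓝 0))
    (h : ∀ n m, eLpNorm (fun x => f n x - f m x) 2 μ ^ 2 ≤ d n + d m) :
    ∃ g, MemLp g 2 μ ∧ Tendsto (fun n => eLpNorm (fun x => f n x - g x) 2 μ) atTop (𝓝 0) := by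
  have hc : CauchySeq fun n => (hf n).toLp (f n) := by
    rw [EMetric.cauchySeq_iff]
    intro ε hε
    have hε2 : 0 < ε ^ 2 / 2 := by
      refine ENNReal.div_pos (pow_ne_zero 2 hε.ne') (by norm_num)
    obtain ⟨N, hN⟩ := eventually_atTop.1 (hd.eventually (gt_mem_nhds hε2))
    refine ⟨N, fun m hm n hn => ?_⟩
    rw [Lp.edist_toLp_toLp]
    by_contra hlt
    have h1 : ε ^ 2 ≤ d m + d n := (pow_le_pow_left' (not_lt.1 hlt) 2).trans (h m n)
    have h2 := ENNReal.add_lt_add (hN m hm) (hN n hn)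
    rw [ENNReal.add_halves] at h2
    exact absurd h1 (not_le.2 h2)
  obtain ⟨g, hg⟩ := cauchySeq_tendsto_of_complete hc
  refine ⟨g, Lp.memLp g, ?_⟩
  rw [tendsto_iff_edist_tendsto_0] at hg
  refine hg.congr fun n => ?_
  rw [Lp.edist_def]
  refine eLpNorm_congr_ae ?_
  filter_upwards [(hf n).coeFn_toLp] with x hx
  rw [Pi.sub_apply, hx]

theorem IsApprox.mono {r R : ℝ} (hr : 0 ≤ r) (h : r ≤ R) {w : ℝ × ℝ → ℝ} {φ : ℕ → ℝ × ℝ → ℝ}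
    (hφ : IsApprox R w φ) : IsApprox r w φ := by
  have hm : volume.restrict (halfDisc r) ≤ volume.restrict (halfDisc R) :=
    Measure.restrict_mono (halfDisc_mono hr h) le_rfl
  exact ⟨hφ.contDiff,
    tendsto_of_tendsto_of_tendsto_of_le_of_le tendsto_const_nhds hφ.tendsto (fun _ => bot_le)
      fun n => eLpNorm_mono_measure _ hm,
    tendsto_of_tendsto_of_tendsto_of_le_of_le tendsto_const_nhds hφ.tendsto_fst (fun _ => bot_le)
      fun n => eLpNorm_mono_measure _ hm,
    tendsto_of_tendsto_of_tendsto_of_le_of_le tendsto_const_nhds hφ.tendsto_snd (fun _ => bot_le)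
      fun n => eLpNorm_mono_measure _ hm⟩

theorem tendsto_eLpNorm_add_smul {α : Type*} [MeasurableSpace α] {μ : Measure α}
    {f f' : ℕ → α → ℝ} {g g' k : α → ℝ} {F : ℕ → α → ℝ} (t : ℝ)
    (hf : ∀ n, AEStronglyMeasurable (f n) μ) (hg : AEStronglyMeasurable g μ)
    (hf' : ∀ n, AEStronglyMeasurable (f' n) μ) (hg' : AEStronglyMeasurable g' μ)
    (h : Tendsto (fun n => eLpNorm (fun x => f n x - g x) 2 μ) atTop (𝓝 0))
    (h' : Tendsto (fun n => eLpNorm (fun x => f' n x - g' x) 2 μ) atTop (𝓝 0))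
    (hF : ∀ n, F n =ᵐ[μ] fun x => f n x + t * f' n x) (hk : k =ᵐ[μ] fun x => g x + t * g' x) :
    Tendsto (fun n => eLpNorm (fun x => F n x - k x) 2 μ) atTop (𝓝 0) := by
  have hlim : Tendsto (fun n => eLpNorm (fun x => f n x - g x) 2 μ +
      ‖t‖ₑ * eLpNorm (fun x => f' n x - g' x) 2 μ) atTop (𝓝 0) := by
    simpa using h.add (ENNReal.Tendsto.const_mul h' (Or.inr enorm_ne_top))
  refine tendsto_of_tendsto_of_tendsto_of_le_of_le tendsto_const_nhds hlim (fun _ => bot_le)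
    fun n => ?_
  have e : (fun x => F n x - k x) =ᵐ[μ] (fun x => f n x - g x) + t • (fun x => f' n x - g' x) := by
    filter_upwards [hF n, hk] with x h1 h2
    rw [h1, h2]; simp; ring
  simp only
  rw [eLpNorm_congr_ae e, ← eLpNorm_const_smul]
  exact eLpNorm_add_le ((hf n).sub hg) (((hf' n).sub hg').const_smul t) (by norm_num)

theorem classicalGrad_add_smul {φ ψ : ℝ × ℝ → ℝ} (hφ : ContDiff ℝ ∞ φ) (hψ : ContDiff ℝ ∞ ψ)
    (t : ℝ) (p : ℝ × ℝ) :
    classicalGrad (fun p => φ p + t * ψ p) p = classicalGrad φ p + t • classicalGrad ψ p := by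
  have h1 := hφ.differentiable (by simp) p
  have h2 := hψ.differentiable (by simp) p
  have : fderiv ℝ (fun p => φ p + t * ψ p) p = fderiv ℝ φ p + t • fderiv ℝ ψ p := by
    rw [fderiv_fun_add h1 (h2.const_mul t), fderiv_const_mul h2]
  simp [classicalGrad, this]

theorem IsApprox.add_smul {R : ℝ} (hR : 0 < R) {w v : ℝ × ℝ → ℝ} (hw : w ∈ H) (hv : v ∈ H)
    {φ ψ : ℕ → ℝ × ℝ → ℝ} (hφ : IsApprox R w φ) (hψ : IsApprox R v ψ) (t : ℝ) :
    IsApprox R (fun p => w p + t * v p) (fun n p => φ n p + t * ψ n p) := by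
  have hae := ae_halfDisc_of_halfPlane (R := R) (weakGrad_add_smul hw hv t)
  refine ⟨fun n => (hφ.contDiff n).add (contDiff_const.mul (hψ.contDiff n)), ?_, ?_, ?_⟩
  · exact tendsto_eLpNorm_add_smul t
      (fun n => (hφ.contDiff n).continuous.aestronglyMeasurable) (hw.2 R hR).1.1
      (fun n => (hψ.contDiff n).continuous.aestronglyMeasurable) (hv.2 R hR).1.1
      hφ.tendsto hψ.tendsto (fun n => ae_of_all _ fun _ => rfl) (ae_of_all _ fun _ => rfl)
  · refine tendsto_eLpNorm_add_smul t
      (fun n => (continuous_classicalGrad (hφ.contDiff n)).fst.aestronglyMeasurable)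
      (hw.2 R hR).2.1.1
      (fun n => (continuous_classicalGrad (hψ.contDiff n)).fst.aestronglyMeasurable)
      (hv.2 R hR).2.1.1 hφ.tendsto_fst hψ.tendsto_fst (fun n => ae_of_all _ fun p => ?_)
      (hae.mono fun p hp => by beta_reduce at hp ⊢; rw [hp]; simp)
    beta_reduce
    rw [classicalGrad_add_smul (hφ.contDiff n) (hψ.contDiff n)]; simp
  · refine tendsto_eLpNorm_add_smul t
      (fun n => (continuous_classicalGrad (hφ.contDiff n)).snd.aestronglyMeasurable)
      (hw.2 R hR).2.2.1
      (fun n => (continuous_classicalGrad (hψ.contDiff n)).snd.aestronglyMeasurable)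
      (hv.2 R hR).2.2.1 hφ.tendsto_snd hψ.tendsto_snd (fun n => ae_of_all _ fun p => ?_)
      (hae.mono fun p hp => by beta_reduce at hp ⊢; rw [hp]; simp)
    beta_reduce
    rw [classicalGrad_add_smul (hφ.contDiff n) (hψ.contDiff n)]; simp

/-- `τ` is the trace of `w` on the segment `(0, R) × {0}`: the condition of `IsTrace` for a single
half-disc. -/
def IsTraceOn (R : ℝ) (w : ℝ × ℝ → ℝ) (τ : ℝ → ℝ) : Prop :=
  MemLp τ 2 (volume.restrict (Ioo 0 R)) ∧ ∃ φ, IsApprox R w φ ∧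
    Tendsto (fun n => eLpNorm (fun x => φ n (x, 0) - τ x) 2 (volume.restrict (Ioo 0 R)))
      atTop (𝓝 0)

theorem isTrace_iff {w : ℝ × ℝ → ℝ} {τ : ℝ → ℝ} :
    IsTrace w τ ↔ ∀ R : ℝ, 0 < R → IsTraceOn R w τ := by
  refine forall₂_congr fun R _ => and_congr_right fun _ => ⟨?_, ?_⟩
  · rintro ⟨φ, h1, h2, h3, h4, h5⟩
    exact ⟨φ, ⟨h1, h2, h3, h4⟩, h5⟩
  · rintro ⟨φ, ⟨h1, h2, h3, h4⟩, h5⟩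
    exact ⟨φ, h1, h2, h3, h4, h5⟩

theorem IsTraceOn.mono {r R : ℝ} (hr : 0 ≤ r) (h : r ≤ R) {w : ℝ × ℝ → ℝ} {τ : ℝ → ℝ}
    (hτ : IsTraceOn R w τ) : IsTraceOn r w τ := by
  have hm : volume.restrict (Ioo 0 r) ≤ volume.restrict (Ioo 0 R) :=
    Measure.restrict_mono (Ioo_subset_Ioo_right h) le_rfl
  obtain ⟨h1, φ, h2, h3⟩ := hτ
  exact ⟨h1.mono_measure hm, φ, h2.mono hr h,
    tendsto_of_tendsto_of_tendsto_of_le_of_le tendsto_const_nhds h3 (fun _ => bot_le)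
      fun n => eLpNorm_mono_measure _ hm⟩

theorem IsTraceOn.congr {R : ℝ} {w : ℝ × ℝ → ℝ} {τ σ : ℝ → ℝ}
    (hτ : IsTraceOn R w τ) (h : τ =ᵐ[volume.restrict (Ioo 0 R)] σ) : IsTraceOn R w σ := by
  obtain ⟨h1, φ, h2, h3⟩ := hτ
  refine ⟨h1.ae_eq h, φ, h2, h3.congr fun n => eLpNorm_congr_ae ?_⟩
  filter_upwards [h] with x hx
  rw [hx]

theorem aestronglyMeasurable_boundary {φ : ℝ × ℝ → ℝ} (h : ContDiff ℝ ∞ φ) {μ : Measure ℝ} :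
    AEStronglyMeasurable (fun x => φ (x, 0)) μ :=
  (h.continuous.comp (Continuous.prodMk_left 0)).aestronglyMeasurable

theorem IsTraceOn.add_smul {R : ℝ} (hR : 0 < R) {w v : ℝ × ℝ → ℝ} (hw : w ∈ H) (hv : v ∈ H)
    {τ σ : ℝ → ℝ} (hτ : IsTraceOn R w τ) (hσ : IsTraceOn R v σ) (t : ℝ) :
    IsTraceOn R (fun p => w p + t * v p) (fun x => τ x + t * σ x) := by
  obtain ⟨h1, φ, h2, h3⟩ := hτ
  obtain ⟨k1, ψ, k2, k3⟩ := hσ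
  exact ⟨h1.add (k1.const_mul t), _, h2.add_smul hR hw hv k2 t, tendsto_eLpNorm_add_smul t
    (fun n => aestronglyMeasurable_boundary (h2.contDiff n)) h1.1
    (fun n => aestronglyMeasurable_boundary (k2.contDiff n)) k1.1 h3 k3
    (fun n => ae_of_all _ fun _ => rfl) (ae_of_all _ fun _ => rfl)⟩

theorem IsTrace.add_smul {w v : ℝ × ℝ → ℝ} (hw : w ∈ H) (hv : v ∈ H)
    {τ σ : ℝ → ℝ} (hτ : IsTrace w τ) (hσ : IsTrace v σ) (t : ℝ) :
    IsTrace (fun p => w p + t * v p) (fun x => τ x + t * σ x) :=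
  isTrace_iff.2 fun R hR => (isTrace_iff.1 hτ R hR).add_smul hR hw hv (isTrace_iff.1 hσ R hR) t

theorem lintegral_rect_le_eLpNorm_sq {R : ℝ} (hR : 0 < R) (f : ℝ × ℝ → ℝ) :
    ∫⁻ p in rect R, ‖f p‖ₑ ^ 2 ≤ eLpNorm f 2 (volume.restrict (halfDisc (2 * R))) ^ 2 := by
  rw [eLpNorm_two_sq]
  exact lintegral_mono_set (rect_subset_halfDisc hR)

theorem exists_boundary_bound {R : ℝ} (hR : 0 < R) : ∃ C : ℝ≥0∞, C ≠ ⊤ ∧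
    ∀ φ : ℝ × ℝ → ℝ, ContDiff ℝ ∞ φ →
      eLpNorm (fun x => φ (x, 0)) 2 (volume.restrict (Ioo 0 R)) ^ 2 ≤
        C * (eLpNorm φ 2 (volume.restrict (halfDisc (2 * R))) ^ 2
          + eLpNorm (fun p => (classicalGrad φ p).2) 2 (volume.restrict (halfDisc (2 * R))) ^ 2) := by
  set ρ := ENNReal.ofReal R with hρ
  have hρ0 : ρ ≠ 0 := by simpa [hρ] using hR
  have hρt : ρ ≠ ⊤ := ENNReal.ofReal_ne_top
  refine ⟨ρ⁻¹ * (4 + 4 * ρ ^ 2), by finiteness, fun φ h => ?_⟩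
  have h1 := lintegral_boundary_sq_le h hR
  rw [eLpNorm_two_sq]
  set D0 := eLpNorm φ 2 (volume.restrict (halfDisc (2 * R))) ^ 2
  set D2 := eLpNorm (fun p => (classicalGrad φ p).2) 2 (volume.restrict (halfDisc (2 * R))) ^ 2
  calc ∫⁻ x in Ioo 0 R, ‖φ (x, 0)‖ₑ ^ 2 = ρ⁻¹ * (ρ * ∫⁻ x in Ioo 0 R, ‖φ (x, 0)‖ₑ ^ 2) := by
        rw [← mul_assoc, ENNReal.inv_mul_cancel hρ0 hρt, one_mul]
    _ ≤ ρ⁻¹ * (4 * D0 + 4 * ρ ^ 2 * D2) := by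
        gcongr
        refine h1.trans ?_
        gcongr
        · exact lintegral_rect_le_eLpNorm_sq hR _
        · exact lintegral_rect_le_eLpNorm_sq hR _
    _ ≤ ρ⁻¹ * (4 * D0 + 4 * ρ ^ 2 * D2) + ρ⁻¹ * (4 * ρ ^ 2 * D0 + 4 * D2) := le_self_add
    _ = ρ⁻¹ * (4 + 4 * ρ ^ 2) * (D0 + D2) := by ring

/-- The trace inequality. -/
theorem exists_trace_bound {R : ℝ} (hR : 0 < R) : ∃ C : ℝ≥0∞, C ≠ ⊤ ∧
    ∀ w ∈ H, ∀ τ, IsTraceOn (2 * R) w τ →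
      eLpNorm τ 2 (volume.restrict (Ioo 0 R)) ^ 2 ≤
        C * (eLpNorm w 2 (volume.restrict (halfDisc (2 * R))) ^ 2
          + eLpNorm (fun p => (weakGrad w p).2) 2 (volume.restrict (halfDisc (2 * R))) ^ 2) := by
  obtain ⟨C, hC, hb⟩ := exists_boundary_bound hR
  refine ⟨C, hC, fun w hw τ hτ => ?_⟩
  have h1 := (hτ.mono hR.le (by linarith : R ≤ 2 * R)).1
  obtain ⟨-, φ, h2, h3⟩ := hτ
  have hm : volume.restrict (Ioo 0 R) ≤ volume.restrict (Ioo 0 (2 * R)) :=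
    Measure.restrict_mono (Ioo_subset_Ioo_right (by linarith)) le_rfl
  have h3' : Tendsto (fun n => eLpNorm (fun x => φ n (x, 0) - τ x) 2 (volume.restrict (Ioo 0 R)))
      atTop (𝓝 0) :=
    tendsto_of_tendsto_of_tendsto_of_le_of_le tendsto_const_nhds h3 (fun _ => bot_le)
      fun n => eLpNorm_mono_measure _ hm
  have hL := hw.2 (2 * R) (by positivity)
  refine le_of_tendsto_of_tendsto' (tendsto_eLpNorm_sq
    (fun n => aestronglyMeasurable_boundary (h2.contDiff n)) h1 h3')
    (ENNReal.Tendsto.const_mul ((tendsto_eLpNorm_sq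
      (fun n => (h2.contDiff n).continuous.aestronglyMeasurable) hL.1 h2.tendsto).add
      (tendsto_eLpNorm_sq
      (fun n => (continuous_classicalGrad (h2.contDiff n)).snd.aestronglyMeasurable)
      hL.2.2 h2.tendsto_snd)) (Or.inr hC)) fun n => hb _ (h2.contDiff n)

theorem weakGrad_zero : weakGrad (fun _ => 0) =ᵐ[volume.restrict halfPlane] fun _ => 0 := by
  have h := (isWeakGrad_classicalGrad (u := fun _ => 0) contDiff_const).weakGrad_ae_eq
  filter_upwards [h] with p hp
  rw [hp]
  simp [classicalGrad]

theorem IsTraceOn.ae_eq {R : ℝ} (hR : 0 < R) {w : ℝ × ℝ → ℝ} (hw : w ∈ H) {τ σ : ℝ → ℝ}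
    (hτ : IsTraceOn (2 * R) w τ) (hσ : IsTraceOn (2 * R) w σ) :
    τ =ᵐ[volume.restrict (Ioo 0 R)] σ := by
  obtain ⟨C, -, hb⟩ := exists_trace_bound hR
  have h := hτ.add_smul (by positivity) hw hw hσ (-1)
  have e0 : (fun p => w p + -1 * w p) = fun _ => 0 := by ext p; ring
  rw [e0] at h
  have h1 := hb _ (mem_H_of_contDiff contDiff_const) _ h
  have e1 : eLpNorm (fun p => (weakGrad (fun _ => 0) p).2) 2
      (volume.restrict (halfDisc (2 * R))) = 0 := by
    rw [eLpNorm_congr_ae (g := fun _ => 0) (ae_halfDisc_of_halfPlane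
      (weakGrad_zero.mono fun p hp => by simp only [hp]; rfl))]
    simp
  have hR2 : Ioo 0 R ⊆ Ioo 0 (2 * R) := Ioo_subset_Ioo_right (by linarith)
  have e2 : eLpNorm (fun _ : ℝ × ℝ => (0 : ℝ)) 2 (volume.restrict (halfDisc (2 * R))) = 0 := by simp
  rw [e1, e2] at h1
  have h2 : eLpNorm (fun x => τ x + -1 * σ x) 2 (volume.restrict (Ioo 0 R)) = 0 := by
    simpa using h1
  rw [eLpNorm_eq_zero_iff (h.1.1.mono_measure (Measure.restrict_mono hR2 le_rfl)) (by norm_num)] at h2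
  filter_upwards [h2] with x hx
  simp only [Pi.zero_apply] at hx
  linarith

theorem ae_Ioi_of_Ioo {P : ℝ → Prop}
    (h : ∀ R : ℝ, 0 < R → ∀ᵐ x ∂volume.restrict (Ioo 0 R), P x) :
    ∀ᵐ x ∂volume.restrict (Ioi (0 : ℝ)), P x := by
  have e : Ioi (0 : ℝ) = ⋃ n : ℕ, Ioo (0 : ℝ) (n + 1) := by
    ext x
    simp only [mem_Ioi, mem_iUnion, mem_Ioo, exists_and_left, iff_self_and]
    intro _
    obtain ⟨n, hn⟩ := exists_nat_gt x
    exact ⟨n, by linarith⟩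
  rw [e, ae_restrict_iUnion_iff]
  exact fun n => h _ (by positivity)

/-- The trace is unique up to null sets. -/
theorem IsTrace.ae_eq {w : ℝ × ℝ → ℝ} (hw : w ∈ H) {τ σ : ℝ → ℝ} (hτ : IsTrace w τ)
    (hσ : IsTrace w σ) : τ =ᵐ[volume.restrict (Ioi 0)] σ :=
  ae_Ioi_of_Ioo fun R hR => IsTraceOn.ae_eq hR hw (isTrace_iff.1 hτ _ (by positivity))
    (isTrace_iff.1 hσ _ (by positivity))

theorem memLp_boundary {φ : ℝ × ℝ → ℝ} (h : ContDiff ℝ ∞ φ) (R : ℝ) :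
    MemLp (fun x => φ (x, 0)) 2 (volume.restrict (Ioo 0 R)) := by
  have hc : Continuous fun x => φ (x, 0) := h.continuous.comp (Continuous.prodMk_left 0)
  obtain ⟨C, hC⟩ := (isCompact_Icc (a := (0 : ℝ)) (b := R)).exists_bound_of_continuousOn
    hc.continuousOn
  refine MemLp.of_bound hc.aestronglyMeasurable C ?_
  filter_upwards [ae_restrict_mem measurableSet_Ioo] with x hx using hC x (Ioo_subset_Icc_self hx)

theorem exists_isTraceOn {w : ℝ × ℝ → ℝ} (hw : w ∈ H) {R : ℝ} (hR : 0 < R) :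
    ∃ τ, IsTraceOn R w τ := by
  obtain ⟨φ, hφ⟩ := exists_isApprox hw (R := 2 * R) (by positivity)
  obtain ⟨C, hC, hb⟩ := exists_boundary_bound hR
  have hL := hw.2 (2 * R) (by positivity)
  set d : ℕ → ℝ≥0∞ := fun n => C * (4 * eLpNorm (fun p => φ n p - w p) 2
      (volume.restrict (halfDisc (2 * R))) ^ 2 +
      4 * eLpNorm (fun p => (classicalGrad (φ n) p).2 - (weakGrad w p).2) 2
      (volume.restrict (halfDisc (2 * R))) ^ 2) with hd
  have hd0 : Tendsto d atTop (𝓝 0) := by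
    have h1 := (ENNReal.Tendsto.const_mul (a := 4) (ENNReal.Tendsto.pow (n := 2) hφ.tendsto)
      (Or.inr (by norm_num))).add (ENNReal.Tendsto.const_mul (a := 4)
        (ENNReal.Tendsto.pow (n := 2) hφ.tendsto_snd) (Or.inr (by norm_num)))
    have h2 := ENNReal.Tendsto.const_mul (a := C) h1 (Or.inr hC)
    simpa using h2
  obtain ⟨τ, h1, h2⟩ := exists_tendsto_eLpNorm_of_sq_le (μ := volume.restrict (Ioo 0 R))
    (f := fun n x => φ n (x, 0)) (fun n => memLp_boundary (hφ.contDiff n) R) hd0 fun n m => by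
      have h1 := hb (fun p => φ n p + -1 * φ m p)
        ((hφ.contDiff n).add (contDiff_const.mul (hφ.contDiff m)))
      have e1 : (fun p => φ n p + -1 * φ m p) = fun p => φ n p - φ m p := by ext p; ring
      have e2 : (fun p => (classicalGrad (fun p => φ n p + -1 * φ m p) p).2)
          = fun p => (classicalGrad (φ n) p).2 - (classicalGrad (φ m) p).2 := by
        ext p
        rw [classicalGrad_add_smul (hφ.contDiff n) (hφ.contDiff m)]; simp; ring
      rw [e2, e1] at h1
      have e3 : (fun x : ℝ => φ n (x, 0) + -1 * φ m (x, 0)) = fun x => φ n (x, 0) - φ m (x, 0) := by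
        ext x; ring
      simp only [e3] at h1
      refine h1.trans ?_
      have k1 := eLpNorm_sub_sq_le_of_approx (μ := volume.restrict (halfDisc (2 * R)))
        (hφ.contDiff n).continuous.aestronglyMeasurable
        (hφ.contDiff m).continuous.aestronglyMeasurable hL.1.1
      have k2 := eLpNorm_sub_sq_le_of_approx (μ := volume.restrict (halfDisc (2 * R)))
        (continuous_classicalGrad (hφ.contDiff n)).snd.aestronglyMeasurable
        (continuous_classicalGrad (hφ.contDiff m)).snd.aestronglyMeasurable hL.2.2.1
      refine (mul_le_mul_right (add_le_add k1 k2) C).trans (le_of_eq ?_)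
      simp only [hd]
      ring
  exact ⟨τ, h1, φ, hφ.mono hR.le (by linarith), h2⟩

/-- The trace theorem: every function of `H` has a trace. -/
theorem exists_isTrace {w : ℝ × ℝ → ℝ} (hw : w ∈ H) : ∃ τ, IsTrace w τ := by
  have hex : ∀ k : ℕ, ∃ τ, IsTraceOn (2 * (k + 1)) w τ := fun k => exists_isTraceOn hw (by positivity)
  choose σ hσ using hex
  have hagree : ∀ k j : ℕ, k ≤ j → σ k =ᵐ[volume.restrict (Ioo 0 ((k : ℝ) + 1))] σ j := fun k j h =>
    IsTraceOn.ae_eq (by positivity) hw (hσ k) ((hσ j).mono (by positivity) (by gcongr))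
  refine ⟨fun x => σ ⌊x⌋₊ x, isTrace_iff.2 fun R hR => ?_⟩
  obtain ⟨N, hN⟩ := exists_nat_gt R
  refine ((hσ N).mono hR.le (by linarith)).congr ?_
  have hall : ∀ᵐ x, ∀ k : ℕ, k ≤ N → x ∈ Ioo (0 : ℝ) (k + 1) → σ k x = σ N x := by
    rw [ae_all_iff]
    intro k
    by_cases hk : k ≤ N
    · have := (ae_restrict_iff' measurableSet_Ioo).1 (hagree k N hk)
      filter_upwards [this] with x hx _ using hx
    · exact ae_of_all _ fun x h => absurd h hk
  rw [EventuallyEq, ae_restrict_iff' measurableSet_Ioo]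
  filter_upwards [hall] with x hx hxR
  refine (hx ⌊x⌋₊ ?_ ⟨hxR.1, Nat.lt_floor_add_one x⟩).symm
  exact (Nat.floor_le_floor (hxR.2.trans hN).le).trans (Nat.floor_natCast N).le

theorem isTrace_trace {w : ℝ × ℝ → ℝ} (hw : w ∈ H) : IsTrace w (trace w) := by
  have h := exists_isTrace hw
  rw [trace, dif_pos h]
  exact h.choose_spec

theorem trace_ae_eq {w : ℝ × ℝ → ℝ} (hw : w ∈ H) {τ : ℝ → ℝ} (h : IsTrace w τ) :
    trace w =ᵐ[volume.restrict (Ioi 0)] τ := (isTrace_trace hw).ae_eq hw h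

theorem trace_add_smul {w v : ℝ × ℝ → ℝ} (hw : w ∈ H) (hv : v ∈ H) (t : ℝ) :
    trace (fun p => w p + t * v p) =ᵐ[volume.restrict (Ioi 0)] fun x => trace w x + t * trace v x :=
  trace_ae_eq (add_smul_mem_H hw hv t) ((isTrace_trace hw).add_smul hw hv (isTrace_trace hv) t)

/-! ### The Poincaré inequality and the weighted trace estimate -/

/-- Poincaré inequality in `H`, with a boundary term on the positive axis. -/
theorem exists_poincare_bound {R : ℝ} (hR : 0 < R) : ∃ C : ℝ≥0∞, C ≠ ⊤ ∧ ∀ w ∈ H,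
    eLpNorm w 2 (volume.restrict (halfDisc R)) ^ 2 ≤
      C * (eLpNorm (trace w) 2 (volume.restrict (Ioo 0 (2 * R))) ^ 2
        + eLpNorm (fun p => (weakGrad w p).1) 2 (volume.restrict (halfDisc (2 * R))) ^ 2
        + eLpNorm (fun p => (weakGrad w p).2) 2 (volume.restrict (halfDisc (2 * R))) ^ 2) := by
  obtain ⟨C, hC, hb⟩ := lintegral_rect_sq_le hR
  refine ⟨C, hC, fun w hw => ?_⟩
  obtain ⟨h1, φ, h2, h3⟩ := isTrace_iff.1 (isTrace_trace hw) (2 * R) (by positivity)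
  have hL := hw.2 (2 * R) (by positivity)
  have hL' := hw.2 R hR
  have h2' := h2.mono hR.le (by linarith : R ≤ 2 * R)
  refine le_of_tendsto_of_tendsto' (tendsto_eLpNorm_sq
    (fun n => (h2.contDiff n).continuous.aestronglyMeasurable) hL'.1 h2'.tendsto)
    (ENNReal.Tendsto.const_mul (((tendsto_eLpNorm_sq
      (fun n => aestronglyMeasurable_boundary (h2.contDiff n)) h1 h3).add (tendsto_eLpNorm_sq
      (fun n => (continuous_classicalGrad (h2.contDiff n)).fst.aestronglyMeasurable)
      hL.2.1 h2.tendsto_fst)).add (tendsto_eLpNorm_sq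
      (fun n => (continuous_classicalGrad (h2.contDiff n)).snd.aestronglyMeasurable)
      hL.2.2 h2.tendsto_snd)) (Or.inr hC)) fun n => ?_
  calc eLpNorm (φ n) 2 (volume.restrict (halfDisc R)) ^ 2 ≤ ∫⁻ p in rect R, ‖φ n p‖ₑ ^ 2 := by
        rw [eLpNorm_two_sq]
        exact lintegral_mono_set (halfDisc_subset_rect hR)
    _ ≤ _ := hb _ (h2.contDiff n)
    _ ≤ _ := by
        gcongr
        · rw [eLpNorm_two_sq]
          exact lintegral_mono_set (Ioo_subset_Ioo_right (by linarith))
        · exact lintegral_rect_le_eLpNorm_sq hR _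
        · exact lintegral_rect_le_eLpNorm_sq hR _

/-- The weighted trace estimate in `H`. -/
theorem exists_weight_bound : ∃ C : ℝ≥0∞, C ≠ ⊤ ∧ ∀ w ∈ H,
    ∫⁻ x in Ioo (0 : ℝ) 1, ENNReal.ofReal (x ^ (-(1 / 2) : ℝ)) * ‖trace w x‖ₑ ≤
      C * (1 + eLpNorm (trace w) 2 (volume.restrict (Ioo 0 1)) ^ 2
        + eLpNorm (fun p => (weakGrad w p).1) 2 (volume.restrict (halfDisc 2)) ^ 2
        + eLpNorm (fun p => (weakGrad w p).2) 2 (volume.restrict (halfDisc 2)) ^ 2) := by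
  obtain ⟨C, hC, hb⟩ := lintegral_weight_mul_le
  refine ⟨C, hC, fun w hw => ?_⟩
  obtain ⟨-, φ, h2, h3⟩ := isTrace_iff.1 (isTrace_trace hw) 2 (by positivity)
  have h1 := (isTrace_iff.1 (isTrace_trace hw) 1 (by positivity)).1
  have hL := hw.2 2 (by positivity)
  have h3' : Tendsto (fun n => eLpNorm (fun x => φ n (x, 0) - trace w x) 2
      (volume.restrict (Ioo 0 1))) atTop (𝓝 0) :=
    tendsto_of_tendsto_of_tendsto_of_le_of_le tendsto_const_nhds h3 (fun _ => bot_le)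
      fun n => eLpNorm_mono_measure _
        (Measure.restrict_mono (Ioo_subset_Ioo_right (by norm_num)) le_rfl)
  have hmeas : TendstoInMeasure (volume.restrict (Ioo (0 : ℝ) 1)) (fun n x => φ n (x, 0)) atTop
      (trace w) := tendstoInMeasure_of_tendsto_eLpNorm (by norm_num)
    (fun n => aestronglyMeasurable_boundary (h2.contDiff n)) h1.1 h3'
  obtain ⟨ns, hns, hae⟩ := hmeas.exists_seq_tendsto_ae
  set k : ℝ → ℝ≥0∞ := fun x => ENNReal.ofReal (x ^ (-(1 / 2) : ℝ)) with hk
  have hlim := (ENNReal.Tendsto.const_mul (((tendsto_const_nhds (x := (1 : ℝ≥0∞))).add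
      (tendsto_eLpNorm_sq
      (fun n => aestronglyMeasurable_boundary (h2.contDiff n)) h1 h3')).add (tendsto_eLpNorm_sq
      (fun n => (continuous_classicalGrad (h2.contDiff n)).fst.aestronglyMeasurable)
      hL.2.1 h2.tendsto_fst) |>.add (tendsto_eLpNorm_sq
      (fun n => (continuous_classicalGrad (h2.contDiff n)).snd.aestronglyMeasurable)
      hL.2.2 h2.tendsto_snd)) (Or.inr hC)).comp hns.tendsto_atTop
  -- Fatou's lemma along an almost everywhere convergent subsequence of boundary values
  calc ∫⁻ x in Ioo (0 : ℝ) 1, k x * ‖trace w x‖ₑ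
      = ∫⁻ x in Ioo (0 : ℝ) 1, liminf (fun n => k x * ‖φ (ns n) (x, 0)‖ₑ) atTop := by
        refine lintegral_congr_ae ?_
        filter_upwards [hae] with x hx
        exact (ENNReal.Tendsto.const_mul hx.enorm (Or.inr ENNReal.ofReal_ne_top)).liminf_eq.symm
    _ ≤ liminf (fun n => ∫⁻ x in Ioo (0 : ℝ) 1, k x * ‖φ (ns n) (x, 0)‖ₑ) atTop := by
        refine lintegral_liminf_le fun n => ?_
        have := ((h2.contDiff (ns n)).continuous.comp (Continuous.prodMk_left (0 : ℝ))).measurable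
        exact Measurable.mul (by fun_prop) this.enorm
    _ ≤ liminf (fun n => _) atTop := liminf_le_liminf (Eventually.of_forall fun n =>
        (hb _ (h2.contDiff (ns n))).trans ?_)
    _ = _ := hlim.liminf_eq
  simp only [Function.comp_apply]
  rw [← eLpNorm_two_sq (fun x : ℝ => φ (ns n) (x, 0))]
  have hr := rect_subset_halfDisc one_pos
  rw [mul_one] at hr
  gcongr
  · rw [eLpNorm_two_sq]; exact lintegral_mono_set hr
  · rw [eLpNorm_two_sq]; exact lintegral_mono_set hr

/-! ### Closedness -/

theorem tendsto_setIntegral_mul {R : ℝ} {f : ℕ → ℝ × ℝ → ℝ} {g ψ : ℝ × ℝ → ℝ}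
    (hf : ∀ n, MemLp (f n) 2 (volume.restrict (halfDisc R)))
    (hg : MemLp g 2 (volume.restrict (halfDisc R)))
    (h : Tendsto (fun n => eLpNorm (fun p => f n p - g p) 2 (volume.restrict (halfDisc R)))
      atTop (𝓝 0)) (hψ : Continuous ψ) :
    Tendsto (fun n => ∫ p in halfDisc R, f n p * ψ p) atTop (𝓝 (∫ p in halfDisc R, g p * ψ p)) := by
  have hψ2 := memLp_halfDisc_of_continuous hψ R 2
  have hψi : ∀ {u : ℝ × ℝ → ℝ}, MemLp u 2 (volume.restrict (halfDisc R)) →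
      Integrable (fun p => u p * ψ p) (volume.restrict (halfDisc R)) := fun hu =>
    hu.integrable_mul hψ2
  refine tendsto_integral_of_L1 _ (hψi hg).1 (Eventually.of_forall fun n => hψi (hf n)) ?_
  have hlim := ENNReal.Tendsto.mul_const (b := eLpNorm ψ 2 (volume.restrict (halfDisc R))) h
    (Or.inr hψ2.eLpNorm_ne_top)
  rw [zero_mul] at hlim
  refine tendsto_of_tendsto_of_tendsto_of_le_of_le tendsto_const_nhds hlim (fun _ => bot_le)
    fun n => ?_
  have e := eLpNorm_le_eLpNorm_mul_eLpNorm_of_nnnorm (p := 2) (q := 2) (r := 1)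
    ((hf n).1.sub hg.1) hψ2.1 (fun a b => a * b) 1 (ae_of_all _ fun p => by simp)
  rw [eLpNorm_one_eq_lintegral_enorm] at e
  simp only [ENNReal.coe_one, one_mul] at e
  refine le_trans (lintegral_mono fun p => ?_) e
  simp only [Pi.sub_apply, sub_mul]
  exact le_rfl

theorem exists_tsupport_subset_halfDisc {ψ : ℝ × ℝ → ℝ} (hc : HasCompactSupport ψ)
    (hs : tsupport ψ ⊆ halfPlane) : ∃ R : ℝ, 0 < R ∧ tsupport ψ ⊆ halfDisc R := by
  obtain ⟨M, hM⟩ := hc.isCompact.bddAbove_image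
    (f := fun p : ℝ × ℝ => p.1 ^ 2 + p.2 ^ 2) (by fun_prop)
  refine ⟨|M| + 1, by positivity, fun p hp => ⟨?_, hs hp⟩⟩
  have h1 : p.1 ^ 2 + p.2 ^ 2 ≤ M := hM (mem_image_of_mem _ hp)
  nlinarith [le_abs_self M, abs_nonneg M]

theorem setIntegral_halfPlane_eq_halfDisc {f ψ : ℝ × ℝ → ℝ} {R : ℝ} (h : tsupport ψ ⊆ halfDisc R) :
    ∫ p in halfPlane, f p * ψ p = ∫ p in halfDisc R, f p * ψ p := by
  rw [setIntegral_eq_integral_of_forall_compl_eq_zero fun p hp => by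
      rw [image_eq_zero_of_notMem_tsupport fun hp' => hp (halfDisc_subset_halfPlane R (h hp')),
        mul_zero],
    setIntegral_eq_integral_of_forall_compl_eq_zero fun p hp => by
      rw [image_eq_zero_of_notMem_tsupport fun hp' => hp (h hp'), mul_zero]]

/-- The weak gradient is a closed operator with respect to local `L²` convergence. -/
theorem isWeakGrad_of_tendsto {w : ℕ → ℝ × ℝ → ℝ} (hw : ∀ n, w n ∈ H) {v G1 G2 : ℝ × ℝ → ℝ}
    (hv : ∀ R : ℝ, 0 < R → MemLp v 2 (volume.restrict (halfDisc R)))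
    (hG1 : ∀ R : ℝ, 0 < R → MemLp G1 2 (volume.restrict (halfDisc R)))
    (hG2 : ∀ R : ℝ, 0 < R → MemLp G2 2 (volume.restrict (halfDisc R)))
    (h0 : ∀ R : ℝ, 0 < R → Tendsto (fun n => eLpNorm (fun p => w n p - v p) 2
      (volume.restrict (halfDisc R))) atTop (𝓝 0))
    (h1 : ∀ R : ℝ, 0 < R → Tendsto (fun n => eLpNorm (fun p => (weakGrad (w n) p).1 - G1 p) 2
      (volume.restrict (halfDisc R))) atTop (𝓝 0))
    (h2 : ∀ R : ℝ, 0 < R → Tendsto (fun n => eLpNorm (fun p => (weakGrad (w n) p).2 - G2 p) 2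
      (volume.restrict (halfDisc R))) atTop (𝓝 0)) :
    IsWeakGrad v (fun p => (G1 p, G2 p)) where
  locallyIntegrableOn := locallyIntegrableOn_of_memLp_halfDisc hv
  locallyIntegrableOn_grad p hp := by
    obtain ⟨n, hn⟩ := exists_mem_halfDisc hp
    refine ⟨halfDisc (n + 1), mem_nhdsWithin_of_mem_nhds ((isOpen_halfDisc _).mem_nhds hn), ?_⟩
    exact ((hG1 _ (by positivity)).integrable (by norm_num)).prodMk
      ((hG2 _ (by positivity)).integrable (by norm_num))
  integral_fst φ k1 k2 k3 := by
    obtain ⟨R, hR, hs⟩ := exists_tsupport_subset_halfDisc k2 k3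
    have hs' := (tsupport_fderiv_apply_subset φ (1, 0)).trans hs
    have t1 := tendsto_setIntegral_mul (fun n => ((hw n).2 R hR).1) (hv R hR) (h0 R hR)
      (continuous_classicalGrad k1).fst
    have t2 := (tendsto_setIntegral_mul (fun n => ((hw n).2 R hR).2.1) (hG1 R hR) (h1 R hR)
      k1.continuous).neg
    have e1 := setIntegral_halfPlane_eq_halfDisc (f := v) hs'
    have e2 := setIntegral_halfPlane_eq_halfDisc (f := G1) hs
    rw [e2]
    refine e1.trans (tendsto_nhds_unique t1 (t2.congr fun n => ?_))
    rw [← setIntegral_halfPlane_eq_halfDisc (f := fun p => (weakGrad (w n) p).1) hs,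
      ← (isWeakGrad_of_mem_H (hw n)).integral_fst φ k1 k2 k3]
    exact setIntegral_halfPlane_eq_halfDisc (f := w n) hs'
  integral_snd φ k1 k2 k3 := by
    obtain ⟨R, hR, hs⟩ := exists_tsupport_subset_halfDisc k2 k3
    have hs' := (tsupport_fderiv_apply_subset φ (0, 1)).trans hs
    have t1 := tendsto_setIntegral_mul (fun n => ((hw n).2 R hR).1) (hv R hR) (h0 R hR)
      (continuous_classicalGrad k1).snd
    have t2 := (tendsto_setIntegral_mul (fun n => ((hw n).2 R hR).2.2) (hG2 R hR) (h2 R hR)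
      k1.continuous).neg
    have e1 := setIntegral_halfPlane_eq_halfDisc (f := v) hs'
    have e2 := setIntegral_halfPlane_eq_halfDisc (f := G2) hs
    rw [e2]
    refine e1.trans (tendsto_nhds_unique t1 (t2.congr fun n => ?_))
    rw [← setIntegral_halfPlane_eq_halfDisc (f := fun p => (weakGrad (w n) p).2) hs,
      ← (isWeakGrad_of_mem_H (hw n)).integral_snd φ k1 k2 k3]
    exact setIntegral_halfPlane_eq_halfDisc (f := w n) hs'

/-- The square of the norm of the energy space: Dirichlet energy plus boundary term. -/
noncomputable def energy (w : ℝ × ℝ → ℝ) : ℝ≥0∞ :=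
  eLpNorm (trace w) 2 (volume.restrict (Ioi 0)) ^ 2
    + eLpNorm (fun p => (weakGrad w p).1) 2 (volume.restrict halfPlane) ^ 2
    + eLpNorm (fun p => (weakGrad w p).2) 2 (volume.restrict halfPlane) ^ 2

/-- A single weighted measure whose `L²` norm is controlled by the energy and controls the `L²`
norms on all half-discs. It lets one complete with respect to all half-discs at once. -/
theorem exists_weighted_measure : ∃ m : Measure (ℝ × ℝ),
    (∀ R : ℝ, 0 < R → ∃ K : ℝ≥0∞, K ≠ ⊤ ∧ volume.restrict (halfDisc R) ≤ K • m) ∧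
    (∀ w ∈ H, AEStronglyMeasurable w m) ∧ ∀ w ∈ H, eLpNorm w 2 m ^ 2 ≤ 2 * energy w := by
  have hpos : ∀ N : ℕ, (0 : ℝ) < N + 1 := fun N => by positivity
  choose C hC hb using fun N : ℕ => exists_poincare_bound (hpos N)
  -- weights that cancel the Poincaré constants and leave a geometric series
  set c : ℕ → ℝ≥0∞ := fun N => 2⁻¹ ^ N * (1 + C N)⁻¹ with hc
  have hc0 : ∀ N, c N ≠ 0 := fun N => mul_ne_zero (pow_ne_zero _ (by norm_num))
    (ENNReal.inv_ne_zero.2 (ENNReal.add_ne_top.2 ⟨by norm_num, hC N⟩))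
  have hct : ∀ N, c N ≠ ⊤ := fun N => ENNReal.mul_ne_top (ENNReal.pow_ne_top (by norm_num))
    (ENNReal.inv_ne_top.2 (by positivity))
  refine ⟨Measure.sum fun N => c N • volume.restrict (halfDisc (N + 1)), fun R hR => ?_,
    fun w hw => ?_, fun w hw => ?_⟩
  · obtain ⟨N, hN⟩ := exists_nat_gt R
    refine ⟨(c N)⁻¹, ENNReal.inv_ne_top.2 (hc0 N), ?_⟩
    calc volume.restrict (halfDisc R) ≤ volume.restrict (halfDisc (N + 1)) :=
          Measure.restrict_mono (halfDisc_mono hR.le (by linarith)) le_rfl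
      _ = (c N)⁻¹ • (c N • volume.restrict (halfDisc (N + 1))) := by
          rw [smul_smul, ENNReal.inv_mul_cancel (hc0 N) (hct N), one_smul]
      _ ≤ _ := by
          gcongr
          exact Measure.le_sum (fun N : ℕ => c N • volume.restrict (halfDisc ((N : ℝ) + 1))) N
  · rw [aestronglyMeasurable_sum_measure_iff]
    exact fun N => (hw.2 _ (hpos N)).1.1.smul_measure _
  · rw [eLpNorm_two_sq, lintegral_sum_measure]
    calc ∑' N, ∫⁻ p, ‖w p‖ₑ ^ 2 ∂(c N • volume.restrict (halfDisc (N + 1)))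
        ≤ ∑' N, 2⁻¹ ^ N * energy w := by
          refine ENNReal.tsum_le_tsum fun N => ?_
          rw [lintegral_smul_measure, ← eLpNorm_two_sq, smul_eq_mul, hc, mul_assoc]
          gcongr
          calc (1 + C N)⁻¹ * eLpNorm w 2 (volume.restrict (halfDisc (N + 1))) ^ 2
              ≤ (1 + C N)⁻¹ * ((1 + C N) * energy w) := by
                gcongr
                refine (hb N w hw).trans ?_
                gcongr
                · exact le_add_self
                · exact add_le_add (add_le_add
                    (pow_le_pow_left' (eLpNorm_mono_measure _
                      (Measure.restrict_mono Ioo_subset_Ioi_self le_rfl)) 2)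
                    (pow_le_pow_left' (eLpNorm_mono_measure _
                      (Measure.restrict_mono (halfDisc_subset_halfPlane _) le_rfl)) 2))
                    (pow_le_pow_left' (eLpNorm_mono_measure _
                      (Measure.restrict_mono (halfDisc_subset_halfPlane _) le_rfl)) 2)
            _ = energy w := by
                rw [← mul_assoc, ENNReal.inv_mul_cancel (by positivity)
                  (ENNReal.add_ne_top.2 ⟨by norm_num, hC N⟩), one_mul]
      _ = 2 * energy w := by
          rw [ENNReal.tsum_mul_right, ENNReal.tsum_geometric, ENNReal.one_sub_inv_two, inv_inv]

theorem aestronglyMeasurable_Ioi_of_Ioo {τ : ℝ → ℝ}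
    (h : ∀ R : ℝ, 0 < R → MemLp τ 2 (volume.restrict (Ioo 0 R))) :
    AEStronglyMeasurable τ (volume.restrict (Ioi 0)) := by
  have e : Ioi (0 : ℝ) = ⋃ n : ℕ, Ioo (0 : ℝ) (n + 1) := by
    ext x
    simp only [mem_Ioi, mem_iUnion, mem_Ioo, exists_and_left, iff_self_and]
    intro _
    obtain ⟨n, hn⟩ := exists_nat_gt x
    exact ⟨n, by linarith⟩
  rw [e, aestronglyMeasurable_iUnion_iff]
  exact fun n => (h _ (by positivity)).1

theorem memLp_trace {w : ℝ × ℝ → ℝ} (hw : w ∈ H) (R : ℝ) (hR : 0 < R) :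
    MemLp (trace w) 2 (volume.restrict (Ioo 0 R)) := (isTrace_iff.1 (isTrace_trace hw) R hR).1

theorem aestronglyMeasurable_trace {w : ℝ × ℝ → ℝ} (hw : w ∈ H) :
    AEStronglyMeasurable (trace w) (volume.restrict (Ioi 0)) :=
  aestronglyMeasurable_Ioi_of_Ioo (memLp_trace hw)

theorem aestronglyMeasurable_weakGrad {w : ℝ × ℝ → ℝ} (hw : w ∈ H) :
    AEStronglyMeasurable (weakGrad w) (volume.restrict halfPlane) :=
  (isWeakGrad_of_mem_H hw).locallyIntegrableOn_grad.aestronglyMeasurable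

theorem energy_sub_le {w v : ℝ × ℝ → ℝ} (hw : w ∈ H) (hv : v ∈ H) {G1 G2 : ℝ × ℝ → ℝ} {τ : ℝ → ℝ}
    (hG1 : AEStronglyMeasurable G1 (volume.restrict halfPlane))
    (hG2 : AEStronglyMeasurable G2 (volume.restrict halfPlane))
    (hτ : AEStronglyMeasurable τ (volume.restrict (Ioi 0))) :
    energy (fun p => w p + -1 * v p) ≤
      4 * (eLpNorm (fun x => trace w x - τ x) 2 (volume.restrict (Ioi 0)) ^ 2
        + eLpNorm (fun p => (weakGrad w p).1 - G1 p) 2 (volume.restrict halfPlane) ^ 2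
        + eLpNorm (fun p => (weakGrad w p).2 - G2 p) 2 (volume.restrict halfPlane) ^ 2)
      + 4 * (eLpNorm (fun x => trace v x - τ x) 2 (volume.restrict (Ioi 0)) ^ 2
        + eLpNorm (fun p => (weakGrad v p).1 - G1 p) 2 (volume.restrict halfPlane) ^ 2
        + eLpNorm (fun p => (weakGrad v p).2 - G2 p) 2 (volume.restrict halfPlane) ^ 2) := by
  have hg := weakGrad_add_smul hw hv (-1)
  have mw := aestronglyMeasurable_weakGrad hw
  have mv := aestronglyMeasurable_weakGrad hv
  have e1 : eLpNorm (trace (fun p => w p + -1 * v p)) 2 (volume.restrict (Ioi 0))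
      = eLpNorm (fun x => trace w x - trace v x) 2 (volume.restrict (Ioi 0)) :=
    eLpNorm_congr_ae ((trace_add_smul hw hv (-1)).mono fun x hx => by rw [hx]; ring)
  have e2 : eLpNorm (fun p => (weakGrad (fun p => w p + -1 * v p) p).1) 2 (volume.restrict halfPlane)
      = eLpNorm (fun p => (weakGrad w p).1 - (weakGrad v p).1) 2 (volume.restrict halfPlane) :=
    eLpNorm_congr_ae (hg.mono fun p hp => by beta_reduce at hp ⊢; rw [hp]; simp; ring)
  have e3 : eLpNorm (fun p => (weakGrad (fun p => w p + -1 * v p) p).2) 2 (volume.restrict halfPlane)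
      = eLpNorm (fun p => (weakGrad w p).2 - (weakGrad v p).2) 2 (volume.restrict halfPlane) :=
    eLpNorm_congr_ae (hg.mono fun p hp => by beta_reduce at hp ⊢; rw [hp]; simp; ring)
  rw [energy, e1, e2, e3]
  refine (add_le_add (add_le_add
    (eLpNorm_sub_sq_le_of_approx (aestronglyMeasurable_trace hw) (aestronglyMeasurable_trace hv) hτ)
    (eLpNorm_sub_sq_le_of_approx mw.fst mv.fst hG1))
    (eLpNorm_sub_sq_le_of_approx mw.snd mv.snd hG2)).trans (le_of_eq (by ring))

/-- Completeness of the energy space: if gradients converge in `L²(ℝ²₊)` and traces converge in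
`L²(0, ∞)`, the limits are the gradient and the trace of one function of `H`. -/
theorem exists_mem_H_of_tendsto {w : ℕ → ℝ × ℝ → ℝ} (hw : ∀ n, w n ∈ H) {G1 G2 : ℝ × ℝ → ℝ}
    {τ : ℝ → ℝ} (hG1 : MemLp G1 2 (volume.restrict halfPlane))
    (hG2 : MemLp G2 2 (volume.restrict halfPlane))
    (hτ : ∀ R : ℝ, 0 < R → MemLp τ 2 (volume.restrict (Ioo 0 R)))
    (f1 : ∀ n, eLpNorm (fun p => (weakGrad (w n) p).1 - G1 p) 2 (volume.restrict halfPlane) ≠ ⊤)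
    (f2 : ∀ n, eLpNorm (fun p => (weakGrad (w n) p).2 - G2 p) 2 (volume.restrict halfPlane) ≠ ⊤)
    (f3 : ∀ n, eLpNorm (fun x => trace (w n) x - τ x) 2 (volume.restrict (Ioi 0)) ≠ ⊤)
    (h1 : Tendsto (fun n => eLpNorm (fun p => (weakGrad (w n) p).1 - G1 p) 2
      (volume.restrict halfPlane)) atTop (𝓝 0))
    (h2 : Tendsto (fun n => eLpNorm (fun p => (weakGrad (w n) p).2 - G2 p) 2
      (volume.restrict halfPlane)) atTop (𝓝 0))
    (h3 : Tendsto (fun n => eLpNorm (fun x => trace (w n) x - τ x) 2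
      (volume.restrict (Ioi 0))) atTop (𝓝 0)) :
    ∃ v ∈ H, (weakGrad v =ᵐ[volume.restrict halfPlane] fun p => (G1 p, G2 p)) ∧
      trace v =ᵐ[volume.restrict (Ioi 0)] τ := by
  obtain ⟨m, hmK, hmm, hme⟩ := exists_weighted_measure
  have mτ := aestronglyMeasurable_Ioi_of_Ioo hτ
  set D : ℕ → ℝ≥0∞ := fun n => eLpNorm (fun x => trace (w n) x - τ x) 2 (volume.restrict (Ioi 0)) ^ 2
        + eLpNorm (fun p => (weakGrad (w n) p).1 - G1 p) 2 (volume.restrict halfPlane) ^ 2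
        + eLpNorm (fun p => (weakGrad (w n) p).2 - G2 p) 2 (volume.restrict halfPlane) ^ 2 with hD
  have hDt : ∀ n, D n ≠ ⊤ := fun n => ENNReal.add_ne_top.2 ⟨ENNReal.add_ne_top.2
    ⟨ENNReal.pow_ne_top (f3 n), ENNReal.pow_ne_top (f1 n)⟩, ENNReal.pow_ne_top (f2 n)⟩
  have hD0 : Tendsto (fun n => 8 * D n) atTop (𝓝 0) := by
    have := ENNReal.Tendsto.const_mul (a := 8) (((ENNReal.Tendsto.pow (n := 2) h3).add
      (ENNReal.Tendsto.pow (n := 2) h1)).add (ENNReal.Tendsto.pow (n := 2) h2))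
      (Or.inr (by norm_num))
    simpa using this
  have hdiff : ∀ n k, eLpNorm (fun p => w n p - w k p) 2 m ^ 2 ≤ 8 * D n + 8 * D k := by
    intro n k
    have e : (fun p => w n p - w k p) = fun p => w n p + -1 * w k p := by ext p; ring
    rw [e]
    refine (hme _ (add_smul_mem_H (hw n) (hw k) (-1))).trans ?_
    refine (mul_le_mul_right (energy_sub_le (hw n) (hw k) hG1.1 hG2.1 mτ) 2).trans (le_of_eq ?_)
    simp only [hD]
    ring
  -- `w n` itself may have infinite `L²(m)` norm, but the differences `w n - w 0` do not
  have hfL : ∀ n, MemLp (fun p => w n p - w 0 p) 2 m := fun n => by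
    refine ⟨(hmm _ (hw n)).sub (hmm _ (hw 0)), lt_top_iff_ne_top.2 fun h => ?_⟩
    have := hdiff n 0
    rw [h] at this
    have h8 : ∀ n, 8 * D n ≠ ⊤ := fun n => ENNReal.mul_ne_top (by norm_num) (hDt n)
    exact absurd (top_unique (by simpa using this)) (ENNReal.add_ne_top.2 ⟨h8 n, h8 0⟩)
  obtain ⟨g, hg, hlim⟩ := exists_tendsto_eLpNorm_of_sq_le hfL hD0 fun n k => by
    simpa using hdiff n k
  set v : ℝ × ℝ → ℝ := fun p => w 0 p + g p with hv
  have hvL : ∀ R : ℝ, 0 < R → MemLp v 2 (volume.restrict (halfDisc R)) := fun R hR => by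
    obtain ⟨K, hK, hle⟩ := hmK R hR
    exact ((hw 0).2 R hR).1.add (hg.of_measure_le_smul hK hle)
  have h0 : ∀ R : ℝ, 0 < R → Tendsto (fun n => eLpNorm (fun p => w n p - v p) 2
      (volume.restrict (halfDisc R))) atTop (𝓝 0) := fun R hR => by
    obtain ⟨K, hK, hle⟩ := hmK R hR
    have hl := ENNReal.Tendsto.const_mul (a := K ^ (1 / (2 : ℝ≥0∞)).toReal) hlim
      (Or.inr (ENNReal.rpow_ne_top_of_nonneg (by positivity) hK))
    rw [mul_zero] at hl
    refine tendsto_of_tendsto_of_tendsto_of_le_of_le tendsto_const_nhds hl (fun _ => bot_le)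
      fun n => ?_
    have e : (fun p => w n p - v p) = fun p => w n p - w 0 p - g p := by ext p; simp [hv]; ring
    simp only [e]
    refine (eLpNorm_mono_measure _ hle).trans (le_of_eq ?_)
    rw [eLpNorm_smul_measure_of_ne_top (by norm_num), smul_eq_mul]
  have hsub := fun R => Measure.restrict_mono (μ := (volume : Measure (ℝ × ℝ)))
    (halfDisc_subset_halfPlane R) le_rfl
  have h1' : ∀ R : ℝ, 0 < R → Tendsto (fun n => eLpNorm (fun p => (weakGrad (w n) p).1 - G1 p) 2
      (volume.restrict (halfDisc R))) atTop (𝓝 0) := fun R _ =>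
    tendsto_of_tendsto_of_tendsto_of_le_of_le tendsto_const_nhds h1 (fun _ => bot_le)
      fun n => eLpNorm_mono_measure _ (hsub R)
  have h2' : ∀ R : ℝ, 0 < R → Tendsto (fun n => eLpNorm (fun p => (weakGrad (w n) p).2 - G2 p) 2
      (volume.restrict (halfDisc R))) atTop (𝓝 0) := fun R _ =>
    tendsto_of_tendsto_of_tendsto_of_le_of_le tendsto_const_nhds h2 (fun _ => bot_le)
      fun n => eLpNorm_mono_measure _ (hsub R)
  have hG1' := fun (R : ℝ) (_ : 0 < R) => hG1.mono_measure (hsub R)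
  have hG2' := fun (R : ℝ) (_ : 0 < R) => hG2.mono_measure (hsub R)
  have hwg := isWeakGrad_of_tendsto hw hvL hG1' hG2' h0 h1' h2'
  have hvH : v ∈ H := mem_H_of_isWeakGrad hwg fun R hR => ⟨hvL R hR, hG1' R hR, hG2' R hR⟩
  have hvg := hwg.weakGrad_ae_eq
  refine ⟨v, hvH, hvg, ae_Ioi_of_Ioo fun R hR => ?_⟩
  -- by the trace inequality, the traces of `w n` converge to the trace of `v` as well
  obtain ⟨C, hC, hb⟩ := exists_trace_bound hR
  set μ := volume.restrict (Ioo (0 : ℝ) R)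
  have hμ : μ ≤ volume.restrict (Ioi 0) := Measure.restrict_mono Ioo_subset_Ioi_self le_rfl
  have hR2 : 0 < 2 * R := by positivity
  have t1 : Tendsto (fun n => eLpNorm (fun x => trace (w n) x - trace v x) 2 μ ^ 2) atTop (𝓝 0) := by
    have hl := ENNReal.Tendsto.const_mul (a := C) ((ENNReal.Tendsto.pow (n := 2) (h0 _ hR2)).add
      (ENNReal.Tendsto.pow (n := 2) (h2' _ hR2))) (Or.inr hC)
    norm_num at hl
    refine tendsto_of_tendsto_of_tendsto_of_le_of_le tendsto_const_nhds hl (fun _ => bot_le)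
      fun n => ?_
    have hn := hb _ (add_smul_mem_H (hw n) hvH (-1)) _ (isTrace_iff.1
      ((isTrace_trace (hw n)).add_smul (hw n) hvH (isTrace_trace hvH) (-1)) _ hR2)
    have e1 : (fun x => trace (w n) x + -1 * trace v x) = fun x => trace (w n) x - trace v x := by
      ext x; ring
    have e2 : (fun p => w n p + -1 * v p) = fun p => w n p - v p := by ext p; ring
    have e3 : eLpNorm (fun p => (weakGrad (fun p => w n p + -1 * v p) p).2) 2
        (volume.restrict (halfDisc (2 * R))) = eLpNorm (fun p => (weakGrad (w n) p).2 - G2 p) 2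
        (volume.restrict (halfDisc (2 * R))) := by
      refine eLpNorm_congr_ae (ae_halfDisc_of_halfPlane ?_)
      filter_upwards [weakGrad_add_smul (hw n) hvH (-1), hvg] with p k1 k2
      rw [k1, k2]; simp; ring
    rw [e3, e1, e2] at hn
    exact hn
  have t2 : Tendsto (fun n => eLpNorm (fun x => trace (w n) x - τ x) 2 μ ^ 2) atTop (𝓝 0) := by
    have hl := ENNReal.Tendsto.pow (n := 2) h3
    norm_num at hl
    exact tendsto_of_tendsto_of_tendsto_of_le_of_le tendsto_const_nhds hl (fun _ => bot_le)
      fun n => pow_le_pow_left' (eLpNorm_mono_measure _ hμ) 2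
  have mv := (memLp_trace hvH R hR).1
  have t3 := ENNReal.Tendsto.const_mul (a := 4) (t1.add t2) (Or.inr (by norm_num))
  norm_num at t3
  have hz : eLpNorm (fun x => trace v x - τ x) 2 μ ^ 2 ≤ 0 :=
    ge_of_tendsto' t3 fun n => by
      have mn := (memLp_trace (hw n) R hR).1
      have e : (fun x => trace v x - τ x)
          = fun x => -(trace (w n) x - trace v x) + (trace (w n) x - τ x) := by ext x; ring
      have e2 : eLpNorm (fun x => -(trace (w n) x - trace v x)) 2 μ
          = eLpNorm (fun x => trace (w n) x - trace v x) 2 μ := eLpNorm_neg (fun x =>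
            trace (w n) x - trace v x) 2 μ
      rw [e, ← e2]
      exact eLpNorm_add_sq_le (mn.sub mv).neg (mn.sub (hτ R hR).1)
  have hz' : eLpNorm (fun x => trace v x - τ x) 2 μ = 0 := by simpa using hz
  filter_upwards [(eLpNorm_eq_zero_iff (f := fun x => trace v x - τ x) (mv.sub (hτ R hR).1)
    (by norm_num)).1 hz'] with x hx
  exact sub_eq_zero.1 hx

/-! ### A function of finite energy with the required decay -/

/-- A smooth function with square integrable gradient whose values on the positive axis differ from
`x ^ (-1/2)` by a function that is square integrable at infinity. -/
noncomputable def profile (p : ℝ × ℝ) : ℝ := (1 + p.1 ^ 2 + p.2 ^ 2) ^ (-(1 / 4) : ℝ)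

theorem contDiff_profile : ContDiff ℝ ∞ profile := by
  refine ContDiff.rpow_const_of_ne (by fun_prop) fun p => ?_
  positivity

theorem classicalGrad_profile (p : ℝ × ℝ) : classicalGrad profile p =
    (-(1 / 2) * p.1 * (1 + p.1 ^ 2 + p.2 ^ 2) ^ (-(5 / 4) : ℝ),
      -(1 / 2) * p.2 * (1 + p.1 ^ 2 + p.2 ^ 2) ^ (-(5 / 4) : ℝ)) := by
  have hpos : ∀ x y : ℝ, (0 : ℝ) < 1 + x ^ 2 + y ^ 2 := fun x y => by positivity
  have h1 : HasDerivAt (fun x => profile (x, p.2))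
      (-(1 / 2) * p.1 * (1 + p.1 ^ 2 + p.2 ^ 2) ^ (-(5 / 4) : ℝ)) p.1 := by
    have h0 : HasDerivAt (fun x : ℝ => 1 + x ^ 2 + p.2 ^ 2) (2 * p.1) p.1 := by
      simpa using ((hasDerivAt_pow 2 p.1).const_add 1).add_const (p.2 ^ 2)
    convert! h0.rpow_const (p := -(1 / 4)) (Or.inl (hpos p.1 p.2).ne') using 1
    rw [show (-(1 / 4) : ℝ) - 1 = -(5 / 4) by norm_num]
    ring
  have h2 : HasDerivAt (fun y => profile (p.1, y))
      (-(1 / 2) * p.2 * (1 + p.1 ^ 2 + p.2 ^ 2) ^ (-(5 / 4) : ℝ)) p.2 := by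
    have h0 : HasDerivAt (fun y : ℝ => 1 + p.1 ^ 2 + y ^ 2) (2 * p.2) p.2 := by
      simpa using (hasDerivAt_pow 2 p.2).const_add (1 + p.1 ^ 2)
    convert! h0.rpow_const (p := -(1 / 4)) (Or.inl (hpos p.1 p.2).ne') using 1
    rw [show (-(1 / 4) : ℝ) - 1 = -(5 / 4) by norm_num]
    ring
  exact Prod.ext ((hasDerivAt_fst contDiff_profile p.1 p.2).unique h1)
    ((hasDerivAt_snd contDiff_profile p.1 p.2).unique h2)

theorem memLp_two_of_sq_le {f : ℝ × ℝ → ℝ} (hf : Continuous f)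
    (h : ∀ p, f p ^ 2 ≤ (1 + ‖p‖ ^ 2) ^ (-3 / 2 : ℝ)) : MemLp f 2 := by
  rw [memLp_two_iff_integrable_sq hf.aestronglyMeasurable]
  refine Integrable.mono' (integrable_rpow_neg_one_add_norm_sq (μ := volume) (E := ℝ × ℝ) (r := 3)
    (by simp; norm_num)) (hf.pow 2).aestronglyMeasurable (ae_of_all _ fun p => ?_)
  rw [Real.norm_of_nonneg (sq_nonneg _)]
  exact h p

theorem sq_mul_rpow_le {a x y n : ℝ} (ha : a ^ 2 ≤ x ^ 2 + y ^ 2) (hn : n ^ 2 ≤ x ^ 2 + y ^ 2) :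
    (-(1 / 2) * a * (1 + x ^ 2 + y ^ 2) ^ (-(5 / 4) : ℝ)) ^ 2 ≤ (1 + n ^ 2) ^ (-3 / 2 : ℝ) := by
  set s := 1 + x ^ 2 + y ^ 2 with hs
  have hs0 : 0 < s := by positivity
  have e : (s ^ (-(5 / 4) : ℝ)) ^ 2 = s⁻¹ * s ^ (-3 / 2 : ℝ) := by
    rw [← Real.rpow_natCast, ← Real.rpow_mul hs0.le, ← Real.rpow_neg_one, ← Real.rpow_add hs0]
    norm_num
  calc (-(1 / 2) * a * s ^ (-(5 / 4) : ℝ)) ^ 2 = (1 / 4 * a ^ 2 * s⁻¹) * s ^ (-3 / 2 : ℝ) := by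
        rw [mul_pow, e]; ring
    _ ≤ 1 * s ^ (-3 / 2 : ℝ) := by
        gcongr
        rw [← div_eq_mul_inv, div_le_one hs0]
        nlinarith [sq_nonneg a]
    _ ≤ (1 + n ^ 2) ^ (-3 / 2 : ℝ) := by
        rw [one_mul]
        exact Real.rpow_le_rpow_of_nonpos (by positivity) (by linarith) (by norm_num)

theorem norm_sq_le (p : ℝ × ℝ) : ‖p‖ ^ 2 ≤ p.1 ^ 2 + p.2 ^ 2 := by
  rw [Prod.norm_def]
  rcases max_choice ‖p.1‖ ‖p.2‖ with h | h <;> rw [h, Real.norm_eq_abs, sq_abs]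
  · nlinarith [sq_nonneg p.2]
  · nlinarith [sq_nonneg p.1]

theorem memLp_classicalGrad_profile_fst : MemLp (fun p => (classicalGrad profile p).1) 2 := by
  refine memLp_two_of_sq_le (continuous_classicalGrad contDiff_profile).fst fun p => ?_
  rw [classicalGrad_profile]
  exact sq_mul_rpow_le (by nlinarith [sq_nonneg p.2]) (norm_sq_le p)

theorem memLp_classicalGrad_profile_snd : MemLp (fun p => (classicalGrad profile p).2) 2 := by
  refine memLp_two_of_sq_le (continuous_classicalGrad contDiff_profile).snd fun p => ?_
  rw [classicalGrad_profile]
  exact sq_mul_rpow_le (by nlinarith [sq_nonneg p.1]) (norm_sq_le p)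

theorem abs_profile_sub_le {x : ℝ} (hx : 1 < x) :
    |profile (x, 0) - x ^ (-(1 / 2) : ℝ)| ≤ x⁻¹ := by
  have hx0 : 0 < x := by linarith
  set a := x ^ (-(1 / 2) : ℝ) with ha
  set b := profile (x, 0) with hb
  have ha0 : 0 < a := Real.rpow_pos_of_pos hx0 _
  have hb0 : 0 < b := Real.rpow_pos_of_pos (by positivity) _
  have ha2 : a ^ 2 = x⁻¹ := by
    rw [ha, ← Real.rpow_natCast, ← Real.rpow_mul hx0.le]; norm_num [Real.rpow_neg_one]
  have ha4 : a ^ 4 = (x ^ 2)⁻¹ := by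
    rw [show a ^ 4 = (a ^ 2) ^ 2 by ring, ha2, inv_pow]
  have hb4 : b ^ 4 = (1 + x ^ 2)⁻¹ := by
    rw [hb, profile, ← Real.rpow_natCast, ← Real.rpow_mul (by positivity)]
    norm_num [Real.rpow_neg_one]
  have hab : b ≤ a := by
    refine le_of_pow_le_pow_left₀ (n := 4) (by norm_num) ha0.le ?_
    rw [ha4, hb4]
    exact inv_anti₀ (by positivity) (by linarith)
  have hxi : x⁻¹ < 1 := inv_lt_one_of_one_lt₀ hx
  have h4 : a ^ 4 - b ^ 4 ≤ a ^ 8 := by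
    rw [show a ^ 8 = a ^ 4 * a ^ 4 by ring, ha4, hb4]
    have : (x ^ 2)⁻¹ - (1 + x ^ 2)⁻¹ = (x ^ 2)⁻¹ * (1 + x ^ 2)⁻¹ := by field_simp; ring
    rw [this]
    gcongr
    linarith
  have ha1 : a < 1 := Real.rpow_lt_one_of_one_lt_of_neg hx (by norm_num)
  have h5 : (a - b) * a ^ 3 ≤ a ^ 4 - b ^ 4 := by
    have : a ^ 4 - b ^ 4 - (a - b) * a ^ 3 = (a - b) * (a ^ 2 * b + a * b ^ 2 + b ^ 3) := by ring
    have h6 : 0 ≤ (a - b) * (a ^ 2 * b + a * b ^ 2 + b ^ 3) :=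
      mul_nonneg (sub_nonneg.2 hab) (by positivity)
    linarith
  have h6 : a - b ≤ a ^ 5 := by
    have h7 : (a - b) * a ^ 3 ≤ a ^ 5 * a ^ 3 := by
      calc _ ≤ a ^ 8 := h5.trans h4
        _ = _ := by ring
    exact le_of_mul_le_mul_right h7 (by positivity)
  rw [abs_sub_comm, abs_of_nonneg (sub_nonneg.2 hab), ← ha2]
  refine h6.trans ?_
  exact pow_le_pow_of_le_one ha0.le ha1.le (by norm_num)

/-! ### The energy space -/

/-- The Hilbert space `L²(ℝ²₊) × L²(ℝ²₊) × L²(0, ∞)`, in which a function is represented by the two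
components of its gradient and by its (corrected) trace. -/
abbrev EnergySpace : Type :=
  WithLp 2 (Lp ℝ 2 (volume.restrict halfPlane : Measure (ℝ × ℝ)) ×
    WithLp 2 (Lp ℝ 2 (volume.restrict halfPlane : Measure (ℝ × ℝ)) ×
      Lp ℝ 2 (volume.restrict (Ioi 0) : Measure ℝ)))

theorem inner_energySpace (k h : EnergySpace) : inner ℝ k h =
    (∫ p in halfPlane, k.fst p * h.fst p) + (∫ p in halfPlane, k.snd.fst p * h.snd.fst p)
      + ∫ x in Ioi (0 : ℝ), k.snd.snd x * h.snd.snd x := by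
  rw [WithLp.prod_inner_apply, WithLp.prod_inner_apply, ← add_assoc]
  change inner ℝ k.fst h.fst + inner ℝ k.snd.fst h.snd.fst + inner ℝ k.snd.snd h.snd.snd = _
  rw [L2.inner_def, L2.inner_def, L2.inner_def]
  have e : ∀ a b : ℝ, inner ℝ a b = a * b := fun a b => by simp [mul_comm]
  simp only [e]

theorem norm_sq_energySpace (k : EnergySpace) :
    ‖k‖ ^ 2 = ‖k.fst‖ ^ 2 + ‖k.snd.fst‖ ^ 2 + ‖k.snd.snd‖ ^ 2 := by
  rw [WithLp.prod_norm_sq_eq_of_L2, WithLp.prod_norm_sq_eq_of_L2, add_assoc]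

/-- The function `x ^ (-1/2)` on `(1, ∞)`, extended by zero. -/
noncomputable def tail : ℝ → ℝ := (Ioi 1).indicator fun x => x ^ (-(1 / 2) : ℝ)

theorem measurable_tail : Measurable tail := Measurable.indicator (by fun_prop) measurableSet_Ioi

theorem tail_of_lt {x : ℝ} (hx : x < 1) : tail x = 0 :=
  indicator_of_notMem (fun h => absurd hx (not_lt.2 (le_of_lt h))) _

theorem tail_of_gt {x : ℝ} (hx : 1 < x) : tail x = x ^ (-(1 / 2) : ℝ) := indicator_of_mem hx _

theorem memLp_tail (R : ℝ) : MemLp tail 2 (volume.restrict (Ioo 0 R)) := by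
  refine MemLp.of_bound measurable_tail.aestronglyMeasurable 1 (ae_of_all _ fun x => ?_)
  by_cases hx : 1 < x
  · rw [tail_of_gt hx, Real.norm_of_nonneg (by positivity)]
    exact Real.rpow_le_one_of_one_le_of_nonpos hx.le (by norm_num)
  · rw [tail, indicator_of_notMem (show x ∉ Ioi 1 from hx)]; simp

/-- `k` represents `w ∈ H` in the energy space: its components are `∂w/∂x`, `∂w/∂y` and the trace of
`w` minus `s x ^ (-1/2)` on `(1, ∞)`. The functional `J c` involves `s = c / 2`, the test functions
of the weak formulation `s = 0`. -/
structure Represents (s : ℝ) (w : ℝ × ℝ → ℝ) (k : EnergySpace) : Prop where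
  mem : w ∈ H
  fst : k.fst =ᵐ[volume.restrict halfPlane] fun p => (weakGrad w p).1
  snd : k.snd.fst =ᵐ[volume.restrict halfPlane] fun p => (weakGrad w p).2
  trace : k.snd.snd =ᵐ[volume.restrict (Ioi 0)] fun x => trace w x - s * tail x

theorem exists_represents {s : ℝ} {w : ℝ × ℝ → ℝ} (hw : w ∈ H)
    (h1 : MemLp (fun p => (weakGrad w p).1) 2 (volume.restrict halfPlane))
    (h2 : MemLp (fun p => (weakGrad w p).2) 2 (volume.restrict halfPlane))
    (h3 : MemLp (fun x => trace w x - s * tail x) 2 (volume.restrict (Ioi 0))) :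
    ∃ k, Represents s w k :=
  ⟨WithLp.toLp 2 (h1.toLp _, WithLp.toLp 2 (h2.toLp _, h3.toLp _)), hw, h1.coeFn_toLp,
    h2.coeFn_toLp, h3.coeFn_toLp⟩

theorem Represents.add_smul {s t : ℝ} {w v : ℝ × ℝ → ℝ} {k h : EnergySpace}
    (hw : Represents s w k) (hv : Represents t v h) (a : ℝ) :
    Represents (s + a * t) (fun p => w p + a * v p) (k + a • h) where
  mem := add_smul_mem_H hw.mem hv.mem a
  fst := by
    filter_upwards [Lp.coeFn_add k.fst (a • h.fst), Lp.coeFn_smul a h.fst, hw.fst, hv.fst,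
      weakGrad_add_smul hw.mem hv.mem a] with p h1 h2 h3 h4 h5
    rw [WithLp.add_fst, WithLp.smul_fst, h1, Pi.add_apply, h2, Pi.smul_apply, h3, h4, h5]
    simp
  snd := by
    filter_upwards [Lp.coeFn_add k.snd.fst (a • h.snd.fst), Lp.coeFn_smul a h.snd.fst, hw.snd,
      hv.snd, weakGrad_add_smul hw.mem hv.mem a] with p h1 h2 h3 h4 h5
    rw [WithLp.add_snd, WithLp.smul_snd, WithLp.add_fst, WithLp.smul_fst, h1, Pi.add_apply, h2,
      Pi.smul_apply, h3, h4, h5]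
    simp
  trace := by
    filter_upwards [Lp.coeFn_add k.snd.snd (a • h.snd.snd), Lp.coeFn_smul a h.snd.snd, hw.trace,
      hv.trace, trace_add_smul hw.mem hv.mem a] with p h1 h2 h3 h4 h5
    rw [WithLp.add_snd, WithLp.smul_snd, WithLp.add_snd, WithLp.smul_snd, h1, Pi.add_apply, h2,
      Pi.smul_apply, h3, h4, h5]
    simp only [smul_eq_mul]
    ring

theorem isTrace_of_contDiff {u : ℝ × ℝ → ℝ} (hu : ContDiff ℝ ∞ u) :
    IsTrace u (fun x => u (x, 0)) := by
  have hg : ∀ R, weakGrad u =ᵐ[volume.restrict (halfDisc R)] classicalGrad u := fun R =>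
    ae_halfDisc_of_halfPlane (isWeakGrad_classicalGrad hu).weakGrad_ae_eq
  have h0 : ∀ {α : Type} [MeasurableSpace α] (μ : Measure α) (f : α → ℝ), f =ᵐ[μ] 0 →
      Tendsto (fun _ : ℕ => eLpNorm f 2 μ) atTop (𝓝 0) := fun μ f hf => by
    rw [eLpNorm_congr_ae hf]; simp
  refine isTrace_iff.2 fun R hR => ⟨memLp_boundary hu R, fun _ => u, ⟨fun _ => hu, ?_, ?_, ?_⟩, ?_⟩
  · exact h0 _ _ (ae_of_all _ fun p => by simp)
  · exact h0 _ _ ((hg R).mono fun p hp => by simp [hp])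
  · exact h0 _ _ ((hg R).mono fun p hp => by simp [hp])
  · exact h0 _ _ (ae_of_all _ fun p => by simp)

theorem represents_zero : Represents 0 (fun _ => 0) 0 where
  mem := mem_H_of_contDiff contDiff_const
  fst := by
    filter_upwards [Lp.coeFn_zero ℝ 2 (volume.restrict halfPlane), weakGrad_zero] with p h1 h2
    rw [WithLp.zero_fst, h1, h2]; rfl
  snd := by
    filter_upwards [Lp.coeFn_zero ℝ 2 (volume.restrict halfPlane), weakGrad_zero] with p h1 h2
    rw [WithLp.zero_snd, WithLp.zero_fst, h1, h2]; rfl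
  trace := by
    filter_upwards [Lp.coeFn_zero ℝ 2 (volume.restrict (Ioi 0)), trace_ae_eq
      (mem_H_of_contDiff contDiff_const) (isTrace_of_contDiff (u := fun _ => 0) contDiff_const)]
      with p h1 h2
    rw [WithLp.zero_snd, WithLp.zero_snd, h1, h2]; simp

theorem memLp_Ioi_of_Ioo_of_Ioi {f : ℝ → ℝ} (h1 : MemLp f 2 (volume.restrict (Ioo 0 1)))
    (h2 : MemLp f 2 (volume.restrict (Ioi 1))) : MemLp f 2 (volume.restrict (Ioi 0)) := by
  have h3 : MemLp f 2 (volume.restrict (Ici 1)) := by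
    rwa [← Measure.restrict_congr_set (Ioi_ae_eq_Ici (a := (1 : ℝ)) (μ := volume))]
  have e : Ioi (0 : ℝ) ⊆ Ioo 0 1 ∪ Ici 1 := fun x hx => by
    rcases lt_or_ge x 1 with h | h
    · exact Or.inl ⟨hx, h⟩
    · exact Or.inr h
  have hm : volume.restrict (Ioi (0 : ℝ)) ≤ volume.restrict (Ioo 0 1) + volume.restrict (Ici 1) :=
    (Measure.restrict_mono e le_rfl).trans (Measure.restrict_union_le _ _)
  refine MemLp.mono_measure hm ⟨?_, ?_⟩
  · exact h1.1.add_measure h3.1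
  · refine lt_top_iff_ne_top.2 fun h => ?_
    have h4 : eLpNorm f 2 (volume.restrict (Ioo 0 1) + volume.restrict (Ici 1)) ^ 2 < ⊤ := by
      rw [eLpNorm_two_sq, lintegral_add_measure, ← eLpNorm_two_sq, ← eLpNorm_two_sq]
      exact ENNReal.add_lt_top.2 ⟨ENNReal.pow_lt_top h1.2, ENNReal.pow_lt_top h3.2⟩
    simp [h] at h4

theorem exists_represents_profile : ∃ k, Represents 1 profile k := by
  have hH := mem_H_of_contDiff contDiff_profile
  have hg := (isWeakGrad_classicalGrad contDiff_profile).weakGrad_ae_eq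
  have ht := trace_ae_eq hH (isTrace_of_contDiff contDiff_profile)
  refine exists_represents hH ?_ ?_ ?_
  · exact (memLp_classicalGrad_profile_fst.restrict halfPlane).ae_eq
      (hg.symm.mono fun p hp => by simp only [hp])
  · exact (memLp_classicalGrad_profile_snd.restrict halfPlane).ae_eq
      (hg.symm.mono fun p hp => by simp only [hp])
  · refine MemLp.ae_eq (f := fun x => profile (x, 0) - 1 * tail x)
      (ht.symm.mono fun x hx => by simp only [hx]) (memLp_Ioi_of_Ioo_of_Ioi ?_ ?_)
    · exact (memLp_boundary contDiff_profile 1).sub ((memLp_tail 1).const_mul 1)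
    · have hc : Continuous fun x => profile (x, 0) :=
        contDiff_profile.continuous.comp (Continuous.prodMk_left 0)
      have hm : Measurable fun x => profile (x, 0) - 1 * tail x :=
        hc.measurable.sub (measurable_tail.const_mul 1)
      rw [memLp_two_iff_integrable_sq hm.aestronglyMeasurable]
      have hi : IntegrableOn (fun x : ℝ => x ^ (-2 : ℝ)) (Ioi 1) :=
        integrableOn_Ioi_rpow_of_lt (by norm_num) one_pos
      refine Integrable.mono' hi (hm.pow_const 2).aestronglyMeasurable ?_
      filter_upwards [ae_restrict_mem measurableSet_Ioi] with x hx
      have hx1 : (1 : ℝ) < x := hx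
      have h := abs_profile_sub_le hx1
      rw [Real.norm_of_nonneg (sq_nonneg _), tail_of_gt hx1, one_mul, ← sq_abs,
        show x ^ (-2 : ℝ) = x⁻¹ ^ 2 by rw [Real.rpow_neg (by linarith), Real.rpow_two, inv_pow]]
      exact pow_le_pow_left₀ (abs_nonneg _) h 2

/-- The elements of the energy space that represent functions of `H` with correction `s` form a closed
set. -/
theorem isClosed_setOf_represents (s : ℝ) : IsClosed {k | ∃ w, Represents s w k} := by
  refine IsSeqClosed.isClosed fun k k0 hk hlim => ?_
  choose w hw using hk
  have l1 : Tendsto (fun n => edist (k n).fst k0.fst) atTop (𝓝 0) :=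
    tendsto_iff_edist_tendsto_0.1 (((WithLp.prod_continuous_ofLp 2 _ _).fst.tendsto k0).comp hlim)
  have c2 : Continuous fun k : EnergySpace => k.snd := (WithLp.prod_continuous_ofLp 2 _ _).snd
  have l2 : Tendsto (fun n => edist (k n).snd.fst k0.snd.fst) atTop (𝓝 0) :=
    tendsto_iff_edist_tendsto_0.1
      ((((WithLp.prod_continuous_ofLp 2 _ _).fst.comp c2).tendsto k0).comp hlim)
  have l3 : Tendsto (fun n => edist (k n).snd.snd k0.snd.snd) atTop (𝓝 0) :=
    tendsto_iff_edist_tendsto_0.1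
      ((((WithLp.prod_continuous_ofLp 2 _ _).snd.comp c2).tendsto k0).comp hlim)
  have e1 : ∀ n, edist (k n).fst k0.fst = eLpNorm (fun p => (weakGrad (w n) p).1 - k0.fst p) 2
      (volume.restrict halfPlane) := fun n => by
    rw [Lp.edist_def]
    exact eLpNorm_congr_ae ((hw n).fst.mono fun p hp => by rw [Pi.sub_apply, hp])
  have e2 : ∀ n, edist (k n).snd.fst k0.snd.fst
      = eLpNorm (fun p => (weakGrad (w n) p).2 - k0.snd.fst p) 2
      (volume.restrict halfPlane) := fun n => by
    rw [Lp.edist_def]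
    exact eLpNorm_congr_ae ((hw n).snd.mono fun p hp => by rw [Pi.sub_apply, hp])
  have e3 : ∀ n, edist (k n).snd.snd k0.snd.snd
      = eLpNorm (fun x => MixedHalfPlane.trace (w n) x - (k0.snd.snd x + s * tail x)) 2
      (volume.restrict (Ioi 0)) := fun n => by
    rw [Lp.edist_def]
    exact eLpNorm_congr_ae ((hw n).trace.mono fun p hp => by rw [Pi.sub_apply, hp]; ring)
  obtain ⟨v, hv, h1, h2⟩ := exists_mem_H_of_tendsto (w := w) (fun n => (hw n).mem)
    (G1 := k0.fst) (G2 := k0.snd.fst) (τ := fun x => k0.snd.snd x + s * tail x)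
    (Lp.memLp k0.fst) (Lp.memLp k0.snd.fst) (fun R _ => ((Lp.memLp k0.snd.snd).mono_measure
      (Measure.restrict_mono Ioo_subset_Ioi_self le_rfl)).add ((memLp_tail R).const_mul s))
    (fun n => by rw [← e1]; exact edist_ne_top _ _)
    (fun n => by rw [← e2]; exact edist_ne_top _ _)
    (fun n => by rw [← e3]; exact edist_ne_top _ _)
    (l1.congr e1) (l2.congr e2) (l3.congr e3)
  exact ⟨v, hv, h1.mono fun p hp => by simp only [hp], h1.mono fun p hp => by simp only [hp],
    h2.mono fun x hx => by simp only [hx]; ring⟩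

theorem convex_setOf_represents (s : ℝ) : Convex ℝ {k | ∃ w, Represents s w k} := by
  rintro k ⟨w, hw⟩ h ⟨v, hv⟩ a b - - hab
  have := hw.add_smul (hv.add_smul hw (-1)) b
  rw [show s + b * (s + -1 * s) = s by ring,
    show k + b • (h + (-1 : ℝ) • k) = a • k + b • h by
      rw [← eq_sub_iff_add_eq] at hab; rw [hab]; module] at this
  exact ⟨_, this⟩

theorem nonempty_setOf_represents (s : ℝ) : {k | ∃ w, Represents s w k}.Nonempty := by
  obtain ⟨k, hk⟩ := exists_represents_profile
  have := represents_zero.add_smul hk s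
  rw [show 0 + s * 1 = s by ring] at this
  exact ⟨_, _, this⟩

/-! ### The linear term -/

/-- The linear functional `∫₀¹ x ^ (-1/2) w(x, 0) dx`, in terms of the representative of `w`. -/
noncomputable def weightIntegral (k : EnergySpace) : ℝ :=
  ∫ x in Ioo (0 : ℝ) 1, x ^ (-(1 / 2) : ℝ) * k.snd.snd x

theorem Represents.trace_Ioo {s : ℝ} {w : ℝ × ℝ → ℝ} {k : EnergySpace} (h : Represents s w k) :
    k.snd.snd =ᵐ[volume.restrict (Ioo 0 1)] MixedHalfPlane.trace w := by
  filter_upwards [ae_restrict_of_ae_restrict_of_subset Ioo_subset_Ioi_self h.trace,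
    ae_restrict_mem measurableSet_Ioo] with x hx hx1
  rw [hx, tail_of_lt hx1.2]; ring

theorem exists_weightIntegral_bound : ∃ C : ℝ, ∀ s w k, Represents s w k →
    IntegrableOn (fun x => x ^ (-(1 / 2) : ℝ) * k.snd.snd x) (Ioo 0 1) ∧
    |weightIntegral k| ≤ C * (1 + ‖k‖ ^ 2) := by
  obtain ⟨C, hC, hb⟩ := exists_weight_bound
  refine ⟨C.toReal, fun s w k hk => ?_⟩
  have h1 := hb w hk.mem
  have hle : ∫⁻ x in Ioo (0 : ℝ) 1, ‖x ^ (-(1 / 2) : ℝ) * k.snd.snd x‖ₑ ≤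
      C * (1 + ‖k.snd.snd‖ₑ ^ 2 + ‖k.fst‖ₑ ^ 2 + ‖k.snd.fst‖ₑ ^ 2) := by
    calc ∫⁻ x in Ioo (0 : ℝ) 1, ‖x ^ (-(1 / 2) : ℝ) * k.snd.snd x‖ₑ
        = ∫⁻ x in Ioo (0 : ℝ) 1,
          ENNReal.ofReal (x ^ (-(1 / 2) : ℝ)) * ‖MixedHalfPlane.trace w x‖ₑ := by
          refine lintegral_congr_ae ?_
          filter_upwards [hk.trace_Ioo, ae_restrict_mem measurableSet_Ioo] with x hx hx1
          rw [enorm_mul, hx, Real.enorm_of_nonneg (Real.rpow_nonneg hx1.1.le _)]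
      _ ≤ _ := h1
      _ ≤ _ := by
          rw [Lp.enorm_def, Lp.enorm_def, Lp.enorm_def, eLpNorm_congr_ae hk.fst,
            eLpNorm_congr_ae hk.snd, ← eLpNorm_congr_ae hk.trace_Ioo]
          gcongr
          · exact Ioo_subset_Ioi_self
          · exact halfDisc_subset_halfPlane _
          · exact halfDisc_subset_halfPlane _
  have hfin : C * (1 + ‖k.snd.snd‖ₑ ^ 2 + ‖k.fst‖ₑ ^ 2 + ‖k.snd.fst‖ₑ ^ 2) ≠ ⊤ := by
    finiteness
  have hmeas : AEStronglyMeasurable (fun x => x ^ (-(1 / 2) : ℝ) * k.snd.snd x)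
      (volume.restrict (Ioo 0 1)) := by
    refine AEStronglyMeasurable.mul (by fun_prop) ?_
    exact (Lp.aestronglyMeasurable k.snd.snd).mono_measure
      (Measure.restrict_mono Ioo_subset_Ioi_self le_rfl)
  refine ⟨⟨hmeas, hle.trans_lt (lt_top_iff_ne_top.2 hfin)⟩, ?_⟩
  have h2 : ‖weightIntegral k‖ₑ ≤ _ := (enorm_integral_le_lintegral_enorm _).trans hle
  have h3 := ENNReal.toReal_mono hfin h2
  rw [toReal_enorm, Real.norm_eq_abs] at h3
  refine h3.trans (le_of_eq ?_)
  rw [ENNReal.toReal_mul, ENNReal.toReal_add (by finiteness) (by finiteness),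
    ENNReal.toReal_add (by finiteness) (by finiteness),
    ENNReal.toReal_add (by finiteness) (by finiteness), norm_sq_energySpace]
  simp only [ENNReal.toReal_one, ENNReal.toReal_pow, toReal_enorm]
  ring

/-- The subspace of the energy space formed by the representatives of functions of `H`. -/
noncomputable def representatives : Submodule ℝ EnergySpace where
  carrier := {k | ∃ s w, Represents s w k}
  zero_mem' := ⟨0, _, represents_zero⟩
  add_mem' := by
    rintro k h ⟨s, w, hw⟩ ⟨t, v, hv⟩
    have := hw.add_smul hv 1
    rw [one_smul] at this
    exact ⟨_, _, this⟩
  smul_mem' := by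
    rintro a k ⟨s, w, hw⟩
    have := represents_zero.add_smul hw a
    rw [zero_add (a • k)] at this
    exact ⟨_, _, this⟩

/-- Riesz representation of the linear term: it is bounded on the representatives by the weighted
trace estimate, hence extends to the energy space by the Hahn-Banach theorem. -/
theorem exists_forall_weightIntegral_eq_inner : ∃ f : EnergySpace, ∀ s w k, Represents s w k →
    weightIntegral k = inner ℝ f k := by
  obtain ⟨C, hC⟩ := exists_weightIntegral_bound
  have hint : ∀ k ∈ representatives,
      IntegrableOn (fun x => x ^ (-(1 / 2) : ℝ) * k.snd.snd x) (Ioo 0 1) := by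
    rintro k ⟨s, w, hk⟩
    exact (hC s w k hk).1
  have hsmul : ∀ (a : ℝ) (k : EnergySpace), weightIntegral (a • k) = a * weightIntegral k := by
    intro a k
    rw [weightIntegral, weightIntegral, ← integral_const_mul]
    refine integral_congr_ae ?_
    filter_upwards [ae_restrict_of_ae_restrict_of_subset Ioo_subset_Ioi_self
      (Lp.coeFn_smul a k.snd.snd)] with x hx
    rw [WithLp.smul_snd, WithLp.smul_snd, hx, Pi.smul_apply, smul_eq_mul]
    ring
  let ℓ : representatives →ₗ[ℝ] ℝ :=
    { toFun := fun k => weightIntegral k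
      map_add' := fun k h => by
        rw [weightIntegral, weightIntegral, weightIntegral,
          ← integral_add (hint k k.2) (hint h h.2)]
        refine integral_congr_ae ?_
        filter_upwards [ae_restrict_of_ae_restrict_of_subset Ioo_subset_Ioi_self
          (Lp.coeFn_add (k : EnergySpace).snd.snd (h : EnergySpace).snd.snd)] with x hx
        rw [Submodule.coe_add, WithLp.add_snd, WithLp.add_snd, hx, Pi.add_apply]
        ring
      map_smul' := fun a k => hsmul a k }
  have hℓ : ∀ k : representatives, ‖ℓ k‖ ≤ (2 * C) * ‖k‖ := by
    intro k
    rcases eq_or_ne k 0 with rfl | hk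
    · simp
    -- the quadratic bound is applied on the unit sphere
    have hn : 0 < ‖k‖ := norm_pos_iff.2 hk
    obtain ⟨s, w, hr⟩ := (‖k‖⁻¹ • k).2
    have h1 := (hC s w _ hr).2
    have h2 : ‖((‖k‖⁻¹ • k : representatives) : EnergySpace)‖ = 1 := by
      rw [← Submodule.coe_norm, norm_smul, norm_inv, norm_norm, inv_mul_cancel₀ hn.ne']
    rw [h2, Submodule.coe_smul, hsmul, abs_mul, abs_inv, abs_norm] at h1
    rw [Real.norm_eq_abs]
    change |weightIntegral k| ≤ _
    rw [inv_mul_le_iff₀ hn] at h1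
    linarith
  obtain ⟨g, hg, -⟩ := exists_extension_norm_eq representatives (ℓ.mkContinuous _ hℓ)
  refine ⟨(InnerProductSpace.toDual ℝ EnergySpace).symm g, fun s w k hk => ?_⟩
  rw [InnerProductSpace.toDual_symm_apply]
  exact (hg ⟨k, s, w, hk⟩).symm

/-! ### The functional in the energy space -/

theorem memLp_two_of_lintegral_ofReal_sq_lt_top {α : Type*} [MeasurableSpace α] {μ : Measure α}
    {f : α → ℝ} (hf : AEStronglyMeasurable f μ) (h : ∫⁻ x, ENNReal.ofReal (f x ^ 2) ∂μ < ⊤) :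
    MemLp f 2 μ := by
  refine ⟨hf, lt_top_iff_ne_top.2 fun htop => ?_⟩
  have h1 : eLpNorm f 2 μ ^ 2 < ⊤ := by
    rw [eLpNorm_two_sq]
    refine lt_of_eq_of_lt (lintegral_congr fun x => ?_) h
    rw [Real.enorm_eq_ofReal_abs, ← ENNReal.ofReal_pow (abs_nonneg _), sq_abs]
  simp [htop] at h1

theorem coe_lintegral_ofReal {α : Type*} [MeasurableSpace α] {μ : Measure α} {f : α → ℝ}
    (hf : Integrable f μ) (h0 : ∀ x, 0 ≤ f x) :
    ((∫⁻ x, ENNReal.ofReal (f x) ∂μ : ℝ≥0∞) : EReal) = ((∫ x, f x ∂μ : ℝ) : EReal) := by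
  rw [← ofReal_integral_eq_lintegral_ofReal hf (ae_of_all _ h0), EReal.coe_ennreal_ofReal,
    max_eq_left (integral_nonneg h0)]

theorem setIntegral_Ioi_zero_eq_add {f : ℝ → ℝ} (h0 : IntegrableOn f (Ioo 0 1))
    (h1 : IntegrableOn f (Ioi 1)) :
    ∫ x in Ioi (0 : ℝ), f x = (∫ x in Ioo (0 : ℝ) 1, f x) + ∫ x in Ioi (1 : ℝ), f x := by
  rw [← Ioc_union_Ioi_eq_Ioi (zero_le_one' ℝ), setIntegral_union (Ioc_disjoint_Ioi le_rfl)
    measurableSet_Ioi ((integrableOn_Ioc_iff_integrableOn_Ioo (by simp)).2 h0) h1,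
    integral_Ioc_eq_integral_Ioo]

/-- Functions of `H` at which `J c` is finite have a representative in the energy space. -/
theorem exists_represents_of_J_ne_top {c : ℝ} {w : ℝ × ℝ → ℝ} (hw : w ∈ H) (hJ : J c w ≠ ⊤) :
    ∃ k, Represents (c / 2) w k := by
  set a := ∫⁻ p in halfPlane, ENNReal.ofReal ((weakGrad w p).1 ^ 2 + (weakGrad w p).2 ^ 2) with ha
  set b := ∫ x in Ioo (0 : ℝ) 1,
      (trace w x ^ 2 - c * x ^ (-(1 / 2) : ℝ) * trace w x) with hb
  set d := ∫⁻ x in Ioi (1 : ℝ),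
      ENNReal.ofReal ((trace w x - c / 2 * x ^ (-(1 / 2) : ℝ)) ^ 2) with hd
  have hJ' : J c w = (a : EReal) + (b : EReal) + (d : EReal) := rfl
  rw [hJ'] at hJ
  have hat : a ≠ ⊤ := by
    intro h
    rw [h, EReal.coe_ennreal_top, EReal.top_add_coe, EReal.top_add_of_ne_bot
      (EReal.coe_ennreal_ne_bot d)] at hJ
    exact hJ rfl
  have hdt : d ≠ ⊤ := by
    intro h
    rw [h, EReal.coe_ennreal_top, EReal.add_top_of_ne_bot] at hJ
    · exact hJ rfl
    · rw [Ne, EReal.add_eq_bot_iff, not_or]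
      exact ⟨EReal.coe_ennreal_ne_bot a, EReal.coe_ne_bot b⟩
  have mg := aestronglyMeasurable_weakGrad hw
  refine exists_represents hw (memLp_two_of_lintegral_ofReal_sq_lt_top mg.fst ?_)
    (memLp_two_of_lintegral_ofReal_sq_lt_top mg.snd ?_) (memLp_Ioi_of_Ioo_of_Ioi ?_ ?_)
  · refine lt_of_le_of_lt (lintegral_mono fun p => ?_) (lt_top_iff_ne_top.2 hat)
    exact ENNReal.ofReal_le_ofReal (by nlinarith [sq_nonneg (weakGrad w p).2])
  · refine lt_of_le_of_lt (lintegral_mono fun p => ?_) (lt_top_iff_ne_top.2 hat)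
    exact ENNReal.ofReal_le_ofReal (by nlinarith [sq_nonneg (weakGrad w p).1])
  · exact (memLp_trace hw 1 one_pos).sub ((memLp_tail 1).const_mul _)
  · refine memLp_two_of_lintegral_ofReal_sq_lt_top ?_ ?_
    · exact ((aestronglyMeasurable_trace hw).mono_measure
        (Measure.restrict_mono (Ioi_subset_Ioi zero_le_one) le_rfl)).sub
        (measurable_tail.const_mul _).aestronglyMeasurable
    · refine lt_of_eq_of_lt (setLIntegral_congr_fun measurableSet_Ioi fun x hx => ?_)
        (lt_top_iff_ne_top.2 hdt)
      simp only [tail_of_gt hx]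

/-- In the energy space the functional is the square of the norm minus a linear functional. -/
theorem J_eq {c : ℝ} {w : ℝ × ℝ → ℝ} {k : EnergySpace} (hk : Represents (c / 2) w k) :
    J c w = ((‖k‖ ^ 2 - c * weightIntegral k : ℝ) : EReal) := by
  obtain ⟨C, hC⟩ := exists_weightIntegral_bound
  have iW := (hC _ _ _ hk).1
  have s1 := (Lp.memLp k.fst).integrable_sq
  have s2 := (Lp.memLp k.snd.fst).integrable_sq
  have s3 := (Lp.memLp k.snd.snd).integrable_sq
  have s30 : IntegrableOn (fun x => k.snd.snd x ^ 2) (Ioo 0 1) :=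
    s3.mono_measure (Measure.restrict_mono Ioo_subset_Ioi_self le_rfl)
  have s31 : IntegrableOn (fun x => k.snd.snd x ^ 2) (Ioi 1) :=
    s3.mono_measure (Measure.restrict_mono (Ioi_subset_Ioi zero_le_one) le_rfl)
  have e1 : ∫⁻ p in halfPlane, ENNReal.ofReal ((weakGrad w p).1 ^ 2 + (weakGrad w p).2 ^ 2)
      = ∫⁻ p in halfPlane, ENNReal.ofReal (k.fst p ^ 2 + k.snd.fst p ^ 2) := by
    refine lintegral_congr_ae ?_
    filter_upwards [hk.fst, hk.snd] with p h1 h2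
    rw [h1, h2]
  have e2 : ∫ x in Ioo (0 : ℝ) 1, (trace w x ^ 2 - c * x ^ (-(1 / 2) : ℝ) * trace w x)
      = (∫ x in Ioo (0 : ℝ) 1, k.snd.snd x ^ 2) - c * weightIntegral k := by
    rw [weightIntegral, ← integral_const_mul, ← integral_sub s30 (iW.const_mul c)]
    refine integral_congr_ae ?_
    filter_upwards [hk.trace_Ioo] with x hx
    rw [hx]; ring
  have e3 : ∫⁻ x in Ioi (1 : ℝ), ENNReal.ofReal ((trace w x - c / 2 * x ^ (-(1 / 2) : ℝ)) ^ 2)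
      = ∫⁻ x in Ioi (1 : ℝ), ENNReal.ofReal (k.snd.snd x ^ 2) := by
    refine lintegral_congr_ae ?_
    filter_upwards [ae_restrict_of_ae_restrict_of_subset (Ioi_subset_Ioi zero_le_one) hk.trace,
      ae_restrict_mem measurableSet_Ioi] with x hx hx1
    rw [hx, tail_of_gt hx1]
  have e4 : ∫ x in Ioi (0 : ℝ), k.snd.snd x ^ 2
      = (∫ x in Ioo (0 : ℝ) 1, k.snd.snd x ^ 2) + ∫ x in Ioi (1 : ℝ), k.snd.snd x ^ 2 :=
    setIntegral_Ioi_zero_eq_add s30 s31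
  have e5 : ‖k‖ ^ 2 = (∫ p in halfPlane, (k.fst p ^ 2 + k.snd.fst p ^ 2))
      + ∫ x in Ioi (0 : ℝ), k.snd.snd x ^ 2 := by
    rw [← real_inner_self_eq_norm_sq, inner_energySpace, integral_add s1 s2]
    simp only [sq]
  rw [J, e1, e2, e3, coe_lintegral_ofReal (f := fun p => k.fst p ^ 2 + k.snd.fst p ^ 2) (s1.add s2)
      fun p => by positivity,
    coe_lintegral_ofReal s31 fun p => by positivity, ← EReal.coe_add, ← EReal.coe_add, e5, e4]
  congr 1
  ring

theorem eq_zero_of_forall_quadratic_nonneg {a b : ℝ} (hb : 0 ≤ b)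
    (h : ∀ t : ℝ, 0 ≤ 2 * t * a + t ^ 2 * b) : a = 0 := by
  have h1 := h (-(a / (b + 1)))
  have hb1 : 0 < b + 1 := by linarith
  have e : 2 * -(a / (b + 1)) * a + (-(a / (b + 1))) ^ 2 * b
      = -(a ^ 2 * (b + 2)) / (b + 1) ^ 2 := by field_simp; ring
  rw [e, le_div_iff₀ (by positivity), zero_mul] at h1
  have h2 : a ^ 2 * (b + 2) ≤ 0 := by linarith
  by_contra ha
  have : 0 < a ^ 2 * (b + 2) := by positivity
  linarith

/-- The weak formulation, from the vanishing of the first variation in the energy space. -/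
theorem isWeakSolution_of_inner_eq_zero {c : ℝ} {w : ℝ × ℝ → ℝ} {k : EnergySpace}
    (hk : Represents (c / 2) w k)
    (h0 : ∀ v h, Represents 0 v h → inner ℝ k h - c / 2 * weightIntegral h = 0) :
    IsWeakSolution c w := by
  intro φ hφ ζ hζ g1 g2 hζL
  have hζt := trace_ae_eq hφ hζ
  obtain ⟨h, hh⟩ := exists_represents (s := 0) hφ g1 g2
    (hζL.ae_eq (hζt.mono fun x hx => by simp only [hx]; ring))
  obtain ⟨C, hC⟩ := exists_weightIntegral_bound
  have iW := (hC _ _ _ hh).1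
  have i1 : IntegrableOn (fun p => k.fst p * h.fst p) halfPlane :=
    (Lp.memLp k.fst).integrable_mul (Lp.memLp h.fst)
  have i2 : IntegrableOn (fun p => k.snd.fst p * h.snd.fst p) halfPlane :=
    (Lp.memLp k.snd.fst).integrable_mul (Lp.memLp h.snd.fst)
  have i3 : IntegrableOn (fun x => k.snd.snd x * h.snd.snd x) (Ioi 0) :=
    (Lp.memLp k.snd.snd).integrable_mul (Lp.memLp h.snd.snd)
  have ae1 : (fun p => k.fst p * h.fst p + k.snd.fst p * h.snd.fst p)
      =ᵐ[volume.restrict halfPlane] fun p => (weakGrad w p).1 * (weakGrad φ p).1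
        + (weakGrad w p).2 * (weakGrad φ p).2 := by
    filter_upwards [hk.fst, hk.snd, hh.fst, hh.snd] with p h1 h2 h3 h4
    rw [h1, h2, h3, h4]
  set ψ : ℝ → ℝ := (Ioo (0 : ℝ) 1).indicator fun x => x ^ (-(1 / 2) : ℝ) * h.snd.snd x with hψ
  have iψ : Integrable ψ := (integrable_indicator_iff measurableSet_Ioo).2 iW
  have iψ' : IntegrableOn (fun x => c / 2 * ψ x) (Ioi 0) := (iψ.const_mul (c / 2)).integrableOn
  have hψint : ∫ x in Ioi (0 : ℝ), ψ x = weightIntegral h := by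
    rw [weightIntegral, hψ, setIntegral_indicator measurableSet_Ioo,
      inter_eq_self_of_subset_right Ioo_subset_Ioi_self]
  have hne : ∀ᵐ x : ℝ, x ≠ 1 := by
    rw [ae_iff]
    simp
  have ae2 : (fun x => k.snd.snd x * h.snd.snd x - c / 2 * ψ x) =ᵐ[volume.restrict (Ioi 0)]
      fun x => (trace w x - c / 2 * x ^ (-(1 / 2) : ℝ)) * ζ x := by
    filter_upwards [hk.trace, hh.trace, hζt, ae_restrict_of_ae hne,
      ae_restrict_mem measurableSet_Ioi] with x h1 h2 h3 h4 h5
    have e : h.snd.snd x = ζ x := by rw [h2, h3]; ring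
    rcases lt_or_gt_of_ne h4 with hx | hx
    · rw [hψ, indicator_of_mem (show x ∈ Ioo (0 : ℝ) 1 from ⟨h5, hx⟩), h1, tail_of_lt hx, e]
      ring
    · rw [hψ, indicator_of_notMem (fun hm : x ∈ Ioo (0 : ℝ) 1 => absurd hx (not_lt.2 hm.2.le)), h1,
        tail_of_gt hx, e]
      ring
  refine ⟨(i1.add i2).congr ae1, (i3.sub iψ').congr ae2, ?_⟩
  have e := h0 φ h hh
  rw [inner_energySpace] at e
  rw [← integral_congr_ae ae1, ← integral_congr_ae ae2, integral_add i1 i2, integral_sub i3 iψ',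
    integral_const_mul, hψint]
  linarith

end MixedHalfPlane

open MixedHalfPlane in
theorem proposition4p4 (c : ℝ) :
    (∃ a : ℝ, MixedHalfPlane.A c = (a : EReal)) ∧
    (∃ w ∈ MixedHalfPlane.H, MixedHalfPlane.J c w = MixedHalfPlane.A c) ∧
    (∀ w ∈ MixedHalfPlane.H, MixedHalfPlane.J c w = MixedHalfPlane.A c →
      MixedHalfPlane.IsWeakSolution c w) := by
  obtain ⟨f, hf⟩ := exists_forall_weightIntegral_eq_inner
  set K : Set EnergySpace := {k | ∃ w, Represents (c / 2) w k} with hK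
  set u : EnergySpace := (c / 2) • f with hu
  -- completing the square: `J c` is the squared distance to `u`, up to a constant
  have hJ : ∀ w k, Represents (c / 2) w k →
      J c w = ((‖u - k‖ ^ 2 - ‖u‖ ^ 2 : ℝ) : EReal) := by
    intro w k hk
    rw [J_eq hk, hf _ _ _ hk, norm_sub_sq_real, hu, inner_smul_left]
    simp only [conj_trivial]
    congr 1
    ring
  obtain ⟨k0, ⟨w0, hw0⟩, hmin⟩ := exists_norm_eq_iInf_of_complete_convex
    (nonempty_setOf_represents (c / 2)) (isClosed_setOf_represents (c / 2)).isComplete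
    (convex_setOf_represents (c / 2)) u
  have hle : ∀ k ∈ K, ‖u - k0‖ ≤ ‖u - k‖ := fun k hk => by
    rw [hmin]
    exact ciInf_le ⟨0, by rintro _ ⟨k, rfl⟩; exact norm_nonneg _⟩ (⟨k, hk⟩ : K)
  have hA : A c = J c w0 := by
    refine le_antisymm (iInf₂_le w0 hw0.mem) (le_iInf₂ fun w hw => ?_)
    by_cases htop : J c w = ⊤
    · rw [htop]; exact le_top
    · obtain ⟨k, hk⟩ := exists_represents_of_J_ne_top hw htop
      rw [hJ w k hk, hJ w0 k0 hw0, EReal.coe_le_coe_iff]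
      have := pow_le_pow_left₀ (norm_nonneg _) (hle k ⟨w, hk⟩) 2
      linarith
  refine ⟨⟨_, hA.trans (hJ w0 k0 hw0)⟩, ⟨w0, hw0.mem, hA.symm⟩, fun w hw hwA => ?_⟩
  have hval := hwA.trans (hA.trans (hJ w0 k0 hw0))
  obtain ⟨k, hk⟩ := exists_represents_of_J_ne_top hw (by rw [hval]; exact EReal.coe_ne_top _)
  rw [hJ w k hk, EReal.coe_eq_coe_iff] at hval
  refine isWeakSolution_of_inner_eq_zero hk fun v h hv => ?_
  -- the first variation of the squared distance in the direction `h` vanishes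
  have hvar : inner ℝ (k - u) h = 0 := by
    refine eq_zero_of_forall_quadratic_nonneg (sq_nonneg ‖h‖) fun t => ?_
    have h1 := hk.add_smul hv t
    rw [mul_zero, add_zero (c / 2)] at h1
    have h2 := pow_le_pow_left₀ (norm_nonneg _) (hle _ ⟨_, h1⟩) 2
    have h3 : ‖u - (k + t • h)‖ ^ 2
        = ‖u - k‖ ^ 2 + 2 * t * inner ℝ (k - u) h + t ^ 2 * ‖h‖ ^ 2 := by
      rw [show u - (k + t • h) = -((k - u) + t • h) by abel, norm_neg, norm_add_sq_real,
        inner_smul_right, norm_smul, mul_pow, Real.norm_eq_abs, sq_abs, norm_sub_rev k u]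
      ring
    linarith
  rw [inner_sub_left, hu, inner_smul_left] at hvar
  rw [hf _ _ _ hv]
  simpa using hvar
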